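/- **Setting.** Let $k$ be a complete non-Archimedean (non-trivially valued) field, $\mathbb{P}^{1,\mathrm{an}}_k$ its Berkovich projective line, $\mathbb{H}_k\subset\mathbb{P}^{1,\mathrm{an}}_k$ the set of points which are not of type 1 (i.e. not images of points of $\mathbb{P}^1$ of the completed algebraic closure of $k$), and $\rho$ the interval length (path distance) metric on $\mathbb{H}_k$. Let $\Gamma\subseteq \mathrm{PGL}_2(k)$ be a Schottky group of rank $g>1$: $\Gamma$ is free and finitely generated, its non-trivial elements are loxodromic, and there is a non-empty connected open $\Gamma$-invariant subset of $\mathbb{P}^{1,\mathrm{an}}_k$ on which $\Gamma$ acts freely and properly. Let $\mathcal D$ be a Schottky figure adapted to a basis $(\gamma_1,\dots,\gamma_g)$ of $\Gamma$ (a generating family with $g$ elements): pairwise disjoint closed disks $D_a$ in $\mathbb{P}^{1,\mathrm{an}}_k$, for $a\in\mathcal A=\{\gamma_1,\gamma_1^{-1},\dots,\gamma_g,\gamma_g^{-1}\}$, and maximal open disks $D_a^\circ$ inside $D_a$, with $a(D_{a^{-1}}^c)=D_a^\circ$ for all $a\in\mathcal A$. Denote by $\partial D_a$ the unique boundary point of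 $D_a$, and let $$F=\mathbb{P}^{1,\mathrm{an}}_k\setminus\Big(\bigcup_{i} D_{\gamma_i}\cup\bigcup_i D^\circ_{\gamma_i^{-1}}\Big).$$ For $s\in\mathbb{C}$ let $M(s)=(m_{a,b}(s))_{a,b\in\mathcal A}$ be the $2g\times 2g$ matrix with $m_{a,b}(s)=e^{-s\rho(\partial D_{a^{-1}},\partial D_b)}$ if $a^{-1}\neq b$ and $m_{a,b}(s)=0$ if $a^{-1}=b$. For $x,y\in\mathbb{H}_k$ let $X_x(s)=(e^{-s\rho(x,\partial D_a)})_{a\in\mathcal A}$ and $Y_y(s)=(e^{-s\rho(y,\partial D_{a^{-1}})})_{a\in\mathcal A}$ (row vectors). The Poincaré series is $\mathcal P_{x,y}(s)=\sum_{\gamma\in\Gamma}e^{-s\rho(x,\gamma y)}$, $s\in\mathbb{R}_{\ge 0}$. **Theorem.** Every point of $\mathbb{H}_k$ has a $\Gamma$-translate in $F$. Let $x,y\in\mathbb{H}_k$, and let $\alpha,\beta\in\Gamma$ be such that $\alpha x,\beta y\in F$ (one may take $\alpha=\beta=\mathrm{id}$ if $x,y\in F$). Then $\mathcal P_{x,y}(s)$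 converges for all large real $s$; $I-M(s)$ is invertible for all $s\in\mathbb{C}$ outside a closed discrete set, and at every real $s\ge 0$ where $\mathcal P_{x,y}(s)$ converges; and $\mathcal P_{x,y}$ extends to a meromorphic function on $\mathbb{C}$ (which equals the series at every real $s\geq 0$ where the series converges), given by $$\mathcal P_{x,y}(s)=X_{\alpha x}(s)\,(I-M(s))^{-1}\,Y_{\beta y}(s)^{t}+e^{-s\rho(\alpha x,\beta y)}$$ at every $s$ where $I-M(s)$ is invertible. This extension is analytic at $s=0$, and $$\mathcal P_{x,y}(0)=\frac{1}{1-g}.$$ -/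

import Mathlib

open scoped Polynomial MatrixGroups OnePoint

noncomputable section

namespace Berkovich

/-! ### The Berkovich projective line -/

section Line

variable (k : Type*) [NormedField k]

/-- The Berkovich affine line over `k`: multiplicative seminorms on `k[T]` which extend the norm
of `k`. -/
structure AffineLine where
  seminorm : MulRingSeminorm k[X]
  map_C : ∀ a : k, seminorm (Polynomial.C a) = ‖a‖

/-- The Berkovich topology: the coarsest one for which all evaluations `x ↦ |P|_x` are
continuous. -/
instance : TopologicalSpace (AffineLine k) :=
  TopologicalSpace.induced (fun x (P : k[X]) => x.seminorm P) inferInstance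

/-- The Berkovich projective line: the affine line together with a point `∞`. As the affine line
is locally compact Hausdorff and the projective line is compact Hausdorff, the topology is that of
the one-point compactification. -/
abbrev ProjLine := OnePoint (AffineLine k)

end Line

section Action

variable {k : Type*} [NormedField k]

/-- The pull-back of a multiplicative seminorm along a ring homomorphism. -/
def pullback {R S : Type*} [Ring R] [Ring S] (f : R →+* S) (v : MulRingSeminorm S) :
    MulRingSeminorm R where
  toFun r := v (f r)
  map_zero' := by simp
  add_le' a b := by simpa using map_add_le_add v (f a) (f b)
  neg' a := by simp
  map_one' := by simp
  map_mul' a b := by simp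

@[simp] theorem pullback_apply {R S : Type*} [Ring R] [Ring S] (f : R →+* S)
    (v : MulRingSeminorm S) (r : R) : pullback f v r = v (f r) := rfl

/-- A point of the projective line as a seminorm in homogeneous coordinates `X₀, X₁` with
`T = X₀ / X₁`: an affine point is evaluated at `(T, 1)`, and `∞` at `(1, 0)`. -/
def homSeminorm (p : ProjLine k) : MulRingSeminorm (MvPolynomial (Fin 2) k) :=
  p.elim (pullback (MvPolynomial.eval ![1, 0]) (NormedField.toMulRingNorm k).toMulRingSeminorm)
    fun x => pullback (MvPolynomial.aeval ![Polynomial.X, 1] :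
      MvPolynomial (Fin 2) k →ₐ[k] k[X]).toRingHom x.seminorm

theorem homSeminorm_infty (F : MvPolynomial (Fin 2) k) :
    homSeminorm ∞ F = ‖MvPolynomial.eval ![1, 0] F‖ := rfl

theorem homSeminorm_coe (x : AffineLine k) (F : MvPolynomial (Fin 2) k) :
    homSeminorm (x : ProjLine k) F = x.seminorm (MvPolynomial.aeval ![Polynomial.X, 1] F) := rfl

theorem homSeminorm_C (p : ProjLine k) (a : k) : homSeminorm p (MvPolynomial.C a) = ‖a‖ := by
  induction p with
  | none => exact (homSeminorm_infty _).trans (by simp)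
  | some x => exact (homSeminorm_coe x _).trans (by simpa using x.map_C a)

/-- The substitution `(X₀, X₁) ↦ (a X₀ + b X₁, c X₀ + d X₁)` for `g = (a b; c d)`. -/
def subst (g : Matrix (Fin 2) (Fin 2) k) :
    MvPolynomial (Fin 2) k →ₐ[k] MvPolynomial (Fin 2) k :=
  MvPolynomial.aeval fun i =>
    MvPolynomial.C (g i 0) * MvPolynomial.X 0 + MvPolynomial.C (g i 1) * MvPolynomial.X 1

theorem apply_homogenize (h : MulRingSeminorm (MvPolynomial (Fin 2) k)) (P : k[X]) {n : ℕ}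
    (hn : P.natDegree ≤ n) :
    h (P.homogenize n) = h (P.homogenize P.natDegree) * h (MvPolynomial.X 1) ^ (n - P.natDegree) := by
  have := Polynomial.homogenize_mul P 1 (m := P.natDegree) (n := n - P.natDegree) le_rfl (by simp)
  rw [mul_one, Nat.add_sub_cancel' hn] at this
  rw [this]
  simp

/-- The affine point `P ↦ h (P(X₀ / X₁))` attached to a multiplicative seminorm `h` in homogeneous
coordinates for which `h X₁ ≠ 0`. -/
def dehomogenize (h : MulRingSeminorm (MvPolynomial (Fin 2) k))
    (hC : ∀ a : k, h (MvPolynomial.C a) = ‖a‖) (hX : h (MvPolynomial.X 1) ≠ 0) : AffineLine k where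
  seminorm :=
    have key : ∀ (P : k[X]) {n : ℕ}, P.natDegree ≤ n →
        h (P.homogenize P.natDegree) / h (MvPolynomial.X 1) ^ P.natDegree =
        h (P.homogenize n) / h (MvPolynomial.X 1) ^ n := fun P n hn => by
      rw [apply_homogenize h P hn]
      field_simp
      rw [mul_assoc, ← pow_add, Nat.add_sub_cancel' hn]
    { toFun := fun P => h (P.homogenize P.natDegree) / h (MvPolynomial.X 1) ^ P.natDegree
      map_zero' := by simp
      add_le' := fun P Q => by
        set n := max P.natDegree Q.natDegree
        rw [key P (le_max_left _ _ : _ ≤ n), key Q (le_max_right _ _ : _ ≤ n),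
          key (P + Q) (Polynomial.natDegree_add_le P Q : _ ≤ n), ← add_div,
          Polynomial.homogenize_add]
        gcongr
        exact map_add_le_add h _ _
      neg' := fun P => by simp
      map_one' := by simp
      map_mul' := fun P Q => by
        rw [key (P * Q) Polynomial.natDegree_mul_le, Polynomial.homogenize_mul P Q le_rfl le_rfl,
          map_mul, pow_add, mul_div_mul_comm] }
  map_C a := by
    change h _ / _ = _
    simp [hC]

theorem dehomogenize_apply (h : MulRingSeminorm (MvPolynomial (Fin 2) k))
    (hC : ∀ a : k, h (MvPolynomial.C a) = ‖a‖) (hX : h (MvPolynomial.X 1) ≠ 0) (P : k[X]) {n : ℕ}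
    (hn : P.natDegree ≤ n) : (dehomogenize h hC hX).seminorm P =
      h (P.homogenize n) / h (MvPolynomial.X 1) ^ n := by
  change h _ / _ = _
  rw [apply_homogenize h P hn]
  field_simp
  rw [mul_assoc, ← pow_add, Nat.add_sub_cancel' hn]

open Classical in
/-- The Möbius transformation `T ↦ (a T + b) / (c T + d)` of `g = (a b; c d)` on the projective
line, by pull-back of seminorms: `|P|_{g x} = |P((a T + b) / (c T + d))|_x`, and `g x = ∞` when
`|c T + d|_x = 0`. -/
def moebius (g : GL (Fin 2) k) (p : ProjLine k) : ProjLine k :=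
  if hX : pullback (subst (g : Matrix (Fin 2) (Fin 2) k)).toRingHom (homSeminorm p)
      (MvPolynomial.X 1) = 0 then ∞
  else (dehomogenize (pullback (subst (g : Matrix (Fin 2) (Fin 2) k)).toRingHom (homSeminorm p))
    (fun a => by simpa [subst] using homSeminorm_C p a) hX : AffineLine k)


theorem subst_X (g : Matrix (Fin 2) (Fin 2) k) (i : Fin 2) :
    subst g (MvPolynomial.X i) =
      MvPolynomial.C (g i 0) * MvPolynomial.X 0 + MvPolynomial.C (g i 1) * MvPolynomial.X 1 := by
  rw [subst, MvPolynomial.aeval_X]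

theorem subst_homogeneous (g : Matrix (Fin 2) (Fin 2) k) {F : MvPolynomial (Fin 2) k} {n : ℕ}
    (hF : F.IsHomogeneous n) : (subst g F).IsHomogeneous n := by
  have := hF.aeval (n := 1) (fun i => MvPolynomial.C (g i 0) * MvPolynomial.X 0 +
    MvPolynomial.C (g i 1) * (MvPolynomial.X 1 : MvPolynomial (Fin 2) k)) (fun i =>
      (MvPolynomial.isHomogeneous_C_mul_X _ _).add (MvPolynomial.isHomogeneous_C_mul_X _ _))
  simpa [subst] using this

theorem subst_subst (g h : Matrix (Fin 2) (Fin 2) k) (F : MvPolynomial (Fin 2) k) :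
    subst h (subst g F) = subst (g * h) F := by
  have : (subst h).comp (subst g) = subst (g * h) := by
    ext i : 1
    simp only [subst, AlgHom.comp_apply, MvPolynomial.aeval_X, map_add, map_mul, Matrix.mul_apply,
      Fin.sum_univ_two, MvPolynomial.algHom_C, MvPolynomial.algebraMap_eq]
    ring
  exact congrArg (fun f => f F) this

theorem subst_one (F : MvPolynomial (Fin 2) k) : subst 1 F = F := by
  have : subst (1 : Matrix (Fin 2) (Fin 2) k) = AlgHom.id k _ := by
    ext i : 1
    fin_cases i <;> simp [subst]
  simp [this]

theorem natDegree_aeval_le {F : MvPolynomial (Fin 2) k} {n : ℕ} (hF : F.IsHomogeneous n) :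
    (MvPolynomial.aeval ![Polynomial.X, 1] F : k[X]).natDegree ≤ n := by
  have h := MvPolynomial.aeval_natDegree_le F hF.totalDegree_le
    ![(Polynomial.X : k[X]), 1] (n := 1) (fun i => by fin_cases i <;> simp)
  simpa using h

theorem eq_of_sub_eq_zero {R : Type*} [Ring R] (h : MulRingSeminorm R) {a b : R}
    (hab : h (a - b) = 0) : h a = h b := by
  have h1 := map_add_le_add h (a - b) b
  have h2 := map_add_le_add h (b - a) a
  rw [← neg_sub a b, map_neg_eq_map] at h2
  simp only [sub_add_cancel, hab, neg_sub, zero_add] at h1 h2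
  linarith

theorem apply_of_apply_X_one_eq_zero (h : MulRingSeminorm (MvPolynomial (Fin 2) k))
    (hC : ∀ a : k, h (MvPolynomial.C a) = ‖a‖) (hX : h (MvPolynomial.X 1) = 0)
    {F : MvPolynomial (Fin 2) k} {n : ℕ} (hF : F.IsHomogeneous n) :
    h F = h (MvPolynomial.X 0) ^ n * ‖MvPolynomial.eval ![1, 0] F‖ := by
  have h1 : ∀ F : MvPolynomial (Fin 2) k,
      h (F - MvPolynomial.aeval ![(MvPolynomial.X 0 : MvPolynomial (Fin 2) k), 0] F) = 0 := by
    intro F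
    induction F using MvPolynomial.induction_on with
    | C a => simp
    | add p q hp hq =>
      refine le_antisymm ?_ (apply_nonneg h _)
      have := map_add_le_add h (p - MvPolynomial.aeval ![MvPolynomial.X 0, 0] p)
        (q - MvPolynomial.aeval ![MvPolynomial.X 0, 0] q)
      rw [hp, hq] at this
      simpa [sub_add_sub_comm] using this
    | mul_X p i hp =>
      refine le_antisymm ?_ (apply_nonneg h _)
      set p' := MvPolynomial.aeval ![(MvPolynomial.X 0 : MvPolynomial (Fin 2) k), 0] p
      have := map_add_le_add h ((p - p') * MvPolynomial.X i)
        (p' * (MvPolynomial.X i - ![(MvPolynomial.X 0 : MvPolynomial (Fin 2) k), 0] i))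
      rw [map_mul, hp, map_mul] at this
      have hi : h (MvPolynomial.X i - ![(MvPolynomial.X 0 : MvPolynomial (Fin 2) k), 0] i) = 0 := by
        fin_cases i
        · simp
        · simpa using hX
      rw [hi] at this
      have e : (p - p') * MvPolynomial.X i +
          (p' * (MvPolynomial.X i - ![(MvPolynomial.X 0 : MvPolynomial (Fin 2) k), 0] i)) =
          p * MvPolynomial.X i -
            MvPolynomial.aeval ![(MvPolynomial.X 0 : MvPolynomial (Fin 2) k), 0]
              (p * MvPolynomial.X i) := by
        simp only [map_mul, MvPolynomial.aeval_X]
        ring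
      rw [← e]
      simpa using this
  have h2 : MvPolynomial.aeval ![(MvPolynomial.X 0 : MvPolynomial (Fin 2) k), 0] F =
      MvPolynomial.X 0 ^ n * MvPolynomial.C (MvPolynomial.eval ![1, 0] F) := by
    rw [F.as_sum]
    simp only [map_sum, Finset.mul_sum]
    refine Finset.sum_congr rfl fun m hm => ?_
    have hm' : m.weight 1 = n := hF (by simpa using hm)
    have hm'' : m 0 + m 1 = n := by
      rw [← hm']
      simp [Finsupp.weight_apply, Finsupp.sum_fintype, Fin.sum_univ_two]
    simp only [MvPolynomial.aeval_monomial, MvPolynomial.eval_monomial,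
      Finsupp.prod_fintype _ _ (fun i => pow_zero _), Fin.prod_univ_two, MvPolynomial.algebraMap_eq]
    by_cases h0 : m 1 = 0
    · have : m 0 = n := by omega
      simp [h0, this, mul_comm]
    · simp [h0]
  rw [eq_of_sub_eq_zero h (h1 F), h2, map_mul, map_pow, hC]

theorem homSeminorm_X_ne (p : ProjLine k) :
    homSeminorm p (MvPolynomial.X 0) ≠ 0 ∨ homSeminorm p (MvPolynomial.X 1) ≠ 0 := by
  induction p with
  | none => exact Or.inl ((homSeminorm_infty _).trans_ne (by simp))
  | some x => exact Or.inr ((homSeminorm_coe x _).trans_ne (by simp))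

theorem homSeminorm_subst_X_ne (g : GL (Fin 2) k) (p : ProjLine k) :
    homSeminorm p (subst (g : Matrix (Fin 2) (Fin 2) k) (MvPolynomial.X 0)) ≠ 0 ∨
    homSeminorm p (subst (g : Matrix (Fin 2) (Fin 2) k) (MvPolynomial.X 1)) ≠ 0 := by
  by_contra! hc
  have key : ∀ i, homSeminorm p (MvPolynomial.X i) = 0 := by
    intro i
    have e : (MvPolynomial.X i : MvPolynomial (Fin 2) k) =
        MvPolynomial.C ((g⁻¹ : GL (Fin 2) k) i 0) *
          subst (g : Matrix (Fin 2) (Fin 2) k) (MvPolynomial.X 0) +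
        MvPolynomial.C ((g⁻¹ : GL (Fin 2) k) i 1) *
          subst (g : Matrix (Fin 2) (Fin 2) k) (MvPolynomial.X 1) := by
      have := subst_subst ((g⁻¹ : GL (Fin 2) k) : Matrix (Fin 2) (Fin 2) k)
        (g : Matrix (Fin 2) (Fin 2) k) (MvPolynomial.X i)
      rw [← Units.val_mul, inv_mul_cancel, Units.val_one, subst_one] at this
      rw [← this, subst_X (_ : Matrix (Fin 2) (Fin 2) k) i]
      simp only [map_add, map_mul, MvPolynomial.algHom_C, MvPolynomial.algebraMap_eq]
    refine le_antisymm ?_ (apply_nonneg _ _)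
    rw [e]
    refine (map_add_le_add _ _ _).trans ?_
    simp [hc.1, hc.2]
  exact (homSeminorm_X_ne p).elim (fun h => h (key 0)) (fun h => h (key 1))

theorem exists_homSeminorm_moebius (g : GL (Fin 2) k) (p : ProjLine k) :
    ∃ c : ℝ, 0 < c ∧ ∀ (n : ℕ) (F : MvPolynomial (Fin 2) k), F.IsHomogeneous n →
      homSeminorm p (subst (g : Matrix (Fin 2) (Fin 2) k) F) =
        c ^ n * homSeminorm (moebius g p) F := by
  set h := pullback (subst (g : Matrix (Fin 2) (Fin 2) k)).toRingHom (homSeminorm p) with hh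
  have hC : ∀ a : k, h (MvPolynomial.C a) = ‖a‖ :=
    fun a => by simpa [hh, subst] using homSeminorm_C p a
  have hv : ∀ F, homSeminorm p (subst (g : Matrix (Fin 2) (Fin 2) k) F) = h F := fun F => rfl
  have hne := homSeminorm_subst_X_ne g p
  simp only [hv] at hne ⊢
  by_cases hX : h (MvPolynomial.X 1) = 0
  · have h0 : h (MvPolynomial.X 0) ≠ 0 := by tauto
    refine ⟨h (MvPolynomial.X 0), lt_of_le_of_ne (apply_nonneg _ _) h0.symm, fun n F hF => ?_⟩
    rw [moebius, dif_pos hX, apply_of_apply_X_one_eq_zero h hC hX hF, homSeminorm_infty]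
  · refine ⟨h (MvPolynomial.X 1), lt_of_le_of_ne (apply_nonneg _ _) (Ne.symm hX),
      fun n F hF => ?_⟩
    rw [moebius, dif_neg hX, homSeminorm_coe, dehomogenize_apply _ _ _ _ (natDegree_aeval_le hF),
      Polynomial.homogenize_eq_of_isHomogeneous hF rfl, ← hh]
    field_simp

theorem eq_of_homSeminorm_eq {p q : ProjLine k} {c : ℝ} (hc : 0 < c)
    (h : ∀ (n : ℕ) (F : MvPolynomial (Fin 2) k), F.IsHomogeneous n →
      homSeminorm p F = c ^ n * homSeminorm q F) : p = q := by
  have hX := h 1 _ (MvPolynomial.isHomogeneous_X k (1 : Fin 2))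
  induction p with
  | none =>
    induction q with
    | none => rfl
    | some y =>
      exfalso
      erw [homSeminorm_infty, homSeminorm_coe] at hX
      simp at hX
      exact hc.ne hX
  | some x =>
    induction q with
    | none =>
      exfalso
      erw [homSeminorm_infty, homSeminorm_coe] at hX
      simp at hX
    | some y =>
      have hc1 : c = 1 := by
        have hx : homSeminorm (x : ProjLine k) (MvPolynomial.X 1) = 1 :=
          (homSeminorm_coe x _).trans (by simp)
        have hy : homSeminorm (y : ProjLine k) (MvPolynomial.X 1) = 1 :=
          (homSeminorm_coe y _).trans (by simp)
        have hX' := hX.symm.trans hx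
        rw [pow_one] at hX'
        have hX'' : c * 1 = 1 := hy ▸ hX'
        simpa using hX''
      subst hc1
      have : x.seminorm = y.seminorm := by
        refine MulRingSeminorm.ext fun P => ?_
        have h2 := h _ _ (P.isHomogeneous_homogenize (n := P.natDegree))
        have hv : ∀ z : AffineLine k,
            homSeminorm (z : ProjLine k) (P.homogenize P.natDegree) = z.seminorm P :=
          fun z => (homSeminorm_coe z _).trans (by simp)
        rw [one_pow, one_mul] at h2
        exact (hv x).symm.trans (h2.trans (hv y))
      cases x; cases y; cases this; rfl

instance : MulAction (GL (Fin 2) k) (ProjLine k) where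
  smul := moebius
  one_smul p := by
    change moebius 1 p = p
    obtain ⟨c, hc, h⟩ := exists_homSeminorm_moebius 1 p
    refine (eq_of_homSeminorm_eq hc fun n F hF => ?_).symm
    rw [← h n F hF, Units.val_one, subst_one]
  mul_smul g g' p := by
    change moebius (g * g') p = moebius g (moebius g' p)
    obtain ⟨c₁, hc₁, h₁⟩ := exists_homSeminorm_moebius (g * g') p
    obtain ⟨c₂, hc₂, h₂⟩ := exists_homSeminorm_moebius g' p
    obtain ⟨c₃, hc₃, h₃⟩ := exists_homSeminorm_moebius g (moebius g' p)
    refine eq_of_homSeminorm_eq (c := c₁⁻¹ * c₂ * c₃) (by positivity) fun n F hF => ?_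
    have e₁ := h₁ n F hF
    have e₂ := h₂ n _ (subst_homogeneous g hF)
    have e₃ := h₃ n F hF
    rw [Units.val_mul, ← subst_subst, e₂, e₃] at e₁
    have : (c₁ ^ n) ≠ 0 := by positivity
    rw [mul_pow, mul_pow, inv_pow]
    field_simp
    linarith

theorem scalar_smul (u : kˣ) (p : ProjLine k) :
    Matrix.GeneralLinearGroup.scalar (Fin 2) u • p = p := by
  change moebius _ p = p
  obtain ⟨c, hc, h⟩ := exists_homSeminorm_moebius (Matrix.GeneralLinearGroup.scalar (Fin 2) u) p
  have hu : 0 < ‖(u : k)‖ := norm_pos_iff.2 u.ne_zero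
  refine (eq_of_homSeminorm_eq (c := c / ‖(u : k)‖) (by positivity) fun n F hF => ?_).symm
  have e := h n F hF
  have : subst ((Matrix.GeneralLinearGroup.scalar (Fin 2) u : GL (Fin 2) k) :
      Matrix (Fin 2) (Fin 2) k) F = MvPolynomial.C ((u : k) ^ n) * F := by
    have : subst ((Matrix.GeneralLinearGroup.scalar (Fin 2) u : GL (Fin 2) k) :
        Matrix (Fin 2) (Fin 2) k) =
        MvPolynomial.aeval fun i => MvPolynomial.C (u : k) * MvPolynomial.X i := by
      ext i : 1
      fin_cases i <;> simp [subst]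
    rw [this, F.as_sum]
    simp only [map_sum, Finset.mul_sum]
    refine Finset.sum_congr rfl fun m hm => ?_
    have hm' : m.weight 1 = n := hF (by simpa using hm)
    have hm'' : m 0 + m 1 = n := by
      rw [← hm']
      simp [Finsupp.weight_apply, Finsupp.sum_fintype, Fin.sum_univ_two]
    rw [MvPolynomial.aeval_monomial, MvPolynomial.monomial_eq]
    rw [Finsupp.prod_fintype _ _ (fun i => pow_zero _),
      Finsupp.prod_fintype _ _ (fun i => pow_zero _)]
    simp only [Fin.prod_univ_two,
      MvPolynomial.algebraMap_eq, ← hm'', mul_pow, pow_add, map_mul, map_pow]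
    ring
  rw [this, map_mul, homSeminorm_C, norm_pow] at e
  rw [div_pow]
  field_simp
  linarith

instance : MulAction PGL(2, k) (ProjLine k) :=
  Matrix.ProjGenLinGroup.mulActionOfGL scalar_smul

end Action

section Hyperbolic

variable (k : Type*) [NontriviallyNormedField k] [IsUltrametricDist k] [CompleteSpace k]

/-- The algebraic closure of `k` with the unique extension of the norm of `k`. -/
instance : NormedField (AlgebraicClosure k) := spectralNorm.normedField k (AlgebraicClosure k)

/-- The completion of the algebraic closure of `k`. -/
abbrev CompletedAlgClosure := UniformSpace.Completion (AlgebraicClosure k)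

/-- The embedding of `k` in the completion of its algebraic closure. -/
def embed : k →+* CompletedAlgClosure k :=
  UniformSpace.Completion.coeRingHom.comp (algebraMap k (AlgebraicClosure k))

variable {k}

/-- The points of type 1: the images of the classical points `α ∈ ℙ¹` of the completed algebraic
closure, that is `∞` and the seminorms `P ↦ ‖P(α)‖`. -/
def IsType1 (p : ProjLine k) : Prop :=
  p = ∞ ∨ ∃ (x : AffineLine k) (α : CompletedAlgClosure k),
    p = x ∧ ∀ P : k[X], x.seminorm P = ‖P.eval₂ (embed k) α‖

variable (k) in
/-- The hyperbolic space over `k`: the points which are not of type 1. -/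
def hyperbolicSpace : Set (ProjLine k) := {p | ¬ IsType1 p}

theorem isNonarchimedean_toAbsoluteValue :
    IsNonarchimedean (NormedField.toAbsoluteValue (AlgebraicClosure k)) :=
  isNonarchimedean_spectralNorm (K := k) (L := AlgebraicClosure k)

/-- The point `η_{a,r}`, `∑ aₙ (T - a)ⁿ ↦ max ‖aₙ‖ rⁿ`, for `a` in the algebraic closure of `k`
(more precisely, its image in the affine line over `k`). -/
def eta (a : AlgebraicClosure k) (r : ℝ) (hr : 0 < r) : AffineLine k where
  seminorm :=
    { toFun := fun P => ((P.map (algebraMap k (AlgebraicClosure k))).taylor a).gaussNorm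
        (NormedField.toAbsoluteValue (AlgebraicClosure k)) r
      map_zero' := by simp
      add_le' := fun P Q => by
        rw [Polynomial.map_add, map_add]
        exact (Polynomial.gaussNorm_isAbsoluteValue isNonarchimedean_toAbsoluteValue hr).abv_add'
          _ _
      neg' := fun P => by
        have := Polynomial.gaussNorm_isAbsoluteValue isNonarchimedean_toAbsoluteValue hr
          (v := NormedField.toAbsoluteValue (AlgebraicClosure k))
        rw [Polynomial.map_neg, map_neg]
        exact IsAbsoluteValue.abv_neg
          (Polynomial.gaussNorm (NormedField.toAbsoluteValue (AlgebraicClosure k)) r) _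
      map_one' := by
        simpa using Polynomial.gaussNorm_C (NormedField.toAbsoluteValue (AlgebraicClosure k)) r 1
      map_mul' := fun P Q => by
        rw [Polynomial.map_mul, Polynomial.taylor_mul]
        exact Polynomial.gaussNorm_mul isNonarchimedean_toAbsoluteValue hr _ _ }
  map_C a := by
    change Polynomial.gaussNorm _ _ _ = _
    rw [Polynomial.map_C, Polynomial.taylor_C, Polynomial.gaussNorm_C]
    exact spectralNorm_extends (K := k) (L := AlgebraicClosure k) a

/-- The diameter of the smallest closed disk containing `x` and `y`, i.e. of the point `x ∨ y` at
which the paths from `x` and from `y` to `∞` meet: the infimum of the radii `r` of the closed disks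
`D(a, r)`, `a` in the algebraic closure of `k`, whose image in the affine line over `k` contains
`x` and `y`. A point lies in this image if and only if it is bounded by `η_{a,r}`. -/
def jointDiam (x y : AffineLine k) : ℝ :=
  sInf {r : ℝ | ∃ (a : AlgebraicClosure k) (hr : 0 < r),
    (∀ P : k[X], x.seminorm P ≤ (eta a r hr).seminorm P) ∧
      ∀ P : k[X], y.seminorm P ≤ (eta a r hr).seminorm P}

/-- The interval length (path distance) metric on the hyperbolic space,
`ρ(x, y) = 2 log diam (x ∨ y) - log diam x - log diam y`, where `diam x` is the diameter of the
smallest closed disk containing `x`: the length of the path going from `x` up to `x ∨ y` and from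
there down to `y`, where a path `[η_{a,r}, η_{a,s}]` with `r ≤ s` has length `log (s / r)`. On
points `η_{a,r}`, `η_{b,s}` with `a, b` in `k` it is `|log (r / s)|` if `‖a - b‖ ≤ max r s`, and
`log (‖a - b‖ / r) + log (‖a - b‖ / s)` otherwise. (The value when a point is of type 1 is
irrelevant.) -/
def rho : ProjLine k → ProjLine k → ℝ
  | (x : AffineLine k), (y : AffineLine k) =>
    2 * Real.log (jointDiam x y) - Real.log (jointDiam x x) - Real.log (jointDiam y y)
  | _, _ => 0

end Hyperbolic

/-! ### Disks -/

section Disks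

variable {k : Type*} [NontriviallyNormedField k] [IsUltrametricDist k] [CompleteSpace k]

/-- The closed disk `{|T - a| ≤ r}` in the affine line. -/
def affineClosedDisk (a : k) (r : ℝ) : Set (ProjLine k) :=
  {p | ∃ x : AffineLine k, p = x ∧ x.seminorm (Polynomial.X - Polynomial.C a) ≤ r}

/-- The open disk `{|T - a| < r}` in the affine line. -/
def affineOpenDisk (a : k) (r : ℝ) : Set (ProjLine k) :=
  {p | ∃ x : AffineLine k, p = x ∧ x.seminorm (Polynomial.X - Polynomial.C a) < r}

variable (k) in
/-- The closed disks of the projective line, i.e. the images of the disks `{|T - a| ≤ r}`, `a ∈ k`,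
`0 < r`, under Möbius transformations: they are the disks `{|T - a| ≤ r}`, and (for those containing
`∞`) the complements of the disks `{|T - a| < r}`. -/
inductive ClosedDisk where
  | affine (a : k) (r : ℝ) (hr : 0 < r)
  | compl (a : k) (r : ℝ) (hr : 0 < r)

/-- The set of points of a closed disk. -/
def ClosedDisk.carrier : ClosedDisk k → Set (ProjLine k)
  | .affine a r _ => affineClosedDisk a r
  | .compl a r _ => (affineOpenDisk a r)ᶜ

/-- The unique boundary point `η_{a,r}` of a closed disk. -/
def ClosedDisk.boundary : ClosedDisk k → ProjLine k
  | .affine a r hr => (eta (algebraMap k (AlgebraicClosure k) a) r hr : AffineLine k)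
  | .compl a r hr => (eta (algebraMap k (AlgebraicClosure k) a) r hr : AffineLine k)

/-- The open disks of the projective line. -/
def IsOpenDisk (S : Set (ProjLine k)) : Prop :=
  ∃ (a : k) (r : ℝ), 0 < r ∧ (S = affineOpenDisk a r ∨ S = (affineClosedDisk a r)ᶜ)

end Disks

/-! ### Schottky groups and Schottky figures -/

section Schottky

variable {k : Type*} [NontriviallyNormedField k] [IsUltrametricDist k] [CompleteSpace k]

/-- A Möbius transformation is loxodromic if the two eigenvalues, in the algebraic closure of `k`,
of a representing matrix have different absolute values. -/
def IsLoxodromic (γ : PGL(2, k)) : Prop :=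
  ∃ A : GL (Fin 2) k, Matrix.ProjGenLinGroup.mk A = γ ∧
    ∃ l m : AlgebraicClosure k,
      ((A : Matrix (Fin 2) (Fin 2) k).charpoly.map (algebraMap k (AlgebraicClosure k))).roots
        = {l, m} ∧ ‖l‖ ≠ ‖m‖

/-- Schottky groups over `k`. The action of the (discrete) group `Γ` on the locally compact
Hausdorff space `U` is proper if every compact subset of `U` meets only finitely many of its
translates. -/
structure IsSchottkyGroup (Γ : Subgroup PGL(2, k)) : Prop where
  free : IsFreeGroup Γ
  fg : Group.FG Γ
  loxodromic : ∀ γ ∈ Γ, γ ≠ 1 → IsLoxodromic γ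
  domain : ∃ U : Set (ProjLine k), IsOpen U ∧ IsConnected U ∧
    (∀ γ ∈ Γ, ∀ p ∈ U, γ • p ∈ U) ∧
    (∀ γ ∈ Γ, ∀ p ∈ U, γ • p = p → γ = 1) ∧
    ∀ K ⊆ U, IsCompact K → {γ | γ ∈ Γ ∧ (((γ • ·) '' K) ∩ K).Nonempty}.Finite

/-- `γ₁, …, γ_g` is a basis of `Γ`, i.e. a generating family with the minimal number `g` of
elements; this number is the rank of `Γ`. -/
def IsBasis (Γ : Subgroup PGL(2, k)) {g : ℕ} (γ : Fin g → PGL(2, k)) : Prop :=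
  Subgroup.closure (Set.range γ) = Γ ∧
    ∀ (n : ℕ) (δ : Fin n → PGL(2, k)), Subgroup.closure (Set.range δ) = Γ → g ≤ n

/-- The alphabet `γ₁, γ₁⁻¹, …, γ_g, γ_g⁻¹`: the letter `(i, true)` stands for `γᵢ` and `(i, false)`
for `γᵢ⁻¹`. -/
abbrev Letter (g : ℕ) := Fin g × Bool

/-- The inverse letter. -/
def Letter.inv {g : ℕ} (a : Letter g) : Letter g := (a.1, !a.2)

/-- The group element of a letter. -/
def Letter.elt {g : ℕ} (γ : Fin g → PGL(2, k)) (a : Letter g) : PGL(2, k) :=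
  if a.2 then γ a.1 else (γ a.1)⁻¹

/-- A Schottky figure adapted to `(γ₁, …, γ_g)`: pairwise disjoint closed disks `D_a` and maximal
open disks `D_a°` inside `D_a`, for `a` in the alphabet `γᵢ^{±1}`, such that
`a (D_{a⁻¹}ᶜ) = D_a°`. -/
structure SchottkyFigure {g : ℕ} (γ : Fin g → PGL(2, k)) where
  disk : Letter g → ClosedDisk k
  openDisk : Letter g → Set (ProjLine k)
  disjoint : ∀ a b, a ≠ b → Disjoint (disk a).carrier (disk b).carrier
  maximal : ∀ a, Maximal (fun S => IsOpenDisk S ∧ S ⊆ (disk a).carrier) (openDisk a)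
  pingpong : ∀ a, (fun p => a.elt γ • p) '' (disk a.inv).carrierᶜ = openDisk a

namespace SchottkyFigure

variable {g : ℕ} {γ : Fin g → PGL(2, k)} (D : SchottkyFigure γ)

/-- The fundamental domain `ℙ¹ \ (⋃ᵢ D_{γᵢ} ∪ ⋃ᵢ D°_{γᵢ⁻¹})`. -/
def fundamentalDomain : Set (ProjLine k) :=
  {p | ∀ i, p ∉ (D.disk (i, true)).carrier ∧ p ∉ D.openDisk (i, false)}

/-- The matrix `M(s)`, with rows and columns indexed by the alphabet: the entry at `(a, b)` is
`exp(-s ρ(∂D_{a⁻¹}, ∂D_b))` if `a⁻¹ ≠ b`, and `0` otherwise. -/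
def M (s : ℂ) : Matrix (Letter g) (Letter g) ℂ := Matrix.of fun a b =>
  if a.inv ≠ b then Complex.exp (-s * rho (D.disk a.inv).boundary (D.disk b).boundary) else 0

/-- The vector `X_x(s)`, with entry `exp(-s ρ(x, ∂D_a))` at `a`. -/
def X (x : ProjLine k) (s : ℂ) : Letter g → ℂ := fun a =>
  Complex.exp (-s * rho x (D.disk a).boundary)

/-- The vector `Y_y(s)`, with entry `exp(-s ρ(y, ∂D_{a⁻¹}))` at `a`. -/
def Y (y : ProjLine k) (s : ℂ) : Letter g → ℂ := fun a =>
  Complex.exp (-s * rho y (D.disk a.inv).boundary)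

end SchottkyFigure

/-- The general term `exp(-s ρ(x, γ y))` of the Poincaré series of `Γ` from `x` to `y`. -/
def poincareTerm (Γ : Subgroup PGL(2, k)) (x y : ProjLine k) (s : ℝ) (γ : Γ) : ℝ :=
  Real.exp (-s * rho x ((γ : PGL(2, k)) • y))

/-- The Poincaré series of `Γ` from `x` to `y`, at an `s` where it converges. -/
def poincareSeries (Γ : Subgroup PGL(2, k)) (x y : ProjLine k) (s : ℝ) : ℝ :=
  ∑' γ : Γ, poincareTerm Γ x y s γ

end Schottky

end Berkovich

end

/-! The Poincaré series is a transfer-matrix sum. By ping-pong, a nonempty reduced word a₁⋯aₙ sends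
y ∈ F into the disk of a₁, so the path from x ∈ F to a₁⋯aₙy crosses ∂D_{a₁}. Applying a₁⁻¹, which
carries ∂D_{a₁} to ∂D_{a₁⁻¹}, and repeating, one cuts ρ(x, a₁⋯aₙy) into ρ(x, ∂D_{a₁}), the
ρ(∂D_{aᵢ⁻¹}, ∂D_{aᵢ₊₁}) and ρ(∂D_{aₙ⁻¹}, y) (`rho_wordElt`, `rho_boundary_wordElt`). Hence the words
of length n contribute X M(s)ⁿ⁻¹ Yᵗ, the zero entries of M removing those that are not reduced.
Since X and Y have positive entries for real s, convergence of the series forces convergence of ∑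
Mⁿ, which inverts I - M (`exists_geometric_sum`).

The geometric input is `jointDiam`. It satisfies the ultrametric inequality (`jointDiam_le_max`) and
transforms under Möbius maps like the difference of two coordinates (`jointDiam_smul`); so ρ is an
invariant pseudometric. Points over k correspond to conjugacy classes of data over the algebraic
closure, and disks are compared through the values of minimal polynomials.

At s = 0 the formula degenerates. With τ the inversion of letters and R the distance matrix of the
boundary points, I - M(s) = I + τ - (exp(-s R(τa, b))), whose rows a and τa coincide at 0. Replacing
f_a by f_a + f_{τa} + (f_a - f_{τa})/s on both sides of the linear system removes the degeneracy:
the new matrix is invertible at 0 because R is negative definite on vectors of sum zero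
(`sum_rho_boundary_neg`), since L - log jointDiam is an ultrametric kernel and such kernels are
mixtures of indicators of partial equivalence relations. In particular det(I - M) is not identically
zero, so its zeros are isolated. The symmetric part of the system at 0 reads u_a + u_{τa} - ∑u = 1;
summing over the 2g letters gives ∑u = 2g/(2 - 2g), and the empty word adds 1, for a total of 1/(1 -
g). -/

noncomputable section

namespace Berkovich

/-! ### Multiplicative seminorms on polynomials and Gauss points -/

section General

variable {F : Type*} [NormedField F]

theorem AffineLine.ext' {x y : AffineLine F} (h : ∀ P, x.seminorm P = y.seminorm P) : x = y := by
  have : x.seminorm = y.seminorm := MulRingSeminorm.ext h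
  cases x; cases y; cases this; rfl

theorem AffineLine.map_natCast_le [IsUltrametricDist F] (x : AffineLine F) (n : ℕ) :
    x.seminorm (n : F[X]) ≤ 1 := by
  have := x.map_C (n : F)
  rw [map_natCast] at this
  rw [this]
  exact IsUltrametricDist.norm_natCast_le_one F n

/-- Binomial coefficients have absolute value at most 1, so the n-th power of |P + Q| is at most (n
+ 1) mⁿ; a ratio |P + Q| / m > 1 would grow exponentially and beat the linear factor. -/
theorem AffineLine.nonarch [IsUltrametricDist F] (x : AffineLine F) :
    IsNonarchimedean x.seminorm := by
  intro P Q
  set m := max (x.seminorm P) (x.seminorm Q) with hm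
  have hm0 : 0 ≤ m := (apply_nonneg x.seminorm P).trans (le_max_left _ _)
  have key : ∀ n : ℕ, x.seminorm (P + Q) ^ n ≤ (n + 1) * m ^ n := by
    intro n
    rw [← map_pow, add_pow]
    have h1 : ∀ s : Finset ℕ, ∀ f : ℕ → F[X],
        x.seminorm (∑ i ∈ s, f i) ≤ ∑ i ∈ s, x.seminorm (f i) := by
      intro s f
      exact Finset.le_sum_of_subadditive _ (map_zero x.seminorm).le (map_add_le_add x.seminorm) _ _
    refine (h1 _ _).trans ?_
    refine (Finset.sum_le_card_nsmul _ _ (m ^ n) fun i hi => ?_).trans (by simp)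
    have hi' : i ≤ n := by simpa [Nat.lt_succ_iff] using hi
    simp only [map_mul, map_pow]
    calc _ ≤ m ^ i * m ^ (n - i) * 1 := by
          gcongr
          · exact le_max_left _ _
          · exact le_max_right _ _
          · exact x.map_natCast_le _
      _ = m ^ n := by rw [mul_one, ← pow_add, Nat.add_sub_cancel' hi']
  by_contra! hlt
  rcases hm0.eq_or_lt with h0 | h0
  · have := key 1
    rw [← h0] at this hlt
    simp at this
    linarith
  · have hr : 1 < x.seminorm (P + Q) / m := (one_lt_div h0).2 hlt
    have h1 := (tendsto_pow_const_div_const_pow_of_one_lt 1 hr).add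
      (tendsto_pow_const_div_const_pow_of_one_lt 0 hr)
    have h2 := (h1.eventually_lt_const (u := 1) (by norm_num)).exists
    obtain ⟨n, hn⟩ := h2
    rw [← add_div, div_lt_one (by positivity), div_pow, lt_div_iff₀ (by positivity)] at hn
    have := key n
    simp at hn
    linarith

theorem AffineLine.apply_sub_le [IsUltrametricDist F] (x : AffineLine F) (P Q : F[X]) :
    x.seminorm (P - Q) ≤ max (x.seminorm P) (x.seminorm Q) := by
  rw [sub_eq_add_neg, ← map_neg_eq_map x.seminorm Q]
  exact x.nonarch _ _

theorem AffineLine.apply_sum_le [IsUltrametricDist F] (x : AffineLine F) {ι : Type*}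
    (s : Finset ι) (f : ι → F[X]) {B : ℝ} (hB : 0 ≤ B) (h : ∀ i ∈ s, x.seminorm (f i) ≤ B) :
    x.seminorm (∑ i ∈ s, f i) ≤ B := by
  classical
  induction s using Finset.induction_on with
  | empty => simpa using hB
  | insert a s ha ih =>
    rw [Finset.sum_insert ha]
    refine (x.nonarch _ _).trans (max_le (h a (by simp)) (ih fun i hi => h i (by simp [hi])))

theorem AffineLine.apply_eq_of_sub_lt [IsUltrametricDist F] (x : AffineLine F) {P Q : F[X]}
    (h : x.seminorm (P - Q) < x.seminorm Q) : x.seminorm P = x.seminorm Q := by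
  refine le_antisymm ?_ ?_
  · have := x.nonarch (P - Q) Q
    rw [sub_add_cancel] at this
    exact this.trans (max_le h.le le_rfl)
  · have := x.apply_sub_le P (P - Q)
    rw [sub_sub_cancel] at this
    exact (le_max_iff.1 this).resolve_right (not_le.2 h)

/-- The absolute value of the linear polynomial `T - a` at a point. -/
def AffineLine.dist (x : AffineLine F) (a : F) : ℝ :=
  x.seminorm (Polynomial.X - Polynomial.C a)

theorem AffineLine.dist_nonneg (x : AffineLine F) (a : F) : 0 ≤ x.dist a := apply_nonneg _ _

theorem AffineLine.dist_le_max [IsUltrametricDist F] (x : AffineLine F) (a b : F) :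
    x.dist a ≤ max (x.dist b) ‖a - b‖ := by
  have := x.apply_sub_le (Polynomial.X - Polynomial.C b) (Polynomial.C (a - b))
  rw [x.map_C] at this
  simpa [AffineLine.dist, Polynomial.C_sub] using this

theorem AffineLine.norm_sub_le_max [IsUltrametricDist F] (x : AffineLine F) (a b : F) :
    ‖a - b‖ ≤ max (x.dist a) (x.dist b) := by
  have := x.apply_sub_le (Polynomial.X - Polynomial.C b) (Polynomial.X - Polynomial.C a)
  rw [sub_sub_sub_cancel_left, ← Polynomial.C_sub, x.map_C] at this
  rw [max_comm]
  exact this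

theorem AffineLine.apply_multiset_prod (x : AffineLine F) (s : Multiset F) :
    x.seminorm (s.map fun b => Polynomial.X - Polynomial.C b).prod = (s.map x.dist).prod := by
  rw [map_multiset_prod, Multiset.map_map]
  rfl

theorem isNonarchimedean_toAbsoluteValue' [IsUltrametricDist F] :
    IsNonarchimedean (NormedField.toAbsoluteValue F) :=
  fun a b => IsUltrametricDist.norm_add_le_max a b

/-- The Gauss point of the closed disk with centre `a` and radius `r`. -/
def gaussPt [IsUltrametricDist F] (a : F) (r : ℝ) (hr : 0 < r) : AffineLine F where
  seminorm :=
    { toFun := fun P => (P.taylor a).gaussNorm (NormedField.toAbsoluteValue F) r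
      map_zero' := by simp
      add_le' := fun P Q => by
        rw [map_add]
        exact (Polynomial.gaussNorm_isAbsoluteValue isNonarchimedean_toAbsoluteValue' hr).abv_add'
          _ _
      neg' := fun P => by
        have := Polynomial.gaussNorm_isAbsoluteValue isNonarchimedean_toAbsoluteValue' hr
          (v := NormedField.toAbsoluteValue F)
        rw [map_neg]
        exact IsAbsoluteValue.abv_neg
          (Polynomial.gaussNorm (NormedField.toAbsoluteValue F) r) _
      map_one' := by
        simpa using Polynomial.gaussNorm_C (NormedField.toAbsoluteValue F) r 1
      map_mul' := fun P Q => by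
        rw [Polynomial.taylor_mul]
        exact Polynomial.gaussNorm_mul isNonarchimedean_toAbsoluteValue' hr _ _ }
  map_C c := by
    change Polynomial.gaussNorm _ _ _ = _
    rw [Polynomial.taylor_C, Polynomial.gaussNorm_C]
    rfl

variable [IsUltrametricDist F]

theorem gaussPt_apply (a : F) {r : ℝ} (hr : 0 < r) (P : F[X]) :
    (gaussPt a r hr).seminorm P = (P.taylor a).gaussNorm (NormedField.toAbsoluteValue F) r := rfl

theorem le_gaussPt (a : F) {r : ℝ} (hr : 0 < r) (P : F[X]) (i : ℕ) :
    ‖(P.taylor a).coeff i‖ * r ^ i ≤ (gaussPt a r hr).seminorm P :=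
  Polynomial.le_gaussNorm (NormedField.toAbsoluteValue F) (P.taylor a) hr.le i

theorem gaussPt_dist (a : F) {r : ℝ} (hr : 0 < r) (b : F) :
    (gaussPt a r hr).dist b = max r ‖a - b‖ := by
  refine le_antisymm ?_ (max_le ?_ ?_)
  · rw [AffineLine.dist, gaussPt_apply]
    obtain ⟨i, hi⟩ := Polynomial.exists_eq_gaussNorm (NormedField.toAbsoluteValue F) r
      ((Polynomial.X - Polynomial.C b).taylor a)
    rw [hi]
    have e : (Polynomial.X - Polynomial.C b).taylor a =
        Polynomial.X + Polynomial.C (a - b) := by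
      rw [map_sub, Polynomial.taylor_X, Polynomial.taylor_C, Polynomial.C_sub]; ring
    rw [e]
    rcases i with _ | _ | i
    · simp [NormedField.toAbsoluteValue]
    · simp
    · simp [Polynomial.coeff_X, hr.le]
  · have := le_gaussPt a hr (Polynomial.X - Polynomial.C b) 1
    simpa [Polynomial.taylor_X, Polynomial.coeff_C, AffineLine.dist] using this
  · have := le_gaussPt a hr (Polynomial.X - Polynomial.C b) 0
    simpa [Polynomial.taylor_X, Polynomial.coeff_C, AffineLine.dist] using this

/-- Expansion in powers of T - a and the ultrametric inequality: the Gauss point is the largest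
point of its closed disk. -/
theorem le_gaussPt_of_dist_le (x : AffineLine F) {a : F} {r : ℝ} (hr : 0 < r)
    (h : x.dist a ≤ r) (P : F[X]) : x.seminorm P ≤ (gaussPt a r hr).seminorm P := by
  have e := Polynomial.sum_taylor_eq P a
  conv_lhs => rw [← e]
  rw [Polynomial.sum_def]
  refine x.apply_sum_le _ _ (apply_nonneg _ _) fun i _ => ?_
  rw [map_mul, map_pow, x.map_C]
  refine le_trans ?_ (le_gaussPt a hr P i)
  gcongr
  exact h

theorem gaussPt_eq {a b : F} {r : ℝ} (hr : 0 < r) (h : ‖a - b‖ ≤ r) :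
    gaussPt a r hr = gaussPt b r hr := by
  refine AffineLine.ext' fun P => le_antisymm ?_ ?_
  · exact le_gaussPt_of_dist_le _ hr (by rw [gaussPt_dist]; simp [h]) P
  · exact le_gaussPt_of_dist_le _ hr (by rw [gaussPt_dist, norm_sub_rev]; simp [h]) P

/-- A product of linear factors without zeros in a closed disk is dominated on this disk by its
value at the centre. -/
theorem gaussPt_prod_sub_lt (a : F) {r : ℝ} (hr : 0 < r) (s : Multiset F)
    (hs : ∀ b ∈ s, r < ‖a - b‖) :
    (gaussPt a r hr).seminorm ((s.map fun b => Polynomial.X - Polynomial.C b).prod -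
      Polynomial.C ((s.map fun b => Polynomial.X - Polynomial.C b).prod.eval a)) <
    ‖(s.map fun b => Polynomial.X - Polynomial.C b).prod.eval a‖ := by
  induction s using Multiset.induction_on with
  | empty => simp
  | cons b s ih =>
    have ih := ih fun c hc => hs c (Multiset.mem_cons_of_mem hc)
    have hb := hs b (Multiset.mem_cons_self b s)
    simp only [Multiset.map_cons, Multiset.prod_cons, Polynomial.eval_mul, Polynomial.eval_sub,
      Polynomial.eval_X, Polynomial.eval_C, norm_mul]
    set G := (s.map fun b => Polynomial.X - Polynomial.C b).prod
    -- The first summand is small by induction, since T - b has absolute value |a - b| at the Gauss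
    -- point; the second because |T - a| = r < |a - b| there.
    have e : (Polynomial.X - Polynomial.C b) * G - Polynomial.C ((a - b) * G.eval a) =
        (Polynomial.X - Polynomial.C b) * (G - Polynomial.C (G.eval a)) +
        Polynomial.C (G.eval a) * (Polynomial.X - Polynomial.C a) := by
      simp only [Polynomial.C_mul, Polynomial.C_sub]; ring
    rw [e]
    refine ((gaussPt a r hr).nonarch _ _).trans_lt (max_lt ?_ ?_)
    · rw [map_mul]
      change (gaussPt a r hr).dist b * _ < _
      rw [gaussPt_dist, max_eq_right hb.le]
      exact mul_lt_mul_of_pos_left ih (hr.trans hb)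
    · rw [map_mul, AffineLine.map_C]
      change _ * (gaussPt a r hr).dist a < _
      rw [gaussPt_dist, mul_comm]
      simp only [sub_self, norm_zero, max_eq_left hr.le]
      exact mul_lt_mul_of_pos_right hb ((apply_nonneg _ _).trans_lt ih)

end General


theorem multiset_prod_lt {ι : Type*} {s : Multiset ι} {f g : ι → ℝ} (hf : ∀ i ∈ s, 0 ≤ f i)
    (hfg : ∀ i ∈ s, f i ≤ g i) (hg : ∀ i ∈ s, 0 < g i) {i : ι} (hi : i ∈ s) (hlt : f i < g i) :
    (s.map f).prod < (s.map g).prod := by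
  obtain ⟨t, rfl⟩ := Multiset.exists_cons_of_mem hi
  simp only [Multiset.map_cons, Multiset.prod_cons]
  have h1 : (t.map f).prod ≤ (t.map g).prod :=
    Multiset.prod_map_le_prod_map₀ _ _ (fun i hi => hf i (Multiset.mem_cons_of_mem hi))
      (fun i hi => hfg i (Multiset.mem_cons_of_mem hi))
  have h2 : 0 < (t.map g).prod := by
    refine Multiset.prod_pos fun x hx => ?_
    obtain ⟨i, hi, rfl⟩ := Multiset.mem_map.1 hx
    exact hg i (Multiset.mem_cons_of_mem hi)
  exact mul_lt_mul_of_lt_of_le_of_nonneg_of_pos hlt h1 (hf i hi) h2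

/-! ### Minimal polynomials and conjugates -/

section Roots

variable {k : Type*} [Field k]

theorem minpoly_map_eq_prod (q : AlgebraicClosure k) :
    (minpoly k q).map (algebraMap k (AlgebraicClosure k)) =
      (((minpoly k q).map (algebraMap k (AlgebraicClosure k))).roots.map
        fun b => Polynomial.X - Polynomial.C b).prod :=
  (IsAlgClosed.splits _).eq_prod_roots_of_monic
    ((minpoly.monic (Algebra.IsIntegral.isIntegral q)).map _)

theorem exists_algEquiv_of_mem_roots {q q' : AlgebraicClosure k}
    (h : q' ∈ ((minpoly k q).map (algebraMap k (AlgebraicClosure k))).roots) :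
    ∃ σ : AlgebraicClosure k ≃ₐ[k] AlgebraicClosure k, σ q = q' := by
  refine minpoly.exists_algEquiv_of_root' (Algebra.IsAlgebraic.isAlgebraic q) ?_
  have := Polynomial.isRoot_of_mem_roots h
  rwa [Polynomial.IsRoot, Polynomial.eval_map_algebraMap] at this

theorem mem_roots_minpoly (q : AlgebraicClosure k) :
    q ∈ ((minpoly k q).map (algebraMap k (AlgebraicClosure k))).roots := by
  rw [Polynomial.mem_roots (Polynomial.map_ne_zero
    (minpoly.ne_zero (Algebra.IsIntegral.isIntegral q)))]
  simp [Polynomial.IsRoot, Polynomial.eval_map_algebraMap]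

end Roots

/-! ### Disks over the algebraic closure and their images over k -/

section Eta

variable {k : Type*} [NontriviallyNormedField k] [IsUltrametricDist k] [CompleteSpace k]

instance : IsUltrametricDist (AlgebraicClosure k) :=
  IsUltrametricDist.isUltrametricDist_of_isNonarchimedean_norm
    (isNonarchimedean_spectralNorm (K := k) (L := AlgebraicClosure k))

theorem norm_algebraMap_closure (a : k) : ‖algebraMap k (AlgebraicClosure k) a‖ = ‖a‖ :=
  spectralNorm_extends (K := k) (L := AlgebraicClosure k) a

theorem norm_algEquiv (σ : AlgebraicClosure k ≃ₐ[k] AlgebraicClosure k) (a : AlgebraicClosure k) :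
    ‖σ a‖ = ‖a‖ :=
  (spectralNorm_eq_of_equiv σ a).symm

theorem eta_apply (a : AlgebraicClosure k) {r : ℝ} (hr : 0 < r) (P : k[X]) :
    (eta a r hr).seminorm P =
      (gaussPt a r hr).seminorm (P.map (algebraMap k (AlgebraicClosure k))) := rfl

theorem eta_dist (a : AlgebraicClosure k) {r : ℝ} (hr : 0 < r) (b : k) :
    (eta a r hr).dist b = max r ‖a - algebraMap k (AlgebraicClosure k) b‖ := by
  rw [AffineLine.dist, eta_apply, ← gaussPt_dist a hr, AffineLine.dist]
  simp

/-- For a polynomial over k, the Taylor coefficients at σ a are the images under σ of those at a,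
and σ preserves the spectral norm. -/
theorem eta_algEquiv (σ : AlgebraicClosure k ≃ₐ[k] AlgebraicClosure k) (a : AlgebraicClosure k)
    {r : ℝ} (hr : 0 < r) : eta (σ a) r hr = eta a r hr := by
  have key : ∀ (σ : AlgebraicClosure k ≃ₐ[k] AlgebraicClosure k) (a : AlgebraicClosure k)
      (P : k[X]), (eta (σ a) r hr).seminorm P ≤ (eta a r hr).seminorm P := by
    intro σ a P
    rw [eta_apply, eta_apply, gaussPt_apply]
    obtain ⟨i, hi⟩ := Polynomial.exists_eq_gaussNorm
      (NormedField.toAbsoluteValue (AlgebraicClosure k)) r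
      ((P.map (algebraMap k (AlgebraicClosure k))).taylor (σ a))
    rw [hi]
    have e : (P.map (algebraMap k (AlgebraicClosure k))).taylor (σ a) =
        ((P.map (algebraMap k (AlgebraicClosure k))).taylor a).map (σ : _ →+* _) := by
      rw [Polynomial.map_taylor, Polynomial.map_map]
      congr 2
      ext1 x
      simp
    rw [e, Polynomial.coeff_map]
    change ‖σ _‖ * _ ≤ _
    rw [norm_algEquiv]
    exact le_gaussPt a hr _ i
  refine AffineLine.ext' fun P => le_antisymm (key σ a P) ?_
  have := key σ.symm (σ a) P
  rwa [AlgEquiv.symm_apply_apply] at this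

/-- Domination by the Gauss point of a closed disk. -/
def AffineLine.InDisk (x : AffineLine k) (a : AlgebraicClosure k) (r : ℝ) : Prop :=
  ∃ hr : 0 < r, ∀ P : k[X], x.seminorm P ≤ (eta a r hr).seminorm P

theorem AffineLine.InDisk.mono {x : AffineLine k} {a b : AlgebraicClosure k} {r s : ℝ}
    (h : x.InDisk a r) (hrs : r ≤ s) (hab : ‖a - b‖ ≤ s) : x.InDisk b s := by
  obtain ⟨hr, h⟩ := h
  refine ⟨hr.trans_le hrs, fun P => (h P).trans ?_⟩
  exact le_gaussPt_of_dist_le (gaussPt a r hr) (hr.trans_le hrs)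
    (by rw [gaussPt_dist]; exact max_le hrs hab) _

theorem inDisk_algEquiv (σ : AlgebraicClosure k ≃ₐ[k] AlgebraicClosure k) {x : AffineLine k}
    {a : AlgebraicClosure k} {r : ℝ} : x.InDisk (σ a) r ↔ x.InDisk a r := by
  simp only [AffineLine.InDisk, eta_algEquiv]

theorem inDisk_algebraMap_iff {x : AffineLine k} {b : k} {r : ℝ} :
    x.InDisk (algebraMap k (AlgebraicClosure k) b) r ↔ 0 < r ∧ x.dist b ≤ r := by
  constructor
  · rintro ⟨hr, h⟩
    refine ⟨hr, (h _).trans ?_⟩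
    change (eta _ r hr).dist b ≤ r
    rw [eta_dist]
    simp [hr.le]
  · rintro ⟨hr, h⟩
    refine ⟨hr, fun P => ?_⟩
    refine (le_gaussPt_of_dist_le x hr h P).trans ?_
    rw [eta_apply, gaussPt_apply b]
    obtain ⟨i, hi⟩ := Polynomial.exists_eq_gaussNorm (NormedField.toAbsoluteValue k) r
      (P.taylor b)
    rw [hi]
    change ‖_‖ * _ ≤ _
    rw [← norm_algebraMap_closure, ← Polynomial.coeff_map, Polynomial.map_taylor]
    exact le_gaussPt _ hr _ i

theorem gaussPt_minpoly (q : AlgebraicClosure k) (x : AffineLine (AlgebraicClosure k)) :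
    x.seminorm ((minpoly k q).map (algebraMap k (AlgebraicClosure k))) =
    (((minpoly k q).map (algebraMap k (AlgebraicClosure k))).roots.map x.dist).prod := by
  conv_lhs => rw [minpoly_map_eq_prod]
  exact x.apply_multiset_prod _

/-- A polynomial close to a constant q on a disk has absolute value |q| at each of its points. As q
need not lie in k, Q - q has no value at x; its substitute is p(Q), p the minimal polynomial of q.
The factor Q - q makes p(Q) smaller than |q|^deg p at the Gauss point, hence at x. But if |Q|_x <
|q|, the constant term of p dominates p(Q) at x and yields exactly |q|^deg p. -/
theorem AffineLine.InDisk.apply_eq_norm {x : AffineLine k} {a : AlgebraicClosure k} {r : ℝ}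
    (h : x.InDisk a r) (Q : k[X]) (q : AlgebraicClosure k)
    (hQ : ∀ hr : 0 < r, (gaussPt a r hr).seminorm
      (Q.map (algebraMap k (AlgebraicClosure k)) - Polynomial.C q) < ‖q‖) :
    x.seminorm Q = ‖q‖ := by
  obtain ⟨hr, h⟩ := h
  have hQ := hQ hr
  set w := gaussPt a r hr
  have hq : 0 < ‖q‖ := (apply_nonneg _ _).trans_lt hQ
  have hwQ : w.seminorm (Q.map (algebraMap k (AlgebraicClosure k))) = ‖q‖ := by
    have := w.apply_eq_of_sub_lt (hQ.trans_eq (w.map_C q).symm)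
    rw [this, w.map_C]
  have hle : x.seminorm Q ≤ ‖q‖ := hwQ ▸ h Q
  by_contra hne
  have hlt : x.seminorm Q < ‖q‖ := lt_of_le_of_ne hle hne
  set p := minpoly k q
  set R := (p.map (algebraMap k (AlgebraicClosure k))).roots with hR
  have hmon : p.Monic := minpoly.monic (Algebra.IsIntegral.isIntegral q)
  have hRn : ∀ b ∈ R, ‖b‖ = ‖q‖ := by
    intro b hb
    obtain ⟨σ, rfl⟩ := exists_algEquiv_of_mem_roots hb
    exact norm_algEquiv σ q
  have hcard : Multiset.card R = p.natDegree := by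
    rw [hR, ← (IsAlgClosed.splits (p.map (algebraMap k (AlgebraicClosure k)))).natDegree_eq_card_roots,
      Polynomial.natDegree_map]
  -- the value of `p.comp Q` at `w`
  have h1 : w.seminorm ((p.comp Q).map (algebraMap k (AlgebraicClosure k))) < ‖q‖ ^ p.natDegree := by
    have e : (p.comp Q).map (algebraMap k (AlgebraicClosure k)) =
        (R.map fun b => Q.map (algebraMap k (AlgebraicClosure k)) - Polynomial.C b).prod := by
      rw [Polynomial.map_comp, minpoly_map_eq_prod q, Polynomial.multiset_prod_comp,
        Multiset.map_map]
      simp [p, R]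
    rw [e, map_multiset_prod, Multiset.map_map, ← hcard]
    have := multiset_prod_lt (s := R) (f := fun b => w.seminorm
      (Q.map (algebraMap k (AlgebraicClosure k)) - Polynomial.C b)) (g := fun _ => ‖q‖)
      (fun _ _ => apply_nonneg _ _) (fun b hb => ?_) (fun _ _ => hq) (mem_roots_minpoly q) hQ
    · simpa using this
    · refine (w.apply_sub_le _ _).trans (max_le hwQ.le ?_)
      rw [w.map_C, hRn b hb]
  have h2 : x.seminorm (p.comp Q) < ‖q‖ ^ p.natDegree := (h _).trans_lt h1
  -- the coefficients of `p`
  have hcoef : ∀ i, ‖p.coeff i‖ * ‖q‖ ^ i ≤ ‖q‖ ^ p.natDegree := by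
    intro i
    have := le_gaussPt (0 : AlgebraicClosure k) hq (p.map (algebraMap k (AlgebraicClosure k))) i
    rw [gaussPt_minpoly, Polynomial.taylor_zero, Polynomial.coeff_map,
      norm_algebraMap_closure] at this
    refine this.trans_eq ?_
    rw [← hcard]
    rw [Multiset.map_congr rfl (g := fun _ => ‖q‖) fun b hb => by
      rw [gaussPt_dist, zero_sub, norm_neg, hRn b hb, max_self]]
    simp [R, p]
  have hcoef0 : ‖p.coeff 0‖ = ‖q‖ ^ p.natDegree := by
    rw [← norm_algebraMap_closure, ← Polynomial.coeff_map, Polynomial.coeff_zero_eq_eval_zero,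
      minpoly_map_eq_prod q, Polynomial.eval_multiset_prod, Multiset.map_map]
    have := map_multiset_prod (NormedField.toMulRingNorm (AlgebraicClosure k))
      (R.map fun b => - b)
    simp only [Function.comp_def, Polynomial.eval_sub, Polynomial.eval_X, Polynomial.eval_C,
      zero_sub]
    refine this.trans ?_
    rw [Multiset.map_map, ← hcard]
    rw [Multiset.map_congr rfl (g := fun _ => ‖q‖) fun b hb => by
      rw [Function.comp_apply, map_neg_eq_map]; exact hRn b hb]
    simp
  have h3 : x.seminorm (p.comp Q) = ‖q‖ ^ p.natDegree := by
    rw [← hcoef0, ← x.map_C]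
    refine x.apply_eq_of_sub_lt ?_
    rw [x.map_C, hcoef0, Polynomial.comp, Polynomial.eval₂_eq_sum_range, Finset.sum_range_succ',
      pow_zero, mul_one, add_sub_cancel_right]
    -- Each term of positive degree carries at least one factor |Q|_x / |q| < 1 relative to the
    -- constant term.
    refine (x.apply_sum_le _ _ (B := ‖q‖ ^ p.natDegree * (x.seminorm Q / ‖q‖)) ?_ ?_).trans_lt ?_
    · have := apply_nonneg x.seminorm Q
      positivity
    · intro i _
      rw [map_mul, map_pow, x.map_C]
      have e : x.seminorm Q ^ (i + 1) =
          ‖q‖ ^ (i + 1) * ((x.seminorm Q / ‖q‖) ^ i * (x.seminorm Q / ‖q‖)) := by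
        rw [← pow_succ, div_pow]; field_simp
      rw [e, ← mul_assoc]
      have hnn := apply_nonneg x.seminorm Q
      refine mul_le_mul (hcoef (i + 1)) ?_ (by positivity) (by positivity)
      refine mul_le_of_le_one_left (by positivity) (pow_le_one₀ (by positivity) ?_)
      exact (div_le_one hq).2 hle
    · refine mul_lt_of_lt_one_right (by positivity) ((div_lt_one hq).2 hlt)
  linarith

end Eta


/-! ### The joint diameter and its ultrametric inequality -/

section JointDiam

variable {k : Type*} [NontriviallyNormedField k] [IsUltrametricDist k] [CompleteSpace k]

/-- Over the algebraic closure P splits, and `gaussPt_prod_sub_lt` shows that P - P(a) is smaller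
than P(a) on the disk, as `AffineLine.InDisk.apply_eq_norm` requires. -/
theorem AffineLine.InDisk.apply_eq_norm_eval {x : AffineLine k} {a : AlgebraicClosure k} {r : ℝ}
    (h : x.InDisk a r) {P : k[X]} (hP : P ≠ 0)
    (hroots : ∀ b ∈ (P.map (algebraMap k (AlgebraicClosure k))).roots, r < ‖a - b‖) :
    x.seminorm P = ‖(P.map (algebraMap k (AlgebraicClosure k))).eval a‖ := by
  refine h.apply_eq_norm P _ fun hr => ?_
  set Q := P.map (algebraMap k (AlgebraicClosure k)) with hQ
  have hQ0 : Q ≠ 0 := Polynomial.map_ne_zero hP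
  have e : Q = Polynomial.C Q.leadingCoeff * (Q.roots.map fun b => Polynomial.X - Polynomial.C b).prod :=
    (IsAlgClosed.splits Q).eq_prod_roots
  have hlc : 0 < ‖Q.leadingCoeff‖ := norm_pos_iff.2 (Polynomial.leadingCoeff_ne_zero.2 hQ0)
  have key := gaussPt_prod_sub_lt a hr Q.roots hroots
  have e1 : Q.eval a = Q.leadingCoeff *
      (Q.roots.map fun b => Polynomial.X - Polynomial.C b).prod.eval a := by
    conv_lhs => rw [e]
    rw [Polynomial.eval_mul, Polynomial.eval_C]
  rw [e1, norm_mul, Polynomial.C_mul]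
  have e2 : ∀ G : (AlgebraicClosure k)[X], Q - G = Polynomial.C Q.leadingCoeff *
      (Q.roots.map fun b => Polynomial.X - Polynomial.C b).prod - G := fun G => by rw [← e]
  rw [e2, ← mul_sub, map_mul, AffineLine.map_C]
  exact mul_lt_mul_of_pos_left key hlc

theorem AffineLine.InDisk.dist_eq {x : AffineLine k} {a : AlgebraicClosure k} {r : ℝ}
    (h : x.InDisk a r) {b : k} (hb : r < ‖a - algebraMap k (AlgebraicClosure k) b‖) :
    x.dist b = ‖a - algebraMap k (AlgebraicClosure k) b‖ := by
  rw [AffineLine.dist, h.apply_eq_norm_eval (Polynomial.X_sub_C_ne_zero b)]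
  · simp
  · simpa using hb

theorem AffineLine.InDisk.dist_le {x : AffineLine k} {a : AlgebraicClosure k} {r : ℝ}
    (h : x.InDisk a r) (b : k) : x.dist b ≤ max r ‖a - algebraMap k (AlgebraicClosure k) b‖ := by
  obtain ⟨hr, h⟩ := h
  rw [← eta_dist a hr]
  exact h _

/-- Two disks whose images in the affine line over `k` contain a common point have nested
conjugates. -/
theorem AffineLine.InDisk.exists_algEquiv {x : AffineLine k} {a b : AlgebraicClosure k} {r s : ℝ}
    (ha : x.InDisk a r) (hb : x.InDisk b s) (hrs : r ≤ s) :
    ∃ σ : AlgebraicClosure k ≃ₐ[k] AlgebraicClosure k, ‖a - σ b‖ ≤ s := by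
  classical
  by_contra! hcon
  set p := minpoly k b with hp
  have hp0 : p ≠ 0 := minpoly.ne_zero (Algebra.IsIntegral.isIntegral b)
  set R := (p.map (algebraMap k (AlgebraicClosure k))).roots with hR
  have hRs : ∀ c ∈ R, s < ‖a - c‖ := by
    intro c hc
    obtain ⟨σ, rfl⟩ := exists_algEquiv_of_mem_roots hc
    exact hcon σ
  have hs : 0 < s := hb.1
  -- All roots of p now lie outside the disk of radius r around a, so |p| is constant there, equal
  -- to |p(a)|.
  have h1 : x.seminorm p = (R.map fun c => ‖a - c‖).prod := by
    rw [ha.apply_eq_norm_eval hp0 fun c hc => hrs.trans_lt (hRs c hc), minpoly_map_eq_prod b,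
      Polynomial.eval_multiset_prod, Multiset.map_map]
    refine (map_multiset_prod (NormedField.toMulRingNorm (AlgebraicClosure k)) _).trans ?_
    rw [Multiset.map_map]
    congr 1
    refine Multiset.map_congr rfl fun c _ => ?_
    simp only [Function.comp_apply, Polynomial.eval_sub, Polynomial.eval_X, Polynomial.eval_C]
    rfl
  obtain ⟨c₀, hc₀, hmin⟩ := R.toFinset.exists_min_image (fun c => ‖a - c‖)
    ⟨b, Multiset.mem_toFinset.2 (mem_roots_minpoly b)⟩
  rw [Multiset.mem_toFinset] at hc₀
  obtain ⟨τ, hτ⟩ := exists_algEquiv_of_mem_roots hc₀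
  set m := ‖a - c₀‖ with hm
  have hsm : s < m := hRs c₀ hc₀
  have hm0 : 0 < m := hs.trans hsm
  -- Enlarging the disk around b to radius m, the distance from a to the nearest root, keeps |p| at
  -- its Gauss point below |p(a)| = |p|_x. As m > s, this value strictly exceeds the one at η_{b,s},
  -- which bounds |p|_x: a contradiction.
  have h2 : (eta b m hm0).seminorm p ≤ x.seminorm p := by
    rw [h1, ← eta_algEquiv τ b hm0, hτ, eta_apply, gaussPt_minpoly]
    refine Multiset.prod_map_le_prod_map₀ _ _ (fun c _ => AffineLine.dist_nonneg _ _)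
      fun c hc => ?_
    have hmc := hmin c (Multiset.mem_toFinset.2 hc)
    rw [gaussPt_dist]
    refine max_le hmc ?_
    have : c₀ - c = (c₀ - a) + (a - c) := by ring
    rw [this]
    refine (IsUltrametricDist.norm_add_le_max _ _).trans (max_le ?_ le_rfl)
    rwa [norm_sub_rev]
  have h3 : (eta b s hs).seminorm p < (eta b m hm0).seminorm p := by
    rw [eta_apply, eta_apply, gaussPt_minpoly, gaussPt_minpoly]
    refine multiset_prod_lt (fun c _ => AffineLine.dist_nonneg _ _) (fun c _ => ?_) (fun c _ => ?_)
      (mem_roots_minpoly b) ?_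
    · rw [gaussPt_dist, gaussPt_dist]
      exact max_le_max hsm.le le_rfl
    · rw [gaussPt_dist]
      exact lt_max_of_lt_left hm0
    · rw [gaussPt_dist, gaussPt_dist]
      simpa [hs.le, hm0.le] using hsm
  have h4 := hb.2 p
  linarith

theorem bddBelow_jointDiam (x y : AffineLine k) :
    BddBelow {r : ℝ | ∃ (a : AlgebraicClosure k) (hr : 0 < r),
    (∀ P : k[X], x.seminorm P ≤ (eta a r hr).seminorm P) ∧
      ∀ P : k[X], y.seminorm P ≤ (eta a r hr).seminorm P} :=
  ⟨0, fun _ ⟨_, hr, _⟩ => hr.le⟩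

theorem jointDiam_le {x y : AffineLine k} {a : AlgebraicClosure k} {r : ℝ}
    (hx : x.InDisk a r) (hy : y.InDisk a r) : jointDiam x y ≤ r :=
  csInf_le (bddBelow_jointDiam x y) ⟨a, hx.1, hx.2, hy.2⟩

theorem exists_inDisk_of_jointDiam_lt {x y : AffineLine k} {t : ℝ} (h : jointDiam x y < t) :
    ∃ a r, r < t ∧ x.InDisk a r ∧ y.InDisk a r := by
  have hne : {r : ℝ | ∃ (a : AlgebraicClosure k) (hr : 0 < r),
      (∀ P : k[X], x.seminorm P ≤ (eta a r hr).seminorm P) ∧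
      ∀ P : k[X], y.seminorm P ≤ (eta a r hr).seminorm P}.Nonempty := by
    have h0 : 0 < max (x.dist 0) (y.dist 0) + 1 := by
      have := x.dist_nonneg 0
      have := le_max_left (x.dist 0) (y.dist 0)
      linarith
    have hx : x.InDisk (algebraMap k (AlgebraicClosure k) 0) (max (x.dist 0) (y.dist 0) + 1) :=
      inDisk_algebraMap_iff.2 ⟨h0, by linarith [le_max_left (x.dist 0) (y.dist 0)]⟩
    have hy : y.InDisk (algebraMap k (AlgebraicClosure k) 0) (max (x.dist 0) (y.dist 0) + 1) :=
      inDisk_algebraMap_iff.2 ⟨h0, by linarith [le_max_right (x.dist 0) (y.dist 0)]⟩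
    exact ⟨_, _, hx.1, hx.2, hy.2⟩
  obtain ⟨r, ⟨a, hr, hx, hy⟩, hrt⟩ := exists_lt_of_csInf_lt hne h
  exact ⟨a, r, hrt, ⟨hr, hx⟩, ⟨hr, hy⟩⟩

theorem le_jointDiam {x y : AffineLine k} {m : ℝ}
    (h : ∀ a r, x.InDisk a r → y.InDisk a r → m ≤ r) : m ≤ jointDiam x y := by
  by_contra! hlt
  obtain ⟨a, r, hr, hx, hy⟩ := exists_inDisk_of_jointDiam_lt hlt
  linarith [h a r hx hy]

theorem jointDiam_nonneg (x y : AffineLine k) : 0 ≤ jointDiam x y :=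
  le_jointDiam fun _ _ h _ => h.1.le

theorem jointDiam_comm (x y : AffineLine k) : jointDiam x y = jointDiam y x :=
  le_antisymm (le_jointDiam fun _ _ h h' => jointDiam_le h' h)
    (le_jointDiam fun _ _ h h' => jointDiam_le h' h)

theorem jointDiam_self_le (x y : AffineLine k) : jointDiam x x ≤ jointDiam x y :=
  le_jointDiam fun _ _ h _ => jointDiam_le h h

theorem jointDiam_self_le' (x y : AffineLine k) : jointDiam y y ≤ jointDiam x y :=
  le_jointDiam fun _ _ _ h => jointDiam_le h h

/-- Two disks having y in their images have nested conjugates, so a conjugate of the larger one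
captures both x and z. -/
theorem jointDiam_le_max (x y z : AffineLine k) :
    jointDiam x z ≤ max (jointDiam x y) (jointDiam y z) := by
  refine le_of_forall_gt_imp_ge_of_dense fun t ht => ?_
  obtain ⟨a, r, hr, hx, hy⟩ := exists_inDisk_of_jointDiam_lt ((le_max_left _ _).trans_lt ht)
  obtain ⟨b, s, hs, hy', hz⟩ := exists_inDisk_of_jointDiam_lt ((le_max_right _ _).trans_lt ht)
  rcases le_total r s with hrs | hrs
  · obtain ⟨σ, hσ⟩ := hy.exists_algEquiv hy' hrs
    exact (jointDiam_le (hx.mono hrs hσ) ((inDisk_algEquiv σ).2 hz)).trans hs.le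
  · obtain ⟨σ, hσ⟩ := hy'.exists_algEquiv hy hrs
    exact (jointDiam_le ((inDisk_algEquiv σ).2 hx) (hz.mono hrs hσ)).trans hr.le

theorem jointDiam_le_of_dist_le {x y : AffineLine k} {b : k} {r : ℝ} (hr : 0 ≤ r)
    (hx : x.dist b ≤ r) (hy : y.dist b ≤ r) : jointDiam x y ≤ r := by
  refine le_of_forall_gt_imp_ge_of_dense fun t ht => ?_
  exact jointDiam_le (inDisk_algebraMap_iff.2 ⟨hr.trans_lt ht, hx.trans ht.le⟩)
    (inDisk_algebraMap_iff.2 ⟨hr.trans_lt ht, hy.trans ht.le⟩)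

/-- A disk of radius below |T - b|_y cannot capture both points: if it contains b then |T - b|_y is
at most the radius, and otherwise T - b has constant absolute value on it. -/
theorem jointDiam_eq_dist {x y : AffineLine k} {b : k} (h : x.dist b < y.dist b) :
    jointDiam x y = y.dist b := by
  refine le_antisymm (jointDiam_le_of_dist_le (y.dist_nonneg b) h.le le_rfl)
    (le_jointDiam fun a r hx hy => ?_)
  by_contra! hr
  rcases le_or_gt ‖a - algebraMap k (AlgebraicClosure k) b‖ r with hab | hab
  · have := hy.dist_le b
    rw [max_eq_left hab] at this
    linarith
  · rw [hx.dist_eq hab, hy.dist_eq hab] at h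
    exact lt_irrefl _ h

/-- The Gauss point of a closed disk with centre in `k`. -/
def diskPt (b : k) (R : ℝ) (hR : 0 < R) : AffineLine k :=
  eta (algebraMap k (AlgebraicClosure k) b) R hR

theorem diskPt_dist (b : k) {R : ℝ} (hR : 0 < R) (c : k) :
    (diskPt b R hR).dist c = max R ‖b - c‖ := by
  rw [diskPt, eta_dist, ← map_sub, norm_algebraMap_closure]

theorem diskPt_eq {a b : k} {R : ℝ} (hR : 0 < R) (h : ‖a - b‖ ≤ R) :
    diskPt a R hR = diskPt b R hR := by
  refine AffineLine.ext' fun P => ?_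
  rw [diskPt, diskPt, eta_apply, eta_apply, gaussPt_eq hR]
  rwa [← map_sub, norm_algebraMap_closure]

theorem jointDiam_diskPt (x : AffineLine k) (b : k) {R : ℝ} (hR : 0 < R) :
    jointDiam x (diskPt b R hR) = max R (x.dist b) := by
  have hd : (diskPt b R hR).dist b = R := by rw [diskPt_dist]; simp [hR.le]
  rcases lt_or_ge R (x.dist b) with h | h
  · rw [jointDiam_comm, jointDiam_eq_dist (hd.trans_lt h), max_eq_right h.le]
  · rw [max_eq_left h]
    refine le_antisymm (jointDiam_le_of_dist_le hR.le h hd.le) (le_jointDiam fun a r _ hy => ?_)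
    by_contra! hr
    have hab : ‖a - algebraMap k (AlgebraicClosure k) b‖ ≤ R := by
      by_contra! hlt
      have := hy.dist_eq (hr.trans hlt)
      rw [hd] at this
      linarith
    have hab' : ‖algebraMap k (AlgebraicClosure k) b - a‖ ≤ R := by rwa [norm_sub_rev]
    -- If η_{b,R} were in the disk of radius r < R around a, it would be dominated by η_{a,r}. On
    -- the minimal polynomial of a this fails: no root factor is smaller at η_{b,R}, and T - a is at
    -- least R there instead of r.
    have h1 := hy.2 (minpoly k a)
    rw [diskPt, eta_apply, eta_apply, gaussPt_minpoly, gaussPt_minpoly] at h1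
    refine absurd h1 (not_le.2 (multiset_prod_lt (fun c _ => AffineLine.dist_nonneg _ _)
      (fun (c : AlgebraicClosure k) _ => ?_) (fun c _ => ?_) (mem_roots_minpoly a) ?_))
    · rw [gaussPt_dist, gaussPt_dist]
      refine max_le (hr.le.trans (le_max_left _ _)) ?_
      have : a - c = (a - algebraMap k (AlgebraicClosure k) b) +
        (algebraMap k (AlgebraicClosure k) b - c) := by ring
      rw [this]
      exact (IsUltrametricDist.norm_add_le_max _ _).trans (max_le_max hab le_rfl)
    · rw [gaussPt_dist]
      exact lt_max_of_lt_left hR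
    · rw [gaussPt_dist, gaussPt_dist]
      simpa [hy.1.le] using Or.inl hr

theorem jointDiam_diskPt_self (b : k) {R : ℝ} (hR : 0 < R) :
    jointDiam (diskPt b R hR) (diskPt b R hR) = R := by
  rw [jointDiam_diskPt, diskPt_dist]; simp [hR.le]

end JointDiam

/-! ### Type 1 points are the points of diameter zero -/

section TypeOne

variable {k : Type*} [NontriviallyNormedField k] [IsUltrametricDist k] [CompleteSpace k]

/-- Evaluation at a point of the completed algebraic closure, as a point of the affine line over
the algebraic closure. -/
def evalPt (α : CompletedAlgClosure k) : AffineLine (AlgebraicClosure k) where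
  seminorm := pullback (Polynomial.eval₂RingHom (UniformSpace.Completion.coeRingHom :
    AlgebraicClosure k →+* CompletedAlgClosure k) α)
    (NormedField.toMulRingNorm (CompletedAlgClosure k)).toMulRingSeminorm
  map_C a := by
    change ‖(Polynomial.C a).eval₂ (UniformSpace.Completion.coeRingHom :
      AlgebraicClosure k →+* CompletedAlgClosure k) α‖ = _
    rw [Polynomial.eval₂_C]
    exact UniformSpace.Completion.norm_coe a

theorem evalPt_apply (α : CompletedAlgClosure k) (P : (AlgebraicClosure k)[X]) :
    (evalPt α).seminorm P = ‖P.eval₂ UniformSpace.Completion.coeRingHom α‖ := rfl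

theorem evalPt_map (α : CompletedAlgClosure k) (P : k[X]) :
    (evalPt α).seminorm (P.map (algebraMap k (AlgebraicClosure k))) = ‖P.eval₂ (embed k) α‖ := by
  rw [evalPt_apply, Polynomial.eval₂_map]
  rfl

theorem evalPt_dist (α : CompletedAlgClosure k) (a : AlgebraicClosure k) :
    (evalPt α).dist a = ‖α - (a : CompletedAlgClosure k)‖ := by
  rw [AffineLine.dist, evalPt_apply]
  simp [UniformSpace.Completion.coeRingHom]

theorem jointDiam_eq_zero_of_isType1 {x : AffineLine k} (h : IsType1 (x : ProjLine k)) :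
    jointDiam x x = 0 := by
  obtain h | ⟨y, α, hxy, hα⟩ := h
  · simp at h
  obtain rfl : x = y := by simpa using hxy
  refine le_antisymm (le_of_forall_gt_imp_ge_of_dense fun ε hε => ?_) (jointDiam_nonneg _ _)
  obtain ⟨a, ha⟩ := UniformSpace.Completion.denseRange_coe.exists_dist_lt α hε
  rw [dist_eq_norm] at ha
  have : x.InDisk a ε := ⟨hε, fun P => by
    rw [hα, ← evalPt_map, eta_apply]
    exact le_gaussPt_of_dist_le _ hε (by rw [evalPt_dist]; exact ha.le) _⟩
  exact jointDiam_le this this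

/-- The centres of small disks around x are determined only up to conjugation; each new centre is
replaced by a conjugate close to the previous one, so that the sequence becomes Cauchy. -/
theorem seq_of_jointDiam_eq_zero {x : AffineLine k} (h : jointDiam x x = 0) :
    ∃ b : ℕ → AlgebraicClosure k, (∀ n, x.InDisk (b n) ((1 / 2) ^ n)) ∧
      ∀ n, ‖b n - b (n + 1)‖ ≤ (1 / 2) ^ n := by
  have h1 : ∀ n : ℕ, ∃ a, x.InDisk a ((1 / 2) ^ n) := by
    intro n
    have : jointDiam x x < (1 / 2) ^ n := by rw [h]; positivity
    obtain ⟨a, r, hr, hx, -⟩ := exists_inDisk_of_jointDiam_lt this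
    exact ⟨a, hx.mono hr.le (by rw [sub_self, norm_zero]; positivity)⟩
  have h2 : ∀ (n : ℕ) (a : {a // x.InDisk a ((1 / 2) ^ n)}),
      ∃ b : {a // x.InDisk a ((1 / 2) ^ (n + 1))}, ‖a.1 - b.1‖ ≤ (1 / 2) ^ n := by
    rintro n ⟨a, ha⟩
    obtain ⟨b, hb⟩ := h1 (n + 1)
    have hle : ((1 : ℝ) / 2) ^ (n + 1) ≤ (1 / 2) ^ n :=
      pow_le_pow_of_le_one (by norm_num) (by norm_num) (Nat.le_succ n)
    obtain ⟨σ, hσ⟩ := hb.exists_algEquiv ha hle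
    refine ⟨⟨σ.symm b, (inDisk_algEquiv _).2 hb⟩, ?_⟩
    rw [← norm_algEquiv σ]
    rwa [map_sub, AlgEquiv.apply_symm_apply, norm_sub_rev]
  choose f hf using h2
  let b : (n : ℕ) → {a // x.InDisk a ((1 / 2) ^ n)} := fun n =>
    Nat.rec ⟨(h1 0).choose, (h1 0).choose_spec⟩ (fun n a => f n a) n
  exact ⟨fun n => (b n).1, fun n => (b n).2, fun n => hf n (b n)⟩

-- The centres bₙ converge to some α. If P(α) = 0, the values of P at the Gauss points around bₙ
-- bound |P|_x and tend to 0. Otherwise the disks eventually avoid the zeros of P, and |P|_x =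
-- |P(bₙ)| for large n.
open Filter Topology in
theorem isType1_of_jointDiam_eq_zero {x : AffineLine k} (h : jointDiam x x = 0) :
    IsType1 (x : ProjLine k) := by
  classical
  obtain ⟨b, hb, hb'⟩ := seq_of_jointDiam_eq_zero h
  have hcau : CauchySeq fun n => (b n : CompletedAlgClosure k) := by
    refine cauchySeq_of_le_geometric (1 / 2) 1 (by norm_num) fun n => ?_
    rw [dist_eq_norm, ← UniformSpace.Completion.coe_sub, UniformSpace.Completion.norm_coe, one_mul]
    exact hb' n
  obtain ⟨α, hα⟩ := cauchySeq_tendsto_of_complete hcau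
  refine Or.inr ⟨x, α, rfl, fun P => ?_⟩
  rw [← evalPt_map]
  rcases eq_or_ne P 0 with rfl | hP
  · simp
  set Q := P.map (algebraMap k (AlgebraicClosure k)) with hQ
  have e : ∀ w : AffineLine (AlgebraicClosure k),
      w.seminorm Q = ‖Q.leadingCoeff‖ * (Q.roots.map w.dist).prod := by
    intro w
    conv_lhs => rw [(IsAlgClosed.splits Q).eq_prod_roots]
    rw [map_mul, w.map_C, w.apply_multiset_prod]
  have hr : Tendsto (fun n : ℕ => ((1 : ℝ) / 2) ^ n) atTop (𝓝 0) :=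
    tendsto_pow_atTop_nhds_zero_of_lt_one (by norm_num) (by norm_num)
  have hdist : ∀ c : AlgebraicClosure k,
      Tendsto (fun n => ‖b n - c‖) atTop (𝓝 ((evalPt α).dist c)) := by
    intro c
    rw [evalPt_dist]
    refine ((hα.sub_const (c : CompletedAlgClosure k)).norm).congr fun n => ?_
    rw [← UniformSpace.Completion.coe_sub, UniformSpace.Completion.norm_coe]
  by_cases h0 : ∃ c ∈ Q.roots, (evalPt α).dist c = 0
  · obtain ⟨c, hc, hc0⟩ := h0
    have hz : (evalPt α).seminorm Q = 0 := by
      rw [e]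
      refine mul_eq_zero_of_right _ (Multiset.prod_eq_zero (Multiset.mem_map.2 ⟨c, hc, hc0⟩))
    rw [hz]
    refine le_antisymm ?_ (apply_nonneg _ _)
    have hlim : Tendsto (fun n => ‖Q.leadingCoeff‖ *
        (Q.roots.map fun c => max (((1 : ℝ) / 2) ^ n) ‖b n - c‖).prod) atTop
        (𝓝 ((evalPt α).seminorm Q)) := by
      rw [e]
      refine Tendsto.const_mul _ (tendsto_multiset_prod _ fun c _ => ?_)
      have := hr.max (hdist c)
      rwa [max_eq_right (AffineLine.dist_nonneg _ _)] at this
    rw [hz] at hlim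
    refine ge_of_tendsto' hlim fun n => ((hb n).2 P).trans_eq ?_
    rw [eta_apply, e]
    congr 2
    exact Multiset.map_congr rfl fun c _ => gaussPt_dist _ _ _
  · push Not at h0
    have hev : ∀ᶠ n in atTop, ∀ c ∈ Q.roots, ((1 : ℝ) / 2) ^ n < ‖b n - c‖ := by
      have : ∀ᶠ n in atTop, ∀ c ∈ Q.roots.toFinset, ((1 : ℝ) / 2) ^ n < ‖b n - c‖ := by
        rw [Filter.eventually_all_finset]
        intro c hc
        refine hr.eventually_lt (hdist c) ?_
        exact lt_of_le_of_ne (AffineLine.dist_nonneg _ _) (h0 c (Multiset.mem_toFinset.1 hc)).symm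
      filter_upwards [this] with n hn c hc using hn c (Multiset.mem_toFinset.2 hc)
    have hlim : Tendsto (fun n => ‖Q.eval (b n)‖) atTop (𝓝 ((evalPt α).seminorm Q)) := by
      have : ∀ a : AlgebraicClosure k, ‖Q.eval a‖ = ‖Q.leadingCoeff‖ *
          (Q.roots.map fun c => ‖a - c‖).prod := by
        intro a
        have h2 := e (evalPt (a : CompletedAlgClosure k))
        have h3 : (evalPt (a : CompletedAlgClosure k)).seminorm Q = ‖Q.eval a‖ := by
          rw [evalPt_apply]
          rw [← UniformSpace.Completion.norm_coe (Q.eval a)]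
          congr 1
          exact Polynomial.eval₂_at_apply UniformSpace.Completion.coeRingHom a
        rw [← h3, h2]
        congr 2
        refine Multiset.map_congr rfl fun c _ => ?_
        rw [evalPt_dist, ← UniformSpace.Completion.coe_sub, UniformSpace.Completion.norm_coe]
      simp only [this]
      rw [e]
      exact Tendsto.const_mul _ (tendsto_multiset_prod _ fun c _ => hdist c)
    refine tendsto_nhds_unique (tendsto_const_nhds.congr' ?_) hlim
    filter_upwards [hev] with n hn
    exact (hb n).apply_eq_norm_eval hP hn

theorem coe_mem_hyperbolicSpace {x : AffineLine k} :
    (x : ProjLine k) ∈ hyperbolicSpace k ↔ 0 < jointDiam x x := by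
  have : IsType1 (x : ProjLine k) ↔ jointDiam x x = 0 :=
    ⟨jointDiam_eq_zero_of_isType1, isType1_of_jointDiam_eq_zero⟩
  rw [hyperbolicSpace, Set.mem_ofPred_eq, this]
  exact (jointDiam_nonneg x x).lt_iff_ne'.symm

theorem infty_notMem_hyperbolicSpace : (∞ : ProjLine k) ∉ hyperbolicSpace k :=
  fun h => h (Or.inl rfl)

end TypeOne


/-! ### Möbius transformations in the affine coordinate -/

section Moebius

variable {F : Type*} [NormedField F]

/-- The numerator `P((a T + b) / (c T + d)) (c T + d)ⁿ`. -/
def moebPoly (g : Matrix (Fin 2) (Fin 2) F) (P : F[X]) (n : ℕ) : F[X] :=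
  MvPolynomial.aeval ![Polynomial.C (g 0 0) * Polynomial.X + Polynomial.C (g 0 1),
    Polynomial.C (g 1 0) * Polynomial.X + Polynomial.C (g 1 1)] (P.homogenize n)

theorem moebPoly_linear (g : Matrix (Fin 2) (Fin 2) F) (u v : F) :
    moebPoly g (Polynomial.C u * Polynomial.X + Polynomial.C v) 1 =
      Polynomial.C u * (Polynomial.C (g 0 0) * Polynomial.X + Polynomial.C (g 0 1)) +
      Polynomial.C v * (Polynomial.C (g 1 0) * Polynomial.X + Polynomial.C (g 1 1)) := by
  rw [moebPoly, Polynomial.homogenize_add, Polynomial.homogenize_C_mul,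
    Polynomial.homogenize_X one_ne_zero, Polynomial.homogenize_C]
  simp

theorem moebPoly_map {E : Type*} [NormedField E] (f : F →+* E) (g : Matrix (Fin 2) (Fin 2) F)
    (P : F[X]) (n : ℕ) : (moebPoly g P n).map f = moebPoly (g.map f) (P.map f) n := by
  rw [moebPoly, moebPoly, Polynomial.homogenize_map, MvPolynomial.aeval_def,
    MvPolynomial.aeval_def, MvPolynomial.eval₂_map, ← Polynomial.coe_mapRingHom,
    MvPolynomial.hom_eval₂]
  congr 1
  · ext x
    simp
  · funext i
    fin_cases i <;> simp

/-- The absolute value of the denominator `c T + d` of a Möbius transformation. -/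
def AffineLine.denom (x : AffineLine F) (g : Matrix (Fin 2) (Fin 2) F) : ℝ :=
  x.seminorm (Polynomial.C (g 1 0) * Polynomial.X + Polynomial.C (g 1 1))

theorem homSeminorm_subst (x : AffineLine F) (g : Matrix (Fin 2) (Fin 2) F)
    (G : MvPolynomial (Fin 2) F) :
    homSeminorm (x : ProjLine F) (subst g G) = x.seminorm (MvPolynomial.aeval
      ![Polynomial.C (g 0 0) * Polynomial.X + Polynomial.C (g 0 1),
        Polynomial.C (g 1 0) * Polynomial.X + Polynomial.C (g 1 1)] G) := by
  rw [homSeminorm_coe]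
  congr 1
  rw [subst]
  have : (MvPolynomial.aeval ![Polynomial.X, 1] : MvPolynomial (Fin 2) F →ₐ[F] F[X]).comp
      (MvPolynomial.aeval fun i =>
        MvPolynomial.C (g i 0) * MvPolynomial.X 0 + MvPolynomial.C (g i 1) * MvPolynomial.X 1) =
      MvPolynomial.aeval ![Polynomial.C (g 0 0) * Polynomial.X + Polynomial.C (g 0 1),
        Polynomial.C (g 1 0) * Polynomial.X + Polynomial.C (g 1 1)] := by
    ext i : 1
    fin_cases i <;> simp [MvPolynomial.algHom_C]
  exact congrArg (fun f => f G) this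

theorem moebius_coe (g : GL (Fin 2) F) (x : AffineLine F)
    (hx : x.denom (g : Matrix (Fin 2) (Fin 2) F) ≠ 0) :
    ∃ z : AffineLine F, moebius g (x : ProjLine F) = z ∧ ∀ (P : F[X]) (n : ℕ), P.natDegree ≤ n →
      z.seminorm P * x.denom (g : Matrix (Fin 2) (Fin 2) F) ^ n =
        x.seminorm (moebPoly (g : Matrix (Fin 2) (Fin 2) F) P n) := by
  have hd : x.denom (g : Matrix (Fin 2) (Fin 2) F) =
      pullback (subst (g : Matrix (Fin 2) (Fin 2) F)).toRingHom (homSeminorm (x : ProjLine F))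
        (MvPolynomial.X 1) := by
    refine Eq.trans ?_ (homSeminorm_subst x _ _).symm
    rw [MvPolynomial.aeval_X]
    rfl
  have hX := hd ▸ hx
  refine ⟨_, dif_neg hX, fun P n hn => ?_⟩
  rw [dehomogenize_apply _ _ _ _ hn, ← hd, div_mul_cancel₀ _ (pow_ne_zero n hx)]
  exact homSeminorm_subst x _ _

theorem moebius_coe_eq_infty (g : GL (Fin 2) F) (x : AffineLine F)
    (hx : x.denom (g : Matrix (Fin 2) (Fin 2) F) = 0) : moebius g (x : ProjLine F) = ∞ := by
  refine dif_pos ?_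
  refine (homSeminorm_subst x _ _).trans ?_
  rw [MvPolynomial.aeval_X]
  exact hx

end Moebius

section MoebiusRel

variable {k : Type*} [NormedField k]

/-- `z` is the image of `x`, both affine, under the Möbius transformation of `g`. -/
def MoebiusRel (g : GL (Fin 2) k) (x z : AffineLine k) : Prop :=
  0 < x.denom (g : Matrix (Fin 2) (Fin 2) k) ∧ ∀ (P : k[X]) (n : ℕ), P.natDegree ≤ n →
      z.seminorm P * x.denom (g : Matrix (Fin 2) (Fin 2) k) ^ n =
        x.seminorm (moebPoly (g : Matrix (Fin 2) (Fin 2) k) P n)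

theorem moebiusRel_of_eq {g : GL (Fin 2) k} {x z : AffineLine k}
    (h : moebius g (x : ProjLine k) = z) : MoebiusRel g x z := by
  by_cases h0 : x.denom (g : Matrix (Fin 2) (Fin 2) k) = 0
  · rw [moebius_coe_eq_infty g x h0] at h
    simp at h
  · obtain ⟨z', hz', h'⟩ := moebius_coe g x h0
    rw [hz'] at h
    obtain rfl : z' = z := by simpa using h
    exact ⟨lt_of_le_of_ne (apply_nonneg _ _) (Ne.symm h0), h'⟩

theorem MoebiusRel.apply_linear {g : GL (Fin 2) k} {x z : AffineLine k} (h : MoebiusRel g x z)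
    (u v : k) : z.seminorm (Polynomial.C u * Polynomial.X + Polynomial.C v) *
      x.denom (g : Matrix (Fin 2) (Fin 2) k) = x.seminorm
      (Polynomial.C u * (Polynomial.C (g 0 0) * Polynomial.X + Polynomial.C (g 0 1)) +
      Polynomial.C v * (Polynomial.C (g 1 0) * Polynomial.X + Polynomial.C (g 1 1))) := by
  rw [← moebPoly_linear, ← h.2 _ 1 Polynomial.natDegree_linear_le, pow_one]

theorem det_fin_two' (g : GL (Fin 2) k) :
    (g : Matrix (Fin 2) (Fin 2) k).det = g 0 0 * g 1 1 - g 0 1 * g 1 0 :=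
  Matrix.det_fin_two _

theorem det_ne_zero' (g : GL (Fin 2) k) : (g : Matrix (Fin 2) (Fin 2) k).det ≠ 0 :=
  ((Matrix.isUnit_iff_isUnit_det _).1 g.isUnit).ne_zero

/-- Cocycle relation of the denominators cT + d for the product g⁻¹ g = 1. -/
theorem MoebiusRel.denom_inv {g : GL (Fin 2) k} {x z : AffineLine k} (h : MoebiusRel g x z) :
    z.denom ((g⁻¹ : GL (Fin 2) k) : Matrix (Fin 2) (Fin 2) k) *
      x.denom (g : Matrix (Fin 2) (Fin 2) k) = 1 := by
  rw [AffineLine.denom, h.apply_linear]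
  have e : ((g⁻¹ : GL (Fin 2) k) : Matrix (Fin 2) (Fin 2) k) * (g : Matrix (Fin 2) (Fin 2) k) = 1 := by
    rw [← Units.val_mul, inv_mul_cancel, Units.val_one]
  have e0 := congrFun (congrFun e 1) 0
  have e1 := congrFun (congrFun e 1) 1
  rw [Matrix.mul_apply, Fin.sum_univ_two] at e0 e1
  simp only [Matrix.one_apply, Fin.isValue, one_ne_zero, if_false, if_true] at e0 e1
  generalize ((g⁻¹ : GL (Fin 2) k) : Matrix (Fin 2) (Fin 2) k) 1 0 = u at e0 e1 ⊢
  generalize ((g⁻¹ : GL (Fin 2) k) : Matrix (Fin 2) (Fin 2) k) 1 1 = v at e0 e1 ⊢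
  have e2 : Polynomial.C u * (Polynomial.C (g 0 0) * Polynomial.X + Polynomial.C (g 0 1)) +
      Polynomial.C v * (Polynomial.C (g 1 0) * Polynomial.X + Polynomial.C (g 1 1)) =
      Polynomial.C (u * g 0 0 + v * g 1 0) * Polynomial.X +
      Polynomial.C (u * g 0 1 + v * g 1 1) := by
    simp only [Polynomial.C_add, Polynomial.C_mul]
    ring
  rw [e2, e0, e1]
  simp

theorem MoebiusRel.symm {g : GL (Fin 2) k} {x z : AffineLine k}
    (h : g • (x : ProjLine k) = z) : MoebiusRel g⁻¹ z x := by
  refine moebiusRel_of_eq ?_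
  change g⁻¹ • (z : ProjLine k) = x
  rw [← h, inv_smul_smul]

end MoebiusRel

/-! ### Transformation of the joint diameter under Möbius maps -/

section Scaling

variable {k : Type*} [NontriviallyNormedField k] [IsUltrametricDist k] [CompleteSpace k]

/-- By `hr` the disk does not contain the pole of g, so |cT + d| is constant on it and the image is
a disk around g(e), with radius scaled by |g'(e)| = |det g| / |ce + d|². Domination is checked
against the image `w'` of the Gauss point over the algebraic closure. -/
theorem MoebiusRel.inDisk {g : GL (Fin 2) k} {x z : AffineLine k} (h : MoebiusRel g x z)
    {e : AlgebraicClosure k} {r : ℝ} (hx : x.InDisk e r)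
    (hr : ‖g 1 0‖ * r < ‖algebraMap k (AlgebraicClosure k) (g 1 0) * e +
      algebraMap k (AlgebraicClosure k) (g 1 1)‖) :
    x.denom (g : Matrix (Fin 2) (Fin 2) k) = ‖algebraMap k (AlgebraicClosure k) (g 1 0) * e +
      algebraMap k (AlgebraicClosure k) (g 1 1)‖ ∧
    z.InDisk ((algebraMap k (AlgebraicClosure k) (g 0 0) * e +
        algebraMap k (AlgebraicClosure k) (g 0 1)) /
      (algebraMap k (AlgebraicClosure k) (g 1 0) * e + algebraMap k (AlgebraicClosure k) (g 1 1)))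
      (r * ‖(g : Matrix (Fin 2) (Fin 2) k).det‖ / ‖algebraMap k (AlgebraicClosure k) (g 1 0) * e +
      algebraMap k (AlgebraicClosure k) (g 1 1)‖ ^ 2) := by
  set φ := algebraMap k (AlgebraicClosure k) with hφ
  set q := φ (g 1 0) * e + φ (g 1 1) with hq
  have hr0 : 0 < r := hx.1
  set w := gaussPt e r hr0 with hw
  have hwe : w.seminorm (Polynomial.X - Polynomial.C e) = r := by
    refine (gaussPt_dist e hr0 e).trans ?_
    simp [hr0.le]
  have hq0 : 0 < ‖q‖ := (by positivity : 0 ≤ ‖g 1 0‖ * r).trans_lt hr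
  have hqne : q ≠ 0 := norm_pos_iff.1 hq0
  have hden : x.denom (g : Matrix (Fin 2) (Fin 2) k) = ‖q‖ := by
    refine hx.apply_eq_norm _ q fun hr' => ?_
    have : (Polynomial.C (g 1 0) * Polynomial.X + Polynomial.C (g 1 1)).map φ - Polynomial.C q =
        Polynomial.C (φ (g 1 0)) * (Polynomial.X - Polynomial.C e) := by
      simp only [Polynomial.map_add, Polynomial.map_mul, Polynomial.map_C, Polynomial.map_X, hq,
        Polynomial.C_add, Polynomial.C_mul]
      ring
    rw [this, map_mul, AffineLine.map_C, hφ, norm_algebraMap_closure]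
    exact (congrArg _ hwe).trans_lt hr
  refine ⟨hden, ?_⟩
  set gK := Matrix.GeneralLinearGroup.map φ g with hgK
  have hgK' : (gK : Matrix (Fin 2) (Fin 2) (AlgebraicClosure k)) =
      (g : Matrix (Fin 2) (Fin 2) k).map φ := rfl
  have hdenK : w.denom (gK : Matrix (Fin 2) (Fin 2) (AlgebraicClosure k)) = ‖q‖ := by
    rw [AffineLine.denom, hgK', ← w.map_C]
    refine w.apply_eq_of_sub_lt ?_
    have : Polynomial.C (((g : Matrix (Fin 2) (Fin 2) k).map φ) 1 0) * Polynomial.X +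
        Polynomial.C (((g : Matrix (Fin 2) (Fin 2) k).map φ) 1 1) - Polynomial.C q =
        Polynomial.C (φ (g 1 0)) * (Polynomial.X - Polynomial.C e) := by
      simp only [Matrix.map_apply, hq, Polynomial.C_add, Polynomial.C_mul]
      ring
    rw [this, map_mul, w.map_C, w.map_C, hφ, norm_algebraMap_closure, hwe]
    exact hr
  obtain ⟨w', -, hw'⟩ := moebius_coe gK w (by rw [hdenK]; exact hq0.ne')
  have hdet : 0 < ‖(g : Matrix (Fin 2) (Fin 2) k).det‖ := norm_pos_iff.2 (det_ne_zero' g)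
  have hr' : 0 < r * ‖(g : Matrix (Fin 2) (Fin 2) k).det‖ / ‖q‖ ^ 2 := by positivity
  refine ⟨hr', fun P => ?_⟩
  have h1 : z.seminorm P ≤ w'.seminorm (P.map φ) := by
    have e1 := h.2 P _ le_rfl
    have e2 := hw' (P.map φ) P.natDegree (Polynomial.natDegree_map_le)
    rw [hdenK, hgK', ← moebPoly_map] at e2
    rw [hden] at e1
    have := hx.2 (moebPoly (g : Matrix (Fin 2) (Fin 2) k) P P.natDegree)
    rw [← e1, eta_apply, ← hφ, ← e2] at this
    exact le_of_mul_le_mul_right this (by positivity)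
  refine h1.trans (le_gaussPt_of_dist_le w' hr' (le_of_eq ?_) _)
  have e3 := hw' (Polynomial.C 1 * Polynomial.X + Polynomial.C (-((φ (g 0 0) * e + φ (g 0 1)) / q)))
    1 Polynomial.natDegree_linear_le
  -- Multiplied by its denominator, gT - g(e) becomes (det g / q)(T - e), which gives the new
  -- radius.
  have e4 : Polynomial.C (1 : AlgebraicClosure k) *
      (Polynomial.C (((g : Matrix (Fin 2) (Fin 2) k).map φ) 0 0) * Polynomial.X +
        Polynomial.C (((g : Matrix (Fin 2) (Fin 2) k).map φ) 0 1)) +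
      Polynomial.C (-((φ (g 0 0) * e + φ (g 0 1)) / q)) *
      (Polynomial.C (((g : Matrix (Fin 2) (Fin 2) k).map φ) 1 0) * Polynomial.X +
        Polynomial.C (((g : Matrix (Fin 2) (Fin 2) k).map φ) 1 1)) =
      Polynomial.C (φ (g : Matrix (Fin 2) (Fin 2) k).det / q) *
        (Polynomial.X - Polynomial.C e) := by
    have a1 : φ (g : Matrix (Fin 2) (Fin 2) k).det / q = φ (g 0 0) -
        (φ (g 0 0) * e + φ (g 0 1)) / q * φ (g 1 0) := by
      rw [det_fin_two', map_sub, map_mul, map_mul]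
      field_simp
      rw [hq]; ring
    have a2 : - (φ (g : Matrix (Fin 2) (Fin 2) k).det / q * e) = φ (g 0 1) -
        (φ (g 0 0) * e + φ (g 0 1)) / q * φ (g 1 1) := by
      rw [det_fin_two', map_sub, map_mul, map_mul]
      field_simp
      rw [hq]; ring
    rw [mul_sub, ← Polynomial.C_mul, sub_eq_add_neg _ (Polynomial.C _), ← Polynomial.C_neg, a2, a1]
    simp only [Matrix.map_apply, Polynomial.C_sub, Polynomial.C_mul, Polynomial.C_neg,
      Polynomial.C_1]
    ring
  rw [hdenK, hgK', moebPoly_linear, e4, map_mul, w.map_C, hwe, pow_one, norm_div, hφ,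
    norm_algebraMap_closure, ← hφ] at e3
  have e5 : Polynomial.C (1 : AlgebraicClosure k) * Polynomial.X +
      Polynomial.C (-((φ (g 0 0) * e + φ (g 0 1)) / q)) =
      Polynomial.X - Polynomial.C ((φ (g 0 0) * e + φ (g 0 1)) / q) := by
    rw [Polynomial.C_neg, Polynomial.C_1, one_mul, ← sub_eq_add_neg]
  rw [e5] at e3
  change w'.seminorm _ = _
  rw [eq_div_iff (by positivity), pow_two, ← mul_assoc, e3]
  field_simp

theorem MoebiusRel.jointDiam_le {g : GL (Fin 2) k} {x y z w : AffineLine k}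
    (hz : MoebiusRel g x z) (hw : MoebiusRel g y w) :
    jointDiam z w * (x.denom (g : Matrix (Fin 2) (Fin 2) k) *
      y.denom (g : Matrix (Fin 2) (Fin 2) k)) ≤
      jointDiam x y * ‖(g : Matrix (Fin 2) (Fin 2) k).det‖ := by
  have hdet : 0 < ‖(g : Matrix (Fin 2) (Fin 2) k).det‖ := norm_pos_iff.2 (det_ne_zero' g)
  rw [← div_le_iff₀ hdet]
  refine le_jointDiam fun e r hx hy => ?_
  rw [div_le_iff₀ hdet]
  have hx0 := hz.1
  have hy0 := hw.1
  rcases lt_or_ge (‖g 1 0‖ * r) ‖algebraMap k (AlgebraicClosure k) (g 1 0) * e +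
      algebraMap k (AlgebraicClosure k) (g 1 1)‖ with h | h
  · obtain ⟨h1, h2⟩ := hz.inDisk hx h
    obtain ⟨h3, h4⟩ := hw.inDisk hy h
    have := Berkovich.jointDiam_le h2 h4
    rw [h1] at hx0
    rw [h1, h3, ← pow_two]
    rwa [le_div_iff₀ (by positivity)] at this
  -- Now the pole lies in the disk, so the image is not a bounded disk. Instead |cT + d| ≤ |c| r on
  -- the disk, and the images are compared with a/c = g(∞), from which gu has distance |det g| /
  -- (|c| |cu + d|); both images then lie in the disk around a/c of the required radius.
  · have hden : ∀ u : AffineLine k, u.InDisk e r →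
        u.denom (g : Matrix (Fin 2) (Fin 2) k) ≤ ‖g 1 0‖ * r := by
      intro u hu
      refine (hu.2 _).trans ?_
      rw [eta_apply]
      have : (Polynomial.C (g 1 0) * Polynomial.X + Polynomial.C (g 1 1)).map
          (algebraMap k (AlgebraicClosure k)) =
          Polynomial.C (algebraMap k (AlgebraicClosure k) (g 1 0)) *
            (Polynomial.X - Polynomial.C e) +
          Polynomial.C (algebraMap k (AlgebraicClosure k) (g 1 0) * e +
            algebraMap k (AlgebraicClosure k) (g 1 1)) := by
        simp only [Polynomial.map_add, Polynomial.map_mul, Polynomial.map_C, Polynomial.map_X,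
          Polynomial.C_add, Polynomial.C_mul]
        ring
      rw [this]
      refine ((gaussPt e r hu.1).nonarch _ _).trans (max_le ?_ ?_)
      · rw [map_mul, AffineLine.map_C, norm_algebraMap_closure]
        refine mul_le_mul_of_nonneg_left ?_ (norm_nonneg _)
        refine (gaussPt_dist e hu.1 e).le.trans ?_
        simp [hu.1.le]
      · rw [AffineLine.map_C]
        exact h
    have hc : 0 < ‖g 1 0‖ := by
      have := hx0.trans_le (hden x hx)
      exact (pos_iff_pos_of_mul_pos this).2 hx.1
    have hc0 : g 1 0 ≠ 0 := norm_pos_iff.1 hc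
    have hdist : ∀ u v : AffineLine k, MoebiusRel g u v →
        v.dist (g 0 0 / g 1 0) * u.denom (g : Matrix (Fin 2) (Fin 2) k) * ‖g 1 0‖ =
          ‖(g : Matrix (Fin 2) (Fin 2) k).det‖ := by
      intro u v huv
      have e1 := huv.apply_linear 1 (-(g 0 0 / g 1 0))
      have e2 : Polynomial.C (1 : k) * (Polynomial.C (g 0 0) * Polynomial.X +
          Polynomial.C (g 0 1)) + Polynomial.C (-(g 0 0 / g 1 0)) *
          (Polynomial.C (g 1 0) * Polynomial.X + Polynomial.C (g 1 1)) =
          Polynomial.C (-((g : Matrix (Fin 2) (Fin 2) k).det / g 1 0)) := by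
        have a1 : -((g : Matrix (Fin 2) (Fin 2) k).det / g 1 0) =
            g 0 1 - g 0 0 / g 1 0 * g 1 1 := by
          rw [det_fin_two']
          field_simp
          ring
        have a2 : g 0 0 = g 0 0 / g 1 0 * g 1 0 := by field_simp
        rw [a1]
        nth_rewrite 1 [a2]
        simp only [Polynomial.C_1, Polynomial.C_neg, Polynomial.C_sub, Polynomial.C_mul]
        ring
      have e3 : Polynomial.C (1 : k) * Polynomial.X + Polynomial.C (-(g 0 0 / g 1 0)) =
          Polynomial.X - Polynomial.C (g 0 0 / g 1 0) := by
        rw [Polynomial.C_neg, Polynomial.C_1, one_mul, ← sub_eq_add_neg]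
      rw [e2, u.map_C, e3, norm_neg, norm_div] at e1
      change v.dist _ * _ = _ at e1
      rw [e1]
      field_simp
    have key : ∀ u v u' : AffineLine k, MoebiusRel g u v → u'.InDisk e r →
        0 < u'.denom (g : Matrix (Fin 2) (Fin 2) k) →
        v.dist (g 0 0 / g 1 0) ≤ r * ‖(g : Matrix (Fin 2) (Fin 2) k).det‖ /
          (u.denom (g : Matrix (Fin 2) (Fin 2) k) * u'.denom (g : Matrix (Fin 2) (Fin 2) k)) := by
      intro u v u' huv hu' hpos
      have hu0 := huv.1
      rw [le_div_iff₀ (by positivity), ← hdist u v huv]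
      have hnn := v.dist_nonneg (g 0 0 / g 1 0)
      calc _ = v.dist (g 0 0 / g 1 0) * u.denom (g : Matrix (Fin 2) (Fin 2) k) *
            u'.denom (g : Matrix (Fin 2) (Fin 2) k) := by ring
        _ ≤ v.dist (g 0 0 / g 1 0) * u.denom (g : Matrix (Fin 2) (Fin 2) k) *
            (‖g 1 0‖ * r) := by
          gcongr
          exact hden u' hu'
        _ = _ := by ring
    have hr0 := hx.1
    have := jointDiam_le_of_dist_le (by positivity) (key x z y hz hy hy0)
      (by rw [mul_comm (x.denom _)]; exact key y w x hw hx hx0)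
    rwa [le_div_iff₀ (by positivity)] at this

/-- The analogue of gx - gy = det g · (x - y) / ((cx + d)(cy + d)). One inequality for g and the
same one for g⁻¹ give equality. -/
theorem jointDiam_smul {g : GL (Fin 2) k} {x y z w : AffineLine k}
    (hz : g • (x : ProjLine k) = z) (hw : g • (y : ProjLine k) = w) :
    jointDiam z w * (x.denom (g : Matrix (Fin 2) (Fin 2) k) *
      y.denom (g : Matrix (Fin 2) (Fin 2) k)) =
      jointDiam x y * ‖(g : Matrix (Fin 2) (Fin 2) k).det‖ := by
  have hz1 : MoebiusRel g x z := moebiusRel_of_eq hz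
  have hw1 : MoebiusRel g y w := moebiusRel_of_eq hw
  refine le_antisymm (hz1.jointDiam_le hw1) ?_
  have h := (MoebiusRel.symm hz).jointDiam_le (MoebiusRel.symm hw)
  have hzd := hz1.denom_inv
  have hwd := hw1.denom_inv
  have hd : ‖((g⁻¹ : GL (Fin 2) k) : Matrix (Fin 2) (Fin 2) k).det‖ *
      ‖(g : Matrix (Fin 2) (Fin 2) k).det‖ = 1 := by
    rw [← norm_mul, ← Matrix.det_mul, ← Units.val_mul, inv_mul_cancel, Units.val_one,
      Matrix.det_one, norm_one]
  have hdet : 0 < ‖(g : Matrix (Fin 2) (Fin 2) k).det‖ := norm_pos_iff.2 (det_ne_zero' g)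
  have hx0 := hz1.1
  have hy0 := hw1.1
  calc jointDiam x y * ‖(g : Matrix (Fin 2) (Fin 2) k).det‖
      = (jointDiam x y * (z.denom ((g⁻¹ : GL (Fin 2) k) : Matrix (Fin 2) (Fin 2) k) *
          w.denom ((g⁻¹ : GL (Fin 2) k) : Matrix (Fin 2) (Fin 2) k))) *
        (x.denom (g : Matrix (Fin 2) (Fin 2) k) * y.denom (g : Matrix (Fin 2) (Fin 2) k) *
          ‖(g : Matrix (Fin 2) (Fin 2) k).det‖) := by
        linear_combination (-(jointDiam x y * ‖(g : Matrix (Fin 2) (Fin 2) k).det‖)) * hwd -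
          (jointDiam x y * ‖(g : Matrix (Fin 2) (Fin 2) k).det‖) *
          (w.denom ((g⁻¹ : GL (Fin 2) k) : Matrix (Fin 2) (Fin 2) k) *
          y.denom (g : Matrix (Fin 2) (Fin 2) k)) * hzd
    _ ≤ (jointDiam z w * ‖((g⁻¹ : GL (Fin 2) k) : Matrix (Fin 2) (Fin 2) k).det‖) *
        (x.denom (g : Matrix (Fin 2) (Fin 2) k) * y.denom (g : Matrix (Fin 2) (Fin 2) k) *
          ‖(g : Matrix (Fin 2) (Fin 2) k).det‖) :=
        mul_le_mul_of_nonneg_right h (by positivity)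
    _ = _ := by
        linear_combination (jointDiam z w * (x.denom (g : Matrix (Fin 2) (Fin 2) k) *
          y.denom (g : Matrix (Fin 2) (Fin 2) k))) * hd

end Scaling


/-! ### Membership in affine disks -/

section Disks

variable {k : Type*} [NontriviallyNormedField k]

theorem coe_mem_affineClosedDisk {x : AffineLine k} {a : k} {r : ℝ} :
    (x : ProjLine k) ∈ affineClosedDisk a r ↔ x.dist a ≤ r := by
  constructor
  · rintro ⟨y, hxy, hy⟩
    obtain rfl : x = y := by simpa using hxy
    exact hy
  · exact fun h => ⟨x, rfl, h⟩

theorem coe_mem_affineOpenDisk {x : AffineLine k} {a : k} {r : ℝ} :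
    (x : ProjLine k) ∈ affineOpenDisk a r ↔ x.dist a < r := by
  constructor
  · rintro ⟨y, hxy, hy⟩
    obtain rfl : x = y := by simpa using hxy
    exact hy
  · exact fun h => ⟨x, rfl, h⟩

theorem infty_notMem_affineClosedDisk {a : k} {r : ℝ} : (∞ : ProjLine k) ∉ affineClosedDisk a r :=
  fun ⟨_, h, _⟩ => by simp at h

theorem infty_notMem_affineOpenDisk {a : k} {r : ℝ} : (∞ : ProjLine k) ∉ affineOpenDisk a r :=
  fun ⟨_, h, _⟩ => by simp at h

theorem AffineLine.dist_eq_norm_of_lt [IsUltrametricDist k] {x : AffineLine k}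
    {a b : k}     (hx : x.dist b < ‖b - a‖) : x.dist a = ‖b - a‖ := by
  have h1 := x.norm_sub_le_max b a
  have h2 := x.dist_le_max a b
  rw [norm_sub_rev a b, max_eq_right hx.le] at h2
  exact le_antisymm h2 ((le_max_iff.1 h1).resolve_left (not_le.2 hx))

end Disks

/-! ### The path distance, its invariance, and boundary points of disks -/

section Metric

variable {k : Type*} [NontriviallyNormedField k] [IsUltrametricDist k] [CompleteSpace k]

theorem exists_coe_of_mem {p : ProjLine k} (hp : p ∈ hyperbolicSpace k) :
    ∃ x : AffineLine k, p = x ∧ 0 < jointDiam x x := by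
  induction p with
  | none => exact absurd hp infty_notMem_hyperbolicSpace
  | some x => exact ⟨x, rfl, coe_mem_hyperbolicSpace.1 hp⟩

theorem jointDiam_self_le_dist (x : AffineLine k) (b : k) : jointDiam x x ≤ x.dist b :=
  jointDiam_le_of_dist_le (x.dist_nonneg b) le_rfl le_rfl

theorem denom_ne_zero (g : GL (Fin 2) k) {x : AffineLine k} (hx : 0 < jointDiam x x) :
    x.denom (g : Matrix (Fin 2) (Fin 2) k) ≠ 0 := by
  intro h
  by_cases hc : g 1 0 = 0
  · have hd : g 1 1 = 0 := by
      rw [AffineLine.denom] at h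
      simpa [hc, x.map_C] using h
    exact det_ne_zero' g (by rw [det_fin_two', hc, hd]; ring)
  · have e : Polynomial.C (g 1 0) * Polynomial.X + Polynomial.C (g 1 1) =
        Polynomial.C (g 1 0) * (Polynomial.X - Polynomial.C (-(g 1 1) / g 1 0)) := by
      rw [mul_sub, ← Polynomial.C_mul, mul_div_cancel₀ _ hc, Polynomial.C_neg, sub_neg_eq_add]
    rw [AffineLine.denom, e, map_mul, x.map_C, mul_eq_zero] at h
    rcases h with h | h
    · exact hc (norm_eq_zero.1 h)
    · exact (hx.trans_le (jointDiam_self_le_dist x _)).ne' h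

theorem exists_smul_eq_coe (g : GL (Fin 2) k) {x : AffineLine k} (hx : 0 < jointDiam x x) :
    ∃ z : AffineLine k, g • (x : ProjLine k) = z ∧ 0 < jointDiam z z := by
  have h0 := denom_ne_zero g hx
  obtain ⟨z, hz, -⟩ := moebius_coe g x h0
  refine ⟨z, hz, ?_⟩
  have h := jointDiam_smul (g := g) hz hz
  have hdet : 0 < ‖(g : Matrix (Fin 2) (Fin 2) k).det‖ := norm_pos_iff.2 (det_ne_zero' g)
  refine lt_of_le_of_ne (jointDiam_nonneg _ _) fun h' => ?_
  rw [← h', zero_mul] at h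
  exact (mul_pos hx hdet).ne h

theorem smul_mem_hyperbolicSpace (γ : PGL(2, k)) {p : ProjLine k} (hp : p ∈ hyperbolicSpace k) :
    γ • p ∈ hyperbolicSpace k := by
  induction γ using Matrix.ProjGenLinGroup.induction_on with | mk g =>
  obtain ⟨x, rfl, hx⟩ := exists_coe_of_mem hp
  obtain ⟨z, hz, hz0⟩ := exists_smul_eq_coe g hx
  change g • (x : ProjLine k) ∈ _
  rw [hz]
  exact coe_mem_hyperbolicSpace.2 hz0

theorem rho_coe (x y : AffineLine k) : rho (x : ProjLine k) (y : ProjLine k) =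
    2 * Real.log (jointDiam x y) - Real.log (jointDiam x x) - Real.log (jointDiam y y) := rfl

/-- The factors |det g| and |cT + d| of `jointDiam_smul` cancel in the combination of logarithms. -/
theorem rho_smul (γ : PGL(2, k)) {p q : ProjLine k} (hp : p ∈ hyperbolicSpace k)
    (hq : q ∈ hyperbolicSpace k) : rho (γ • p) (γ • q) = rho p q := by
  induction γ using Matrix.ProjGenLinGroup.induction_on with | mk g =>
  obtain ⟨x, rfl, hx⟩ := exists_coe_of_mem hp
  obtain ⟨y, rfl, hy⟩ := exists_coe_of_mem hq
  obtain ⟨z, hz, hz0⟩ := exists_smul_eq_coe g hx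
  obtain ⟨w, hw, hw0⟩ := exists_smul_eq_coe g hy
  change rho (g • (x : ProjLine k)) (g • (y : ProjLine k)) = _
  have hdet : 0 < ‖(g : Matrix (Fin 2) (Fin 2) k).det‖ := norm_pos_iff.2 (det_ne_zero' g)
  have hxd := (moebiusRel_of_eq (g := g) hz).1
  have hyd := (moebiusRel_of_eq (g := g) hw).1
  have hxy : 0 < jointDiam x y := hx.trans_le (jointDiam_self_le x y)
  have hzw : 0 < jointDiam z w := hz0.trans_le (jointDiam_self_le z w)
  have h1 := congrArg Real.log (jointDiam_smul hz hz)
  have h2 := congrArg Real.log (jointDiam_smul hz hw)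
  have h3 := congrArg Real.log (jointDiam_smul hw hw)
  rw [Real.log_mul, Real.log_mul, Real.log_mul] at h1 h2 h3 <;> try positivity
  rw [hz, hw, rho_coe, rho_coe]
  linarith

theorem rho_comm (p q : ProjLine k) : rho p q = rho q p := by
  induction p with
  | none => induction q with | none => rfl | some y => rfl
  | some x =>
    induction q with
    | none => rfl
    | some y =>
      change rho (x : ProjLine k) (y : ProjLine k) = rho (y : ProjLine k) (x : ProjLine k)
      rw [rho_coe, rho_coe, jointDiam_comm]
      ring

theorem rho_self (p : ProjLine k) : rho p p = 0 := by
  induction p with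
  | none => rfl
  | some x =>
    change rho (x : ProjLine k) (x : ProjLine k) = 0
    rw [rho_coe]
    ring

/-- One of the two joint diameters with y bounds that of x and z, and the other is at least the
diameter of y. -/
theorem rho_triangle {p q r : ProjLine k} (hp : p ∈ hyperbolicSpace k)
    (hq : q ∈ hyperbolicSpace k) (hr : r ∈ hyperbolicSpace k) :
    rho p r ≤ rho p q + rho q r := by
  obtain ⟨x, rfl, hx⟩ := exists_coe_of_mem hp
  obtain ⟨y, rfl, hy⟩ := exists_coe_of_mem hq
  obtain ⟨z, rfl, hz⟩ := exists_coe_of_mem hr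
  rw [rho_coe, rho_coe, rho_coe]
  have hxy := jointDiam_self_le' x y
  have hyz := jointDiam_self_le y z
  have hxz : 0 < jointDiam x z := hx.trans_le (jointDiam_self_le x z)
  have l1 := Real.log_le_log hy hxy
  have l2 := Real.log_le_log hy hyz
  rcases le_max_iff.1 (jointDiam_le_max x y z) with h | h
  · have := Real.log_le_log hxz h
    linarith
  · have := Real.log_le_log hxz h
    linarith

theorem rho_nonneg {p q : ProjLine k} (hp : p ∈ hyperbolicSpace k) (hq : q ∈ hyperbolicSpace k) :
    0 ≤ rho p q := by
  have := rho_triangle hp hq hp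
  rw [rho_self, rho_comm q p] at this
  linarith

theorem diskPt_mem (b : k) {R : ℝ} (hR : 0 < R) :
    (diskPt b R hR : ProjLine k) ∈ hyperbolicSpace k := by
  rw [coe_mem_hyperbolicSpace, jointDiam_diskPt_self]
  exact hR

theorem rho_diskPt_add {x y : AffineLine k} {b : k} {R : ℝ} (hR : 0 < R) (h1 : x.dist b ≤ R) (h2 : R ≤ y.dist b)
    (h3 : x.dist b < y.dist b) : rho (x : ProjLine k) (y : ProjLine k) =
      rho (x : ProjLine k) (diskPt b R hR : ProjLine k) +
      rho (diskPt b R hR : ProjLine k) (y : ProjLine k) := by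
  rw [rho_coe, rho_coe, rho_coe, jointDiam_diskPt_self, jointDiam_comm (diskPt b R hR) y,
    jointDiam_diskPt, jointDiam_diskPt, jointDiam_eq_dist h3, max_eq_left h1, max_eq_right h2]
  ring

theorem diskPt_dist_self (b : k) {R : ℝ} (hR : 0 < R) : (diskPt b R hR).dist b = R := by
  rw [diskPt_dist]; simp [hR.le]

theorem rho_diskPt_diskPt (b : k) {r R : ℝ} (hr : 0 < r) (hR : 0 < R) (h : r ≤ R) :
    rho (diskPt b r hr : ProjLine k) (diskPt b R hR : ProjLine k) =
      Real.log R - Real.log r := by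
  rw [rho_coe, jointDiam_diskPt_self, jointDiam_diskPt_self, jointDiam_diskPt, diskPt_dist_self,
    max_eq_left h]
  ring

/-- `z` is the boundary point of the set `S`, in terms of the path distance: all paths between a
point in `S` and a point outside `S` pass through `z`, and `z` is in the closure of `S` and
in the closure of its complement. -/
structure IsEnd (S : Set (ProjLine k)) (z : ProjLine k) : Prop where
  mem : z ∈ hyperbolicSpace k
  add : ∀ x ∈ S, x ∈ hyperbolicSpace k → ∀ y ∉ S, y ∈ hyperbolicSpace k →
    rho x y = rho x z + rho z y
  inner : ∀ ε > 0, ∃ x ∈ S, x ∈ hyperbolicSpace k ∧ rho x z < ε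
  outer : ∀ ε > 0, ∃ y ∉ S, y ∈ hyperbolicSpace k ∧ rho y z < ε

theorem IsEnd.compl {S : Set (ProjLine k)} {z : ProjLine k} (h : IsEnd S z) : IsEnd Sᶜ z where
  mem := h.mem
  add x hx hxH y hy hyH := by
    rw [rho_comm, h.add y (not_not.1 hy) hyH x hx hxH, rho_comm x, rho_comm z y, add_comm]
  inner := h.outer
  outer ε hε := by
    obtain ⟨x, hx, h'⟩ := h.inner ε hε
    exact ⟨x, not_not.2 hx, h'⟩

theorem IsEnd.smul {S : Set (ProjLine k)} {z : ProjLine k} (h : IsEnd S z) (γ : PGL(2, k)) :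
    IsEnd ((fun p => γ • p) '' S) (γ • z) where
  mem := smul_mem_hyperbolicSpace γ h.mem
  add := by
    rintro _ ⟨x, hx, rfl⟩ hxH y hy hyH
    obtain ⟨y, rfl⟩ : ∃ y', γ • y' = y := ⟨γ⁻¹ • y, smul_inv_smul _ _⟩
    have hx' : x ∈ hyperbolicSpace k := by
      have := smul_mem_hyperbolicSpace γ⁻¹ hxH
      rwa [inv_smul_smul] at this
    have hy' : y ∈ hyperbolicSpace k := by
      have := smul_mem_hyperbolicSpace γ⁻¹ hyH
      rwa [inv_smul_smul] at this
    change rho (γ • x) _ = rho (γ • x) _ + _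
    rw [rho_smul γ hx' hy', rho_smul γ hx' h.mem, rho_smul γ h.mem hy']
    exact h.add x hx hx' y (fun hyS => hy ⟨y, hyS, rfl⟩) hy'
  inner ε hε := by
    obtain ⟨x, hx, hxH, h'⟩ := h.inner ε hε
    exact ⟨γ • x, ⟨x, hx, rfl⟩, smul_mem_hyperbolicSpace γ hxH, by rwa [rho_smul γ hxH h.mem]⟩
  outer ε hε := by
    obtain ⟨y, hy, hyH, h'⟩ := h.outer ε hε
    refine ⟨γ • y, ?_, smul_mem_hyperbolicSpace γ hyH, by rwa [rho_smul γ hyH h.mem]⟩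
    rintro ⟨y', hy', e⟩
    exact hy (MulAction.injective γ e ▸ hy')

/-- Choose x inside and y outside S, both close to z. Additivity at z' gives ρ(x, z') ≤ ρ(x, y), so
z' is close to z as well. This uniqueness up to distance zero is all that is needed to follow
boundary points under Möbius maps. -/
theorem IsEnd.rho_eq_zero {S : Set (ProjLine k)} {z z' : ProjLine k} (h : IsEnd S z)
    (h' : IsEnd S z') : rho z z' = 0 := by
  refine le_antisymm (le_of_forall_pos_le_add fun ε hε => ?_) (rho_nonneg h.mem h'.mem)
  obtain ⟨x, hx, hxH, hxz⟩ := h.inner (ε / 3) (by positivity)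
  obtain ⟨y, hy, hyH, hyz⟩ := h.outer (ε / 3) (by positivity)
  have h1 := h.add x hx hxH y hy hyH
  have h2 := h'.add x hx hxH y hy hyH
  have h3 := rho_triangle h.mem hxH h'.mem
  have h4 := rho_nonneg h'.mem hyH
  rw [rho_comm z y] at h1
  rw [rho_comm z x] at h3
  linarith

theorem rho_congr_of_eq_zero {z z' w : ProjLine k} (hz : z ∈ hyperbolicSpace k)
    (hz' : z' ∈ hyperbolicSpace k) (hw : w ∈ hyperbolicSpace k) (h : rho z z' = 0) :
    rho z w = rho z' w := by
  have h1 := rho_triangle hz hz' hw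
  have h2 := rho_triangle hz' hz hw
  rw [rho_comm z' z] at h2
  linarith

theorem exists_diskPt_lt (b : k) {R : ℝ} (hR : 0 < R) {ε : ℝ} (hε : 0 < ε) :
    ∃ (r : ℝ) (hr : 0 < r), r < R ∧
      rho (diskPt b r hr : ProjLine k) (diskPt b R hR : ProjLine k) < ε := by
  have h1 : Real.exp (-(ε / 2)) < 1 := Real.exp_lt_one_iff.2 (by linarith)
  have h2 : R * Real.exp (-(ε / 2)) < R := mul_lt_of_lt_one_right hR h1
  refine ⟨R * Real.exp (-(ε / 2)), by positivity, h2, ?_⟩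
  rw [rho_diskPt_diskPt b _ _ h2.le, Real.log_mul hR.ne' (Real.exp_pos _).ne', Real.log_exp]
  linarith

theorem exists_lt_diskPt (b : k) {R : ℝ} (hR : 0 < R) {ε : ℝ} (hε : 0 < ε) :
    ∃ (r : ℝ) (hr : 0 < r), R < r ∧
      rho (diskPt b r hr : ProjLine k) (diskPt b R hR : ProjLine k) < ε := by
  have h1 : 1 < Real.exp (ε / 2) := Real.one_lt_exp_iff.2 (by linarith)
  have h2 : R < R * Real.exp (ε / 2) := lt_mul_of_one_lt_right hR h1
  refine ⟨R * Real.exp (ε / 2), by positivity, h2, ?_⟩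
  rw [rho_comm, rho_diskPt_diskPt b _ _ h2.le, Real.log_mul hR.ne' (Real.exp_pos _).ne',
    Real.log_exp]
  linarith

theorem isEnd_affineClosedDisk (b : k) {R : ℝ} (hR : 0 < R) :
    IsEnd (affineClosedDisk b R) (diskPt b R hR : ProjLine k) where
  mem := diskPt_mem b hR
  add := by
    rintro _ hx hxH _ hy hyH
    obtain ⟨x, rfl, -⟩ := exists_coe_of_mem hxH
    obtain ⟨y, rfl, -⟩ := exists_coe_of_mem hyH
    rw [coe_mem_affineClosedDisk] at hx hy
    push Not at hy
    exact rho_diskPt_add hR hx hy.le (hx.trans_lt hy)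
  inner ε hε := ⟨_, coe_mem_affineClosedDisk.2 (diskPt_dist_self b hR).le, diskPt_mem b hR, by
    rwa [rho_self]⟩
  outer ε hε := by
    obtain ⟨r, hr, hRr, h⟩ := exists_lt_diskPt b hR hε
    refine ⟨_, ?_, diskPt_mem b hr, h⟩
    rwa [coe_mem_affineClosedDisk, diskPt_dist_self, not_le]

theorem isEnd_affineOpenDisk (b : k) {R : ℝ} (hR : 0 < R) :
    IsEnd (affineOpenDisk b R) (diskPt b R hR : ProjLine k) where
  mem := diskPt_mem b hR
  add := by
    rintro _ hx hxH _ hy hyH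
    obtain ⟨x, rfl, -⟩ := exists_coe_of_mem hxH
    obtain ⟨y, rfl, -⟩ := exists_coe_of_mem hyH
    rw [coe_mem_affineOpenDisk] at hx hy
    push Not at hy
    exact rho_diskPt_add hR hx.le hy (hx.trans_le hy)
  inner ε hε := by
    obtain ⟨r, hr, hRr, h⟩ := exists_diskPt_lt b hR hε
    refine ⟨_, ?_, diskPt_mem b hr, h⟩
    rwa [coe_mem_affineOpenDisk, diskPt_dist_self]
  outer ε hε := ⟨_, fun h => (coe_mem_affineOpenDisk.1 h).ne (diskPt_dist_self b hR),
    diskPt_mem b hR, by rwa [rho_self]⟩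

theorem ClosedDisk.isEnd (C : ClosedDisk k) : IsEnd C.carrier C.boundary := by
  cases C with
  | affine a r hr => exact isEnd_affineClosedDisk a hr
  | compl a r hr => exact (isEnd_affineOpenDisk a hr).compl

theorem ClosedDisk.boundary_mem_carrier (C : ClosedDisk k) : C.boundary ∈ C.carrier := by
  cases C with
  | affine a r hr => exact coe_mem_affineClosedDisk.2 (diskPt_dist_self a hr).le
  | compl a r hr =>
    exact fun h => (coe_mem_affineOpenDisk.1 h).ne (diskPt_dist_self a hr)

theorem ClosedDisk.exists_boundary_eq (C : ClosedDisk k) :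
    ∃ (b : k) (r : ℝ) (hr : 0 < r), C.boundary = (diskPt b r hr : ProjLine k) := by
  cases C with
  | affine a r hr => exact ⟨a, r, hr, rfl⟩
  | compl a r hr => exact ⟨a, r, hr, rfl⟩

/-- An open disk inside C with another boundary point can be enlarged inside C, against maximality.
Gauss points of nearby radii serve as test points that separate disks of different radii. -/
theorem ClosedDisk.isEnd_of_maximal (C : ClosedDisk k) {S : Set (ProjLine k)}
    (hS : Maximal (fun S => IsOpenDisk S ∧ S ⊆ C.carrier) S) : IsEnd S C.boundary := by
  obtain ⟨⟨⟨b, r, hr, hSb⟩, hSC⟩, hmax⟩ := hS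
  have hmax' : ∀ T : Set (ProjLine k), IsOpenDisk T → T ⊆ C.carrier → S ⊆ T → T ⊆ S :=
    fun T h1 h2 h3 => hmax ⟨h1, h2⟩ h3
  cases C with
  | affine a R hR =>
    change IsEnd S (diskPt a R hR : ProjLine k)
    change S ⊆ affineClosedDisk a R at hSC
    change ∀ T : Set (ProjLine k), IsOpenDisk T → T ⊆ affineClosedDisk a R → S ⊆ T → T ⊆ S at hmax'
    rcases hSb with rfl | rfl
    · have hsub : ∀ t : ℝ, ∀ ht : 0 < t, t < r → max t ‖b - a‖ ≤ R := by
        intro t ht htr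
        have : (diskPt b t ht : ProjLine k) ∈ affineClosedDisk a R :=
          hSC (coe_mem_affineOpenDisk.2 (by rwa [diskPt_dist_self b ht]))
        rwa [coe_mem_affineClosedDisk, diskPt_dist] at this
      have hba : ‖b - a‖ ≤ R := (le_max_right _ _).trans (hsub (r / 2) (by linarith) (by linarith))
      have hrR : r ≤ R := by
        by_contra! hlt
        have := (le_max_left _ _).trans (hsub ((r + R) / 2) (by linarith) (by linarith))
        linarith
      rcases hrR.eq_or_lt with rfl | hlt
      · rw [← diskPt_eq hR hba]
        exact isEnd_affineOpenDisk b hR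
      · exfalso
        have := hmax' (affineOpenDisk b R) ⟨b, R, hR, Or.inl rfl⟩ ?_ ?_
          (coe_mem_affineOpenDisk.2 (by rwa [diskPt_dist_self b hr]))
        · rw [coe_mem_affineOpenDisk, diskPt_dist_self] at this
          exact lt_irrefl _ this
        · rintro _ ⟨x, rfl, hx⟩
          rw [coe_mem_affineClosedDisk]
          refine (x.dist_le_max a b).trans (max_le hx.le ?_)
          rwa [norm_sub_rev]
        · rintro _ ⟨x, rfl, hx⟩
          exact ⟨x, rfl, hx.trans hlt⟩
    · exact absurd (hSC infty_notMem_affineClosedDisk) infty_notMem_affineClosedDisk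
  | compl a R hR =>
    change IsEnd S (diskPt a R hR : ProjLine k)
    change S ⊆ (affineOpenDisk a R)ᶜ at hSC
    change ∀ T : Set (ProjLine k), IsOpenDisk T → T ⊆ (affineOpenDisk a R)ᶜ → S ⊆ T → T ⊆ S
      at hmax'
    have houter : (affineClosedDisk a R)ᶜ ⊆ (affineOpenDisk a R)ᶜ := by
      refine Set.compl_subset_compl.2 ?_
      rintro _ ⟨x, rfl, hx⟩
      exact ⟨x, rfl, hx.le⟩
    rcases hSb with rfl | rfl
    · have h1 : ∀ t : ℝ, ∀ ht : 0 < t, t < r → R ≤ max t ‖b - a‖ := by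
        intro t ht htr
        have : (diskPt b t ht : ProjLine k) ∈ (affineOpenDisk a R)ᶜ :=
          hSC (coe_mem_affineOpenDisk.2 (by rwa [diskPt_dist_self b ht]))
        rwa [Set.mem_compl_iff, coe_mem_affineOpenDisk, diskPt_dist, not_lt] at this
      have h2 : ∀ t : ℝ, ∀ ht : 0 < t, t < R → r ≤ max t ‖b - a‖ := by
        intro t ht htR
        by_contra! hlt
        have : (diskPt a t ht : ProjLine k) ∈ (affineOpenDisk a R)ᶜ := by
          refine hSC (coe_mem_affineOpenDisk.2 ?_)
          rwa [diskPt_dist, norm_sub_rev]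
        rw [Set.mem_compl_iff, coe_mem_affineOpenDisk, diskPt_dist_self] at this
        exact this htR
      have hrb : r ≤ ‖b - a‖ := by
        by_contra! hlt
        set t := min (r / 2) (R / 2) with ht
        have ht0 : 0 < t := lt_min (by linarith) (by linarith)
        have htr : t < r := (min_le_left _ _).trans_lt (by linarith)
        have htR : t < R := (min_le_right _ _).trans_lt (by linarith)
        rcases le_max_iff.1 (h2 t ht0 htR) with h | h <;> linarith
      have hRb : R ≤ ‖b - a‖ := by
        by_contra! hlt
        set t := min (r / 2) (R / 2) with ht
        have ht0 : 0 < t := lt_min (by linarith) (by linarith)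
        have htr : t < r := (min_le_left _ _).trans_lt (by linarith)
        have htR : t < R := (min_le_right _ _).trans_lt (by linarith)
        rcases le_max_iff.1 (h1 t ht0 htr) with h | h <;> linarith
      -- If |b - a| = R = r, the boundary points agree. If r < R = |b - a|, S grows to radius R; if
      -- |b - a| > R, it grows to {|T - a| > R}, which contains ∞ while S does not.
      rcases hRb.eq_or_lt with heq | hlt
      · rcases hrb.eq_or_lt with heq' | hlt'
        · obtain rfl : r = R := heq'.trans heq.symm
          rw [← diskPt_eq hR heq.symm.le]
          exact isEnd_affineOpenDisk b hR
        · exfalso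
          have hrR : r < R := hlt'.trans_eq heq.symm
          have := hmax' (affineOpenDisk b R) ⟨b, R, hR, Or.inl rfl⟩ ?_ ?_
            (coe_mem_affineOpenDisk.2 (by rwa [diskPt_dist_self b hr]))
          · rw [coe_mem_affineOpenDisk, diskPt_dist_self] at this
            exact lt_irrefl _ this
          · rintro _ ⟨x, rfl, hx⟩
            rw [Set.mem_compl_iff, coe_mem_affineOpenDisk, not_lt, heq]
            exact (AffineLine.dist_eq_norm_of_lt (hx.trans_eq heq)).ge
          · rintro _ ⟨x, rfl, hx⟩
            exact ⟨x, rfl, hx.trans hrR⟩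
      · exfalso
        refine infty_notMem_affineOpenDisk (hmax' (affineClosedDisk a R)ᶜ
          ⟨a, R, hR, Or.inr rfl⟩ houter ?_ infty_notMem_affineClosedDisk)
        rintro _ ⟨x, rfl, hx⟩
        rw [Set.mem_compl_iff, coe_mem_affineClosedDisk, not_le,
          AffineLine.dist_eq_norm_of_lt (lt_of_lt_of_le hx hrb)]
        exact hlt
    · have hsub : ∀ t : ℝ, ∀ ht : 0 < t, t < R → max t ‖a - b‖ ≤ r := by
        intro t ht htR
        have : (diskPt a t ht : ProjLine k) ∈ affineClosedDisk b r := by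
          by_contra hcon
          exact hSC hcon (coe_mem_affineOpenDisk.2 (by rwa [diskPt_dist_self a ht]))
        rwa [coe_mem_affineClosedDisk, diskPt_dist] at this
      have hab : ‖a - b‖ ≤ r := (le_max_right _ _).trans (hsub (R / 2) (by linarith) (by linarith))
      have hRr : R ≤ r := by
        by_contra! hlt
        have := (le_max_left _ _).trans (hsub ((r + R) / 2) (by linarith) (by linarith))
        linarith
      rcases hRr.eq_or_lt with rfl | hlt
      · rw [diskPt_eq hR hab]
        exact (isEnd_affineClosedDisk b hR).compl
      · exfalso
        have := hmax' (affineClosedDisk a R)ᶜ ⟨a, R, hR, Or.inr rfl⟩ houter ?_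
          (a := (diskPt a r hr : ProjLine k)) ?_
        · rw [Set.mem_compl_iff, coe_mem_affineClosedDisk, diskPt_dist, not_le] at this
          exact (max_le le_rfl hab).not_gt this
        · refine Set.compl_subset_compl.2 ?_
          rintro _ ⟨x, rfl, hx⟩
          rw [coe_mem_affineClosedDisk]
          refine (x.dist_le_max b a).trans (max_le (hx.trans hlt.le) ?_)
          rwa [norm_sub_rev]
        · rwa [Set.mem_compl_iff, coe_mem_affineClosedDisk, diskPt_dist_self, not_le]

end Metric


/-! ### Words in the alphabet -/

section Letters

variable {g : ℕ}

theorem Letter.inv_inv (a : Letter g) : a.inv.inv = a := by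
  simp [Letter.inv]

theorem Letter.inv_ne_iff (a b : Letter g) : a.inv ≠ b ↔ (a.1 = b.1 → a.2 = b.2) := by
  obtain ⟨i, e⟩ := a
  obtain ⟨j, f⟩ := b
  simp only [Letter.inv, ne_eq, Prod.mk.injEq, not_and]
  cases e <;> cases f <;> simp

variable {k : Type*} [NontriviallyNormedField k] (γ : Fin g → PGL(2, k))

theorem Letter.elt_inv (a : Letter g) : a.inv.elt γ = (a.elt γ)⁻¹ := by
  obtain ⟨i, e⟩ := a
  cases e <;> simp [Letter.inv, Letter.elt]

/-- The group element of a word. -/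
def wordElt (l : List (Letter g)) : PGL(2, k) := (l.map (Letter.elt γ)).prod

@[simp] theorem wordElt_nil : wordElt γ [] = 1 := rfl

theorem wordElt_cons (a : Letter g) (l : List (Letter g)) :
    wordElt γ (a :: l) = a.elt γ * wordElt γ l := List.prod_cons

theorem wordElt_toWord (w : FreeGroup (Fin g)) : wordElt γ w.toWord = FreeGroup.lift γ w := by
  conv_rhs => rw [← FreeGroup.mk_toWord (x := w), FreeGroup.lift_mk]
  rw [wordElt]
  congr 2
  funext x
  rw [Letter.elt]
  cases x.2 <;> rfl

end Letters

/-! ### Ping-pong, additivity of distances along words, fundamental domain -/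

namespace SchottkyFigure

variable {k : Type*} [NontriviallyNormedField k] {g : ℕ} {γ : Fin g → PGL(2, k)}
  (D : SchottkyFigure γ)

theorem openDisk_subset (a : Letter g) : D.openDisk a ⊆ (D.disk a).carrier :=
  (D.maximal a).1.2

theorem smul_mem_openDisk {a : Letter g} {p : ProjLine k} (hp : p ∉ (D.disk a.inv).carrier) :
    a.elt γ • p ∈ D.openDisk a := by
  rw [← D.pingpong a]
  exact ⟨p, hp, rfl⟩

theorem smul_mem_carrier {a : Letter g} {p : ProjLine k} (hp : p ∉ D.openDisk a.inv) :
    a.elt γ • p ∈ (D.disk a).carrier := by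
  by_contra h
  rw [← Letter.inv_inv a] at h
  have := D.smul_mem_openDisk h
  rw [Letter.inv_inv, Letter.elt_inv, inv_smul_smul] at this
  exact hp this

theorem notMem_carrier {a b : Letter g} (hab : a ≠ b) {p : ProjLine k}
    (hp : p ∈ (D.disk a).carrier) : p ∉ (D.disk b).carrier :=
  Set.disjoint_left.1 (D.disjoint a b hab) hp

theorem notMem_of_mem_fundamentalDomain {p : ProjLine k} (hp : p ∈ D.fundamentalDomain)
    (a : Letter g) : p ∉ D.openDisk a ∧ (a.2 = true → p ∉ (D.disk a).carrier) := by
  obtain ⟨i, e⟩ := a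
  cases e with
  | true => exact ⟨fun h => (hp i).1 (D.openDisk_subset _ h), fun _ => (hp i).1⟩
  | false => exact ⟨(hp i).2, fun h => by simp at h⟩

/-- Ping-pong. F omits the closed disks of the γᵢ but only the open ones of the γᵢ⁻¹; hence the last
letter, applied to a point of F itself, lands in an open disk for γᵢ⁻¹ and only in a closed one for
γᵢ. Both conclusions are incompatible with lying in F. -/
theorem wordElt_smul_mem {p : ProjLine k} (hp : p ∈ D.fundamentalDomain) (a : Letter g)
    (l : List (Letter g)) (h : FreeGroup.IsReduced (a :: l)) :
    wordElt γ (a :: l) • p ∈ (D.disk a).carrier ∧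
      (a.2 = false → wordElt γ (a :: l) • p ∈ D.openDisk a) := by
  induction l generalizing a with
  | nil =>
    rw [wordElt_cons, wordElt_nil, mul_one]
    have h1 := D.notMem_of_mem_fundamentalDomain hp a.inv
    exact ⟨D.smul_mem_carrier h1.1, fun ha => D.smul_mem_openDisk (h1.2 (by simp [Letter.inv, ha]))⟩
  | cons b l ih =>
    rw [FreeGroup.isReduced_cons_cons] at h
    have hb := (ih b h.2).1
    have hne : a.inv ≠ b := (Letter.inv_ne_iff a b).2 h.1
    rw [wordElt_cons, mul_smul]
    have := D.smul_mem_openDisk (D.notMem_carrier hne.symm hb)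
    exact ⟨D.openDisk_subset _ this, fun _ => this⟩

theorem lift_injective {p : ProjLine k} (hp : p ∈ D.fundamentalDomain) :
    Function.Injective (FreeGroup.lift γ) := by
  rw [injective_iff_map_eq_one]
  intro w hw
  rw [← wordElt_toWord] at hw
  have hred : FreeGroup.IsReduced w.toWord := FreeGroup.isReduced_toWord
  rw [← FreeGroup.toWord_eq_nil_iff]
  cases hl : w.toWord with
  | nil => rfl
  | cons a l =>
    exfalso
    rw [hl] at hw hred
    have hm := D.wordElt_smul_mem hp a l hred
    rw [hw, one_smul] at hm
    have ha := D.notMem_of_mem_fundamentalDomain hp a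
    rcases h : a.2 with _ | _
    · exact ha.1 (hm.2 h)
    · exact ha.2 h hm.1

theorem exists_letter_of_notMem {x : ProjLine k} (hx : x ∉ D.fundamentalDomain) :
    ∃ a : Letter g, x ∈ (D.disk a).carrier ∧ (a.2 = true ∨ x ∈ D.openDisk a) := by
  simp only [fundamentalDomain, Set.mem_ofPred_eq, not_forall, not_and_or, not_not] at hx
  obtain ⟨i, h | h⟩ := hx
  · exact ⟨(i, true), h, Or.inl rfl⟩
  · exact ⟨(i, false), D.openDisk_subset _ h, Or.inr h⟩

/-- Points of D_a° are sent outside D_{a⁻¹}. The remaining points of D_a, relevant only for a = γᵢ,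
go to D_{a⁻¹} \ D_{a⁻¹}°, which belongs to F. -/
theorem inv_elt_smul_mem {a : Letter g} {x : ProjLine k} (hx : x ∈ (D.disk a).carrier)
    (ha : a.2 = true ∨ x ∈ D.openDisk a) :
    (a.elt γ)⁻¹ • x ∈ D.fundamentalDomain ∨ (a.elt γ)⁻¹ • x ∉ (D.disk a.inv).carrier := by
  by_cases hxo : x ∈ D.openDisk a
  · right
    rw [← D.pingpong a] at hxo
    obtain ⟨p, hp, rfl⟩ := hxo
    simpa using hp
  · left
    have ha := ha.resolve_right hxo
    have h1 : (a.elt γ)⁻¹ • x ∈ (D.disk a.inv).carrier := by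
      rw [← Letter.elt_inv]
      exact D.smul_mem_carrier (by rwa [Letter.inv_inv])
    have h2 : (a.elt γ)⁻¹ • x ∉ D.openDisk a.inv := by
      intro h
      rw [← D.pingpong a.inv] at h
      obtain ⟨p, hp, h⟩ := h
      rw [Letter.inv_inv] at hp
      simp only [Letter.elt_inv] at h
      exact hp (smul_left_cancel _ h ▸ hx)
    intro i
    have hai : a.inv.2 = false := by simp [Letter.inv, ha]
    refine ⟨D.notMem_carrier (fun h => ?_) h1, fun h => ?_⟩
    · rw [h] at hai
      simp at hai
    · by_cases he : a.inv = (i, false)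
      · exact h2 (he ▸ h)
      · exact D.notMem_carrier he h1 (D.openDisk_subset _ h)

variable [IsUltrametricDist k] [CompleteSpace k]

theorem boundary_mem (a : Letter g) : (D.disk a).boundary ∈ hyperbolicSpace k :=
  (D.disk a).isEnd.mem

theorem isEnd_openDisk (a : Letter g) : IsEnd (D.openDisk a) (D.disk a).boundary :=
  (D.disk a).isEnd_of_maximal (D.maximal a)

/-- The letter a maps the complement of D_{a⁻¹} onto D_a°, so both a·∂D_{a⁻¹} and ∂D_a are ends of
D_a°; they are at distance zero. -/
theorem rho_boundary_smul (a : Letter g) {w : ProjLine k} (hw : w ∈ hyperbolicSpace k) :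
    rho (D.disk a).boundary (a.elt γ • w) = rho (D.disk a.inv).boundary w := by
  have h1 := (D.disk a.inv).isEnd.compl.smul (a.elt γ)
  rw [D.pingpong a] at h1
  rw [← rho_smul (a.elt γ) (D.boundary_mem a.inv) hw]
  exact rho_congr_of_eq_zero (D.boundary_mem a) h1.mem (smul_mem_hyperbolicSpace _ hw)
    ((D.isEnd_openDisk a).rho_eq_zero h1)

/-- Distance zero would force equal radii r and centres within r, that is, the same Gauss point in
two disjoint disks. -/
theorem rho_boundary_pos {a b : Letter g} (hab : a ≠ b) :
    0 < rho (D.disk a).boundary (D.disk b).boundary := by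
  refine lt_of_le_of_ne (rho_nonneg (D.boundary_mem a) (D.boundary_mem b)) fun h => ?_
  have ha := (D.disk a).boundary_mem_carrier
  have hb := (D.disk b).boundary_mem_carrier
  obtain ⟨c, r, hr, hc⟩ := (D.disk a).exists_boundary_eq
  obtain ⟨e, s, hs, he⟩ := (D.disk b).exists_boundary_eq
  have hne : (D.disk a).boundary ≠ (D.disk b).boundary := fun h' =>
    D.notMem_carrier hab ha (h' ▸ hb)
  rw [hc, he, rho_coe, jointDiam_diskPt_self, jointDiam_diskPt_self, jointDiam_diskPt,
    diskPt_dist] at h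
  have h1 := Real.log_le_log hr ((le_max_left r ‖c - e‖).trans (le_max_right s _))
  have h2 := Real.log_le_log hs (le_max_left s (max r ‖c - e‖))
  have h3 : Real.log r = Real.log (max s (max r ‖c - e‖)) := by linarith
  have h4 : Real.log s = Real.log (max s (max r ‖c - e‖)) := by linarith
  have hpos : 0 < max s (max r ‖c - e‖) := lt_max_of_lt_left hs
  have h5 := Real.log_injOn_pos hr hpos h3
  have h6 := Real.log_injOn_pos hs hpos h4
  obtain rfl : r = s := h5.trans h6.symm
  refine hne ?_
  rw [hc, he, diskPt_eq hr]
  exact ((le_max_right _ _).trans (le_max_right _ _)).trans h6.symm.le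

/-- The disk of a contains the translate of y but not x, so its boundary point splits the path; a⁻¹
then moves the inner part to ∂D_{a⁻¹}. -/
theorem rho_wordElt {x y : ProjLine k} (hx : x ∈ hyperbolicSpace k) (hy : y ∈ hyperbolicSpace k)
    (hxF : x ∈ D.fundamentalDomain) (hyF : y ∈ D.fundamentalDomain) (a : Letter g)
    (l : List (Letter g)) (h : FreeGroup.IsReduced (a :: l)) :
    rho x (wordElt γ (a :: l) • y) = rho x (D.disk a).boundary +
      rho (D.disk a.inv).boundary (wordElt γ l • y) := by
  have hm := D.wordElt_smul_mem hyF a l h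
  have hwy := smul_mem_hyperbolicSpace (wordElt γ (a :: l)) hy
  have hxa := D.notMem_of_mem_fundamentalDomain hxF a
  have key : rho (wordElt γ (a :: l) • y) x = rho (wordElt γ (a :: l) • y) (D.disk a).boundary +
      rho (D.disk a).boundary x := by
    rcases ha : a.2 with _ | _
    · exact (D.isEnd_openDisk a).add _ (hm.2 ha) hwy _ hxa.1 hx
    · exact (D.disk a).isEnd.add _ hm.1 hwy _ (hxa.2 ha) hx
  rw [rho_comm, key, rho_comm _ x, rho_comm _ (D.disk a).boundary, wordElt_cons, mul_smul,
    D.rho_boundary_smul a (smul_mem_hyperbolicSpace _ hy), add_comm]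

theorem rho_boundary_wordElt {y : ProjLine k} (hy : y ∈ hyperbolicSpace k)
    (hyF : y ∈ D.fundamentalDomain) (a b : Letter g) (l : List (Letter g))
    (h : FreeGroup.IsReduced (a :: b :: l)) :
    rho (D.disk a.inv).boundary (wordElt γ (b :: l) • y) =
      rho (D.disk a.inv).boundary (D.disk b).boundary +
      rho (D.disk b.inv).boundary (wordElt γ l • y) := by
  rw [FreeGroup.isReduced_cons_cons] at h
  have hm := D.wordElt_smul_mem hyF b l h.2
  have hwy := smul_mem_hyperbolicSpace (wordElt γ (b :: l)) hy
  have hne : a.inv ≠ b := (Letter.inv_ne_iff a b).2 h.1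
  have key := (D.disk b).isEnd.add _ hm.1 hwy _
    (D.notMem_carrier hne (D.disk a.inv).boundary_mem_carrier) (D.boundary_mem a.inv)
  rw [rho_comm, key, rho_comm _ (D.disk a.inv).boundary, rho_comm _ (D.disk b).boundary,
    wordElt_cons, mul_smul, D.rho_boundary_smul b (smul_mem_hyperbolicSpace _ hy), add_comm]

theorem exists_min_rho_boundary :
    ∃ δ > 0, ∀ a b : Letter g, a ≠ b → δ ≤ rho (D.disk a).boundary (D.disk b).boundary := by
  classical
  set s : Finset ℝ := (Finset.univ.filter fun p : Letter g × Letter g => p.1 ≠ p.2).image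
    fun p => rho (D.disk p.1).boundary (D.disk p.2).boundary with hs
  have hmem : ∀ a b : Letter g, a ≠ b → rho (D.disk a).boundary (D.disk b).boundary ∈ s :=
    fun a b hab => Finset.mem_image.2 ⟨(a, b), by simpa using hab, rfl⟩
  rcases s.eq_empty_or_nonempty with h | h
  · exact ⟨1, one_pos, fun a b hab => by simpa [h] using hmem a b hab⟩
  · refine ⟨s.min' h, ?_, fun a b hab => s.min'_le _ (hmem a b hab)⟩
    obtain ⟨⟨a, b⟩, hab, h'⟩ := Finset.mem_image.1 (s.min'_mem h)
    rw [← h']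
    exact D.rho_boundary_pos (by simpa using hab)

theorem exists_smul_mem_fundamentalDomain {Γ : Subgroup PGL(2, k)} (hΓ : ∀ i, γ i ∈ Γ)
    {x : ProjLine k} (hx : x ∈ hyperbolicSpace k) : ∃ α ∈ Γ, α • x ∈ D.fundamentalDomain := by
  obtain ⟨δ, hδ, hmin⟩ := D.exists_min_rho_boundary
  have helt : ∀ a : Letter g, a.elt γ ∈ Γ := by
    intro a
    rw [Letter.elt]
    split_ifs
    · exact hΓ _
    · exact Γ.inv_mem (hΓ _)
  -- Descent: for x in D_a, if a⁻¹x is not yet in F it lies in some D_b with b ≠ a⁻¹, and ρ(∂D_b,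
  -- a⁻¹x) is smaller than ρ(∂D_a, x) by ρ(∂D_{a⁻¹}, ∂D_b) ≥ δ.
  have key : ∀ (N : ℕ) (x : ProjLine k), x ∈ hyperbolicSpace k → ∀ a : Letter g,
      x ∈ (D.disk a).carrier → (a.2 = true ∨ x ∈ D.openDisk a) →
      rho (D.disk a).boundary x < N * δ → ∃ α ∈ Γ, α • x ∈ D.fundamentalDomain := by
    intro N
    induction N with
    | zero =>
      intro x hx a _ _ h
      have := rho_nonneg (D.boundary_mem a) hx
      rw [Nat.cast_zero, zero_mul] at h
      linarith
    | succ N ih =>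
      intro x hx a hxa ha h
      set x' := (a.elt γ)⁻¹ • x with hx'
      have hxx' : x = a.elt γ • x' := by rw [hx', smul_inv_smul]
      have hxH : x' ∈ hyperbolicSpace k := smul_mem_hyperbolicSpace _ hx
      by_cases hF : x' ∈ D.fundamentalDomain
      · exact ⟨_, Γ.inv_mem (helt a), hF⟩
      · have hx'a := (D.inv_elt_smul_mem hxa ha).resolve_left hF
        obtain ⟨b, hb, hb'⟩ := D.exists_letter_of_notMem hF
        have hne : a.inv ≠ b := by
          rintro rfl
          exact hx'a hb
        have h1 := (D.disk b).isEnd.add _ hb hxH _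
          (D.notMem_carrier hne (D.disk a.inv).boundary_mem_carrier) (D.boundary_mem a.inv)
        have h2 := hmin _ _ hne
        rw [hxx', D.rho_boundary_smul a hxH, rho_comm, h1, rho_comm x',
          rho_comm (D.disk b).boundary (D.disk a.inv).boundary] at h
        push_cast at h
        obtain ⟨α, hα, h3⟩ := ih x' hxH b hb hb' (by linarith)
        refine ⟨α * (a.elt γ)⁻¹, Γ.mul_mem hα (Γ.inv_mem (helt a)), ?_⟩
        rw [mul_smul]
        exact h3
  by_cases hF : x ∈ D.fundamentalDomain
  · exact ⟨1, Γ.one_mem, by rwa [one_smul]⟩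
  · obtain ⟨a, ha, ha'⟩ := D.exists_letter_of_notMem hF
    obtain ⟨N, hN⟩ := exists_nat_gt (rho (D.disk a).boundary x / δ)
    exact key N x hx a ha ha' ((div_lt_iff₀ hδ).1 hN)

end SchottkyFigure


/-! ### Sums over words and the geometric series of a non-negative matrix -/

section WordSums

variable {A : Type*} (X Y : A → ℝ) (M : Matrix A A ℝ) (c : ℝ)

/-- The weight `M_{a,a₁} M_{a₁,a₂} ⋯ Y_{aₙ}` of a word `a₁ ⋯ aₙ` following the letter `a`. -/
def wordWeight : A → List A → ℝ
  | a, [] => Y a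
  | a, b :: l => M a b * wordWeight b l

/-- The weight `X_{a₁} M_{a₁,a₂} ⋯ Y_{aₙ}` of a word `a₁ ⋯ aₙ`, and `c` for the empty word. -/
def wordTerm : List A → ℝ
  | [] => c
  | a :: l => X a * wordWeight Y M a l

variable {X Y M c}

theorem wordWeight_nonneg (hY : ∀ a, 0 ≤ Y a) (hM : ∀ a b, 0 ≤ M a b) (a : A) (l : List A) :
    0 ≤ wordWeight Y M a l := by
  induction l generalizing a with
  | nil => exact hY a
  | cons b l ih => exact mul_nonneg (hM a b) (ih b)

theorem wordTerm_nonneg (hX : ∀ a, 0 ≤ X a) (hY : ∀ a, 0 ≤ Y a) (hM : ∀ a b, 0 ≤ M a b)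
    (hc : 0 ≤ c) (l : List A) : 0 ≤ wordTerm X Y M c l := by
  cases l with
  | nil => exact hc
  | cons a l => exact mul_nonneg (hX a) (wordWeight_nonneg hY hM a l)

variable [Fintype A] (X Y M c)

theorem sum_wordWeight [DecidableEq A] (n : ℕ) (a : A) :
    ∑ f : Fin n → A, wordWeight Y M a (List.ofFn f) = ((M ^ n).mulVec Y) a := by
  induction n generalizing a with
  | zero => simp [wordWeight]
  | succ n ih =>
    rw [← (Fin.consEquiv fun _ => A).sum_comp, Fintype.sum_prod_type, pow_succ',
      ← Matrix.mulVec_mulVec]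
    refine Finset.sum_congr rfl fun b _ => ?_
    rw [← ih, Finset.mul_sum]
    refine Finset.sum_congr rfl fun f _ => ?_
    simp [Fin.consEquiv, wordWeight]

theorem sum_wordTerm [DecidableEq A] (n : ℕ) :
    ∑ f : Fin (n + 1) → A, wordTerm X Y M c (List.ofFn f) = X ⬝ᵥ ((M ^ n).mulVec Y) := by
  rw [← (Fin.consEquiv fun _ => A).sum_comp, Fintype.sum_prod_type]
  refine Finset.sum_congr rfl fun b _ => ?_
  rw [← sum_wordWeight, Finset.mul_sum]
  refine Finset.sum_congr rfl fun f _ => ?_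
  simp [Fin.consEquiv, wordTerm]

variable {X Y M c}

/-- Words are grouped by length, legitimate in both directions by non-negativity. A word of length n
+ 1 has n transitions, hence the shift of index. -/
theorem summable_wordTerm_iff [DecidableEq A] (hX : ∀ a, 0 ≤ X a) (hY : ∀ a, 0 ≤ Y a)
    (hM : ∀ a b, 0 ≤ M a b) (hc : 0 ≤ c) :
    Summable (wordTerm X Y M c) ↔ Summable fun n : ℕ => X ⬝ᵥ ((M ^ n).mulVec Y) := by
  rw [← List.equivSigmaTuple.symm.summable_iff]
  refine (summable_sigma_of_nonneg fun _ => wordTerm_nonneg hX hY hM hc _).trans ?_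
  refine (and_iff_right fun n => (hasSum_fintype _).summable).trans ?_
  rw [← summable_nat_add_iff 1]
  have : ∀ n : ℕ, ∑' f : Fin (n + 1) → A, (wordTerm X Y M c ∘ List.equivSigmaTuple.symm)
      ⟨n + 1, f⟩ = X ⬝ᵥ ((M ^ n).mulVec Y) := fun n => by
    rw [tsum_fintype]; exact sum_wordTerm X Y M c n
  exact summable_congr this

theorem tsum_wordTerm [DecidableEq A] (h : Summable (wordTerm X Y M c)) :
    ∑' l, wordTerm X Y M c l = c + ∑' n : ℕ, X ⬝ᵥ ((M ^ n).mulVec Y) := by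
  have h' := List.equivSigmaTuple.symm.summable_iff.2 h
  rw [← List.equivSigmaTuple.symm.tsum_eq]
  refine (h'.tsum_sigma).trans ?_
  rw [(h'.sigma).tsum_eq_zero_add]
  congr 1
  · rw [tsum_fintype, Fintype.sum_unique]
    simp [List.equivSigmaTuple, wordTerm]
  · refine tsum_congr fun n => ?_
    rw [tsum_fintype]
    exact sum_wordTerm X Y M c n

/-- As X and Y are strictly positive, X_a (Mⁿ)_{ab} Y_b ≤ X Mⁿ Y, so ∑ Mⁿ converges entrywise and is
an inverse of 1 - M. -/
theorem exists_geometric_sum [DecidableEq A] (hX : ∀ a, 0 < X a) (hY : ∀ a, 0 < Y a)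
    (hM : ∀ a b, 0 ≤ M a b) (h : Summable fun n : ℕ => X ⬝ᵥ ((M ^ n).mulVec Y)) :
    (1 - M).det ≠ 0 ∧ ∃ u : A → ℝ, (1 - M).mulVec u = Y ∧
      ∑' n : ℕ, X ⬝ᵥ ((M ^ n).mulVec Y) = X ⬝ᵥ u := by
  have hMn : ∀ n a b, 0 ≤ (M ^ n) a b := by
    intro n
    induction n with
    | zero =>
      intro a b
      rw [pow_zero, Matrix.one_apply]
      split_ifs <;> norm_num
    | succ n ih =>
      intro a b
      rw [pow_succ, Matrix.mul_apply]
      exact Finset.sum_nonneg fun i _ => mul_nonneg (ih a i) (hM i b)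
  have hsum : Summable fun n : ℕ => M ^ n := by
    refine Pi.summable.2 fun a => Pi.summable.2 fun b => ?_
    have h1 : ∀ n : ℕ, (M ^ n) a b ≤ (X a * Y b)⁻¹ * (X ⬝ᵥ ((M ^ n).mulVec Y)) := by
      intro n
      rw [le_inv_mul_iff₀ (mul_pos (hX a) (hY b))]
      have h2 : (M ^ n) a b * Y b ≤ ((M ^ n).mulVec Y) a :=
        Finset.single_le_sum (f := fun b => (M ^ n) a b * Y b)
          (fun i _ => mul_nonneg (hMn n a i) (hY i).le) (Finset.mem_univ b)
      have h3 : X a * ((M ^ n).mulVec Y) a ≤ X ⬝ᵥ ((M ^ n).mulVec Y) :=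
        Finset.single_le_sum (f := fun a => X a * ((M ^ n).mulVec Y) a)
          (fun i _ => mul_nonneg (hX i).le (Finset.sum_nonneg fun j _ =>
            mul_nonneg (hMn n i j) (hY j).le)) (Finset.mem_univ a)
      calc X a * Y b * (M ^ n) a b = X a * ((M ^ n) a b * Y b) := by ring
        _ ≤ _ := (mul_le_mul_of_nonneg_left h2 (hX a).le).trans h3
    exact Summable.of_nonneg_of_le (fun n => hMn n a b) h1 (h.mul_left _)
  set N := ∑' n : ℕ, M ^ n with hN
  have hMN : (1 - M) * N = 1 := by
    have h1 : N = 1 + M * N := by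
      rw [hN, ← hsum.tsum_mul_left, hsum.tsum_eq_zero_add, pow_zero]
      simp only [pow_succ']
    rw [sub_mul, one_mul, sub_eq_iff_eq_add]
    exact h1
  refine ⟨?_, N.mulVec Y, by rw [Matrix.mulVec_mulVec, hMN, Matrix.one_mulVec], ?_⟩
  · intro h0
    have := congrArg Matrix.det hMN
    rw [Matrix.det_mul, h0, zero_mul, Matrix.det_one] at this
    exact zero_ne_one this
  · have hcont : Continuous fun B : Matrix A A ℝ => X ⬝ᵥ (B.mulVec Y) := by fun_prop
    let φ : Matrix A A ℝ →+ ℝ :=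
      { toFun := fun B => X ⬝ᵥ (B.mulVec Y)
        map_zero' := by simp
        map_add' := fun B B' => by rw [Matrix.add_mulVec, dotProduct_add] }
    exact (hsum.hasSum.map φ hcont).tsum_eq

theorem summable_of_row_sum_le [DecidableEq A] (hX : ∀ a, 0 ≤ X a) (hY : ∀ a, 0 ≤ Y a)
    (hM : ∀ a b, 0 ≤ M a b) (h : ∀ a, ∑ b, M a b ≤ 1 / 2) :
    Summable fun n : ℕ => X ⬝ᵥ ((M ^ n).mulVec Y) := by
  obtain ⟨C, hC⟩ : ∃ C, ∀ a, Y a ≤ C := ⟨∑ a, Y a, fun a =>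
    Finset.single_le_sum (fun i _ => hY i) (Finset.mem_univ a)⟩
  have hb : ∀ n a, 0 ≤ ((M ^ n).mulVec Y) a ∧ ((M ^ n).mulVec Y) a ≤ (1 / 2) ^ n * C := by
    intro n
    induction n with
    | zero => intro a; simpa using ⟨hY a, hC a⟩
    | succ n ih =>
      intro a
      rw [pow_succ', ← Matrix.mulVec_mulVec]
      refine ⟨Finset.sum_nonneg fun b _ => mul_nonneg (hM a b) (ih b).1, ?_⟩
      calc M.mulVec ((M ^ n).mulVec Y) a = ∑ b, M a b * ((M ^ n).mulVec Y) b := rfl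
        _ ≤ ∑ b, M a b * ((1 / 2) ^ n * C) :=
          Finset.sum_le_sum fun b _ => mul_le_mul_of_nonneg_left (ih b).2 (hM a b)
        _ = (∑ b, M a b) * ((1 / 2) ^ n * C) := by rw [Finset.sum_mul]
        _ ≤ 1 / 2 * ((1 / 2) ^ n * C) :=
          mul_le_mul_of_nonneg_right (h a) ((ih a).1.trans (ih a).2)
        _ = _ := by ring
  refine Summable.of_nonneg_of_le
    (fun n => Finset.sum_nonneg fun a _ => mul_nonneg (hX a) (hb n a).1)
    (g := fun n => X ⬝ᵥ ((M ^ n).mulVec Y)) (f := fun n => (∑ a, X a) * C * (1 / 2) ^ n) ?_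
    ((summable_geometric_of_lt_one (by norm_num) (by norm_num)).mul_left _)
  intro n
  calc X ⬝ᵥ ((M ^ n).mulVec Y) ≤ ∑ a, X a * ((1 / 2) ^ n * C) :=
        Finset.sum_le_sum fun a _ => mul_le_mul_of_nonneg_left (hb n a).2 (hX a)
    _ = _ := by rw [← Finset.sum_mul]; ring

end WordSums


/-! ### Positivity of ultrametric kernels -/

section UltrametricKernel

variable {A : Type*} [Fintype A]

open Classical in
/-- The kernel of a partial equivalence relation is positive semidefinite. -/
theorem sum_sum_rel_nonneg (r : A → A → Prop) (hs : ∀ a b, r a b → r b a)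
    (ht : ∀ a b c, r a b → r b c → r a c) (v : A → ℝ) :
    0 ≤ ∑ a, ∑ b, v a * v b * (if r a b then 1 else 0) := by
  -- n c is the size of the class of c. Weighting by (n c)⁻¹ counts the square of each class sum of
  -- v once; elements related to nothing have n c = 0 and contribute nothing.
  set n : A → ℝ := fun c => ∑ d, if r d c then 1 else 0 with hn
  have hn0 : ∀ c, 0 ≤ n c := fun c => Finset.sum_nonneg fun d _ => by split_ifs <;> norm_num
  have key : ∀ a b, (∑ c, (n c)⁻¹ * ((if r a c then 1 else 0) * (if r b c then 1 else 0)) : ℝ) =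
      if r a b then 1 else 0 := by
    intro a b
    split_ifs with h
    · have h1 : ∀ c, ((n c)⁻¹ * ((if r a c then 1 else 0) * (if r b c then 1 else 0)) : ℝ) =
          (n a)⁻¹ * (if r c a then 1 else 0) := by
        intro c
        by_cases hc : r a c
        · have hbc : r b c := ht _ _ _ (hs _ _ h) hc
          have : n c = n a := Finset.sum_congr rfl fun d _ => by
            have : r d c ↔ r d a := ⟨fun h' => ht _ _ _ h' (hs _ _ hc), fun h' => ht _ _ _ h' hc⟩
            simp only [this]
          simp [hc, hbc, hs _ _ hc, this]
        · have : ¬ r c a := fun h' => hc (hs _ _ h')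
          simp [hc, this]
      simp only [h1]
      rw [← Finset.mul_sum]
      refine inv_mul_cancel₀ (ne_of_gt ?_)
      have hb : r b a := hs _ _ h
      have : (1 : ℝ) ≤ n a := by
        have := Finset.single_le_sum (f := fun d => if r d a then (1 : ℝ) else 0)
          (fun d _ => by split_ifs <;> norm_num) (Finset.mem_univ b)
        simpa only [if_pos hb] using this
      linarith
    · refine Finset.sum_eq_zero fun c _ => ?_
      by_cases hc : r a c
      · have : ¬ r b c := fun h' => h (ht _ _ _ hc (hs _ _ h'))
        simp [this]
      · simp [hc]
  have e : ∑ a, ∑ b, v a * v b * (if r a b then 1 else 0) =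
      ∑ c, (n c)⁻¹ * (∑ a, v a * (if r a c then 1 else 0)) ^ 2 := by
    have e1 : ∀ a b, v a * v b * (if r a b then 1 else 0) = ∑ c, v a * v b *
        ((n c)⁻¹ * ((if r a c then 1 else 0) * (if r b c then 1 else 0))) := fun a b => by
      rw [← key, Finset.mul_sum]
    have e2 : ∀ c, (n c)⁻¹ * (∑ a, v a * (if r a c then 1 else 0)) ^ 2 = ∑ a, ∑ b, v a * v b *
        ((n c)⁻¹ * ((if r a c then 1 else 0) * (if r b c then 1 else 0))) := fun c => by
      rw [pow_two, Finset.sum_mul_sum, Finset.mul_sum]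
      refine Finset.sum_congr rfl fun a _ => ?_
      rw [Finset.mul_sum]
      refine Finset.sum_congr rfl fun b _ => ?_
      ring
    rw [Finset.sum_congr rfl fun a _ => Finset.sum_congr rfl fun b _ => e1 a b,
      Finset.sum_congr rfl fun c _ => e2 c, Finset.sum_congr rfl fun a _ => Finset.sum_comm,
      Finset.sum_comm]
  rw [e]
  exact Finset.sum_nonneg fun c _ => mul_nonneg (inv_nonneg.2 (hn0 c)) (sq_nonneg _)

open MeasureTheory in
/-- Ultrametric kernels are positive semidefinite. -/
theorem ultrametricKernel_nonneg (K : A → A → ℝ) (hs : ∀ a b, K a b = K b a)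
    (hu : ∀ a b c, min (K a b) (K b c) ≤ K a c) (h0 : ∀ a b, 0 ≤ K a b) (v : A → ℝ) :
    0 ≤ ∑ a, ∑ b, v a * v b * K a b := by
  classical
  obtain ⟨L, hL⟩ : ∃ L, ∀ a b, K a b ≤ L := ⟨∑ a, ∑ b, K a b, fun a b =>
    (Finset.single_le_sum (fun i _ => h0 a i) (Finset.mem_univ b)).trans
      (Finset.single_le_sum (f := fun a => ∑ b, K a b)
        (fun i _ => Finset.sum_nonneg fun j _ => h0 i j) (Finset.mem_univ a))⟩
  -- Layer-cake formula: K is the integral over u of the indicators of {K > u}, which are symmetric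
  -- and, by the ultrametric inequality, transitive relations.
  have hK : ∀ a b, K a b = ∫ u in Set.Ioc 0 L, (Set.Iio (K a b)).indicator 1 u := by
    intro a b
    rw [integral_indicator_one measurableSet_Iio, measureReal_restrict_apply measurableSet_Iio]
    have : Set.Iio (K a b) ∩ Set.Ioc 0 L = Set.Ioo 0 (K a b) := by
      ext u
      simp only [Set.mem_inter_iff, Set.mem_Iio, Set.mem_Ioc, Set.mem_Ioo]
      exact ⟨fun h => ⟨h.2.1, h.1⟩, fun h => ⟨h.2, h.1, h.2.le.trans (hL a b)⟩⟩
    rw [this, Real.volume_real_Ioo_of_le (h0 a b), sub_zero]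
  have hint : ∀ a b, Integrable (fun u => v a * v b * (Set.Iio (K a b)).indicator 1 u)
      (volume.restrict (Set.Ioc 0 L)) := by
    intro a b
    refine Integrable.const_mul ?_ _
    exact (integrable_const (1 : ℝ)).indicator measurableSet_Iio
  have e : ∑ a, ∑ b, v a * v b * K a b = ∫ u in Set.Ioc 0 L,
      ∑ a, ∑ b, v a * v b * (Set.Iio (K a b)).indicator 1 u := by
    rw [integral_finsetSum _ fun a _ => integrable_finsetSum _ fun b _ => hint a b]
    refine Finset.sum_congr rfl fun a _ => ?_
    rw [integral_finsetSum _ fun b _ => hint a b]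
    refine Finset.sum_congr rfl fun b _ => ?_
    rw [integral_const_mul, ← hK]
  rw [e]
  refine integral_nonneg fun u => ?_
  have := sum_sum_rel_nonneg (fun a b => u < K a b) (fun a b h => by rwa [hs])
    (fun a b c h1 h2 => (lt_min h1 h2).trans_le (hu a b c)) v
  simpa [Set.indicator_apply] using this

/-- Let a₀ maximise the diagonal over the support of v. By `hd`, K a₀ a₀ exceeds every other K a₀ b
on the support, so it can be lowered to some κ without destroying the ultrametric inequality. The
lowered kernel is still semidefinite, and the excess v(a₀)² (K a₀ a₀ - κ) is positive. -/
theorem ultrametricKernel_pos (K : A → A → ℝ) (hs : ∀ a b, K a b = K b a)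
    (hu : ∀ a b c, min (K a b) (K b c) ≤ K a c) (h0 : ∀ a b, 0 < K a b)
    (hd : ∀ a b, a ≠ b → 2 * K a b < K a a + K b b) {v : A → ℝ} (hv : v ≠ 0) :
    0 < ∑ a, ∑ b, v a * v b * K a b := by
  classical
  obtain ⟨a₁, ha₁⟩ := Function.ne_iff.1 hv
  obtain ⟨a₀, ha₀, hmax⟩ := (Finset.univ.filter fun a => v a ≠ 0).exists_max_image
    (fun a => K a a) ⟨a₁, by simpa using ha₁⟩
  simp only [Finset.mem_filter, Finset.mem_univ, true_and] at ha₀ hmax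
  have hlt : ∀ b, v b ≠ 0 → b ≠ a₀ → K a₀ b < K a₀ a₀ := by
    intro b hb hne
    have h1 := hd a₀ b hne.symm
    have h2 := hmax b hb
    linarith
  obtain ⟨κ, hκ0, hκ, hκb⟩ : ∃ κ, 0 ≤ κ ∧ κ < K a₀ a₀ ∧
      ∀ b, v b ≠ 0 → b ≠ a₀ → K a₀ b ≤ κ := by
    set T : Finset ℝ := insert 0 ((Finset.univ.filter fun b => v b ≠ 0 ∧ b ≠ a₀).image (K a₀))
    have hT : T.Nonempty := Finset.insert_nonempty _ _
    refine ⟨T.max' hT, T.le_max' _ (Finset.mem_insert_self _ _), ?_, fun b hb hne => ?_⟩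
    · rw [Finset.max'_lt_iff]
      intro y hy
      rcases Finset.mem_insert.1 hy with rfl | hy
      · exact h0 _ _
      · obtain ⟨b, hb, rfl⟩ := Finset.mem_image.1 hy
        simp only [Finset.mem_filter, Finset.mem_univ, true_and] at hb
        exact hlt b hb.1 hb.2
    · refine T.le_max' _ (Finset.mem_insert_of_mem (Finset.mem_image_of_mem _ ?_))
      simpa using ⟨hb, hne⟩
  -- The kernel is set to zero off the support of v, because κ bounds the entries K a₀ b only for b
  -- in the support.
  set K' : A → A → ℝ := fun a b => if v a = 0 ∨ v b = 0 then 0 else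
    if a = a₀ ∧ b = a₀ then κ else K a b with hK'
  have hK'0 : ∀ a b, 0 ≤ K' a b := by
    intro a b
    simp only [hK']
    split_ifs
    exacts [le_rfl, hκ0, (h0 a b).le]
  have hK'le : ∀ a b, K' a b ≤ K a b := by
    intro a b
    simp only [hK']
    split_ifs with h1 h2
    · exact (h0 a b).le
    · rw [h2.1, h2.2]; exact hκ.le
    · exact le_rfl
  have hnn := ultrametricKernel_nonneg K' ?_ ?_ hK'0 v
  · have hterm : ∀ a b, v a * v b * K a b = v a * v b * K' a b +
        (if a = a₀ then if b = a₀ then v a₀ ^ 2 * (K a₀ a₀ - κ) else 0 else 0) := by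
      intro a b
      by_cases ha : a = a₀
      · by_cases hb : b = a₀
        · subst ha hb
          simp [hK', ha₀]
          ring
        · by_cases hvb : v b = 0
          · simp [hvb, hb]
          · simp [hK', ha, hb, hvb, ha₀]
      · by_cases h : v a = 0 ∨ v b = 0
        · rcases h with h | h <;> simp [h, ha]
        · simp [hK', ha, h]
    simp only [hterm, Finset.sum_add_distrib]
    have : (∑ a, ∑ b, if a = a₀ then if b = a₀ then v a₀ ^ 2 * (K a₀ a₀ - κ) else 0 else 0) =
        v a₀ ^ 2 * (K a₀ a₀ - κ) := by
      rw [Finset.sum_eq_single a₀]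
      · simp
      · intro a _ ha
        simp [ha]
      · simp
    rw [this]
    have h2 : 0 < v a₀ ^ 2 := by positivity
    have h3 : 0 < K a₀ a₀ - κ := sub_pos.2 hκ
    linarith [mul_pos h2 h3]
  · intro a b
    simp only [hK']
    simp only [hs a b, or_comm (a := v a = 0), and_comm (a := a = a₀)]
  · intro a b c
    by_cases hb : v b = 0
    · have : K' a b = 0 := by simp [hK', hb]
      exact (min_le_left _ _).trans (this.le.trans (hK'0 a c))
    by_cases ha : v a = 0
    · have : K' a b = 0 := by simp [hK', ha]
      exact (min_le_left _ _).trans (this.le.trans (hK'0 a c))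
    by_cases hc : v c = 0
    · have : K' b c = 0 := by simp [hK', hc]
      exact (min_le_right _ _).trans (this.le.trans (hK'0 a c))
    by_cases hac : a = a₀ ∧ c = a₀
    · obtain ⟨rfl, rfl⟩ := hac
      have h1 : K' c c = κ := by simp [hK', hc]
      rw [h1]
      by_cases hbc : b = c
      · subst hbc
        rw [h1, min_self]
      · exact (min_le_left _ _).trans ((hK'le _ _).trans (hκb b hb hbc))
    · have : K' a c = K a c := by simp only [hK', ha, hc, or_self, if_false, hac]
      rw [this]
      exact (min_le_min (hK'le a b) (hK'le b c)).trans (hu a b c)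

end UltrametricKernel

/-! ### Negative definiteness of the distance matrix -/

namespace SchottkyFigure

variable {k : Type*} [NontriviallyNormedField k] [IsUltrametricDist k] [CompleteSpace k]
variable {g : ℕ} {γ : Fin g → PGL(2, k)} (D : SchottkyFigure γ)

/-- The distance matrix of the boundary points is negative definite on vectors of sum zero. -/
theorem sum_rho_boundary_neg {v : Letter g → ℝ} (hv : v ≠ 0) (hv0 : ∑ a, v a = 0) :
    ∑ a, ∑ b, v a * v b * rho (D.disk a).boundary (D.disk b).boundary < 0 := by
  have hx : ∀ a, ∃ x : AffineLine k, (D.disk a).boundary = x ∧ 0 < jointDiam x x :=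
    fun a => exists_coe_of_mem (D.boundary_mem a)
  choose x hxa hx0 using hx
  have hpos : ∀ a b, 0 < jointDiam (x a) (x b) :=
    fun a b => (hx0 a).trans_le (jointDiam_self_le _ _)
  obtain ⟨L, hL⟩ : ∃ L : ℝ, ∀ a b, Real.log (jointDiam (x a) (x b)) < L := by
    refine ⟨(∑ a, ∑ b, |Real.log (jointDiam (x a) (x b))|) + 1, fun a b => ?_⟩
    have h1 := Finset.single_le_sum (f := fun b => |Real.log (jointDiam (x a) (x b))|)
      (fun i _ => abs_nonneg _) (Finset.mem_univ b)
    have h2 := Finset.single_le_sum (f := fun a => ∑ b, |Real.log (jointDiam (x a) (x b))|)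
      (fun i _ => Finset.sum_nonneg fun j _ => abs_nonneg _) (Finset.mem_univ a)
    have h3 := le_abs_self (Real.log (jointDiam (x a) (x b)))
    linarith
  have key := ultrametricKernel_pos (fun a b => L - Real.log (jointDiam (x a) (x b)))
    (fun a b => by rw [jointDiam_comm]) (fun a b c => ?_) (fun a b => sub_pos.2 (hL a b))
    (fun a b hab => ?_) hv
  · set c : Letter g → ℝ := fun a => Real.log (jointDiam (x a) (x a)) with hc
    -- Up to terms depending on only one of the two indices, which vanish on vectors of sum zero, ρ
    -- is -2 times the ultrametric kernel L - log jointDiam.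
    have e : ∀ a b, v a * v b * rho (D.disk a).boundary (D.disk b).boundary =
        -2 * (v a * v b * (L - Real.log (jointDiam (x a) (x b)))) +
        ((2 * L * v a - v a * c a) * v b - v a * (v b * c b)) := by
      intro a b
      rw [hxa, hxa, rho_coe]
      ring
    simp only [e, Finset.sum_add_distrib, Finset.sum_sub_distrib, ← Finset.mul_sum,
      ← Finset.sum_mul, hv0]
    linarith
  · have h := jointDiam_le_max (x a) (x b) (x c)
    rcases le_max_iff.1 h with h | h
    · exact (min_le_left _ _).trans (sub_le_sub_left (Real.log_le_log (hpos a c) h) L)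
    · exact (min_le_right _ _).trans (sub_le_sub_left (Real.log_le_log (hpos a c) h) L)
  · have := D.rho_boundary_pos hab
    rw [hxa, hxa, rho_coe] at this
    linarith

end SchottkyFigure


/-! ### Meromorphy of the resolvent and its desingularization at 0 -/

section Analytic

open Filter Topology

variable {A : Type*} [Fintype A]

theorem differentiable_det [DecidableEq A] {B : ℂ → Matrix A A ℂ}
    (hB : ∀ a b, Differentiable ℂ fun s => B s a b) : Differentiable ℂ fun s => (B s).det := by
  simp only [Matrix.det_apply]
  refine Differentiable.fun_sum fun σ _ => Differentiable.const_smul ?_ _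
  exact Differentiable.fun_finsetProd fun a _ => hB _ _

theorem differentiable_cramer [DecidableEq A] {B : ℂ → Matrix A A ℂ} {f : ℂ → A → ℂ}
    (hB : ∀ a b, Differentiable ℂ fun s => B s a b) (hf : ∀ a, Differentiable ℂ fun s => f s a)
    (a : A) : Differentiable ℂ fun s => (B s).cramer (f s) a := by
  simp only [Matrix.cramer_apply]
  refine differentiable_det fun b c => ?_
  simp only [Matrix.updateCol_apply]
  split_ifs
  exacts [hf b, hB b c]

theorem inv_mulVec_eq_cramer [DecidableEq A] (B : Matrix A A ℂ) (f : A → ℂ) :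
    B⁻¹.mulVec f = B.det⁻¹ • B.cramer f := by
  rw [Matrix.inv_def, Ring.inverse_eq_inv', Matrix.smul_mulVec, Matrix.cramer_eq_adjugate_mulVec]

theorem inv_mulVec_eq [DecidableEq A] {K : Type*} [Field K] {B : Matrix A A K} (hB : B.det ≠ 0)
    {u f : A → K} (h : B.mulVec u = f) : B⁻¹.mulVec f = u := by
  rw [← h, Matrix.mulVec_mulVec, Matrix.nonsing_inv_mul _ (isUnit_iff_ne_zero.2 hB),
    Matrix.one_mulVec]

theorem meromorphicAt_dotProduct_inv [DecidableEq A] {B : ℂ → Matrix A A ℂ} {f e : ℂ → A → ℂ}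
    (hB : ∀ a b, Differentiable ℂ fun s => B s a b) (hf : ∀ a, Differentiable ℂ fun s => f s a)
    (he : ∀ a, Differentiable ℂ fun s => e s a) (z : ℂ) :
    MeromorphicAt (fun s => e s ⬝ᵥ ((B s)⁻¹.mulVec (f s))) z := by
  have h1 : (fun s => e s ⬝ᵥ ((B s)⁻¹.mulVec (f s))) =
      (fun s => (B s).det)⁻¹ * fun s => ∑ a, e s a * (B s).cramer (f s) a := by
    funext s
    rw [inv_mulVec_eq_cramer, dotProduct_smul, smul_eq_mul]
    rfl
  rw [h1]
  refine ((differentiable_det hB).analyticAt z).meromorphicAt.inv.mul ?_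
  refine (Differentiable.analyticAt ?_ z).meromorphicAt
  exact Differentiable.fun_sum fun a _ => (he a).mul (differentiable_cramer hB hf a)

theorem analyticAt_dotProduct_inv [DecidableEq A] {B : ℂ → Matrix A A ℂ} {f e : ℂ → A → ℂ}
    (hB : ∀ a b, Differentiable ℂ fun s => B s a b) (hf : ∀ a, Differentiable ℂ fun s => f s a)
    (he : ∀ a, Differentiable ℂ fun s => e s a) {z : ℂ} (hz : (B z).det ≠ 0) :
    AnalyticAt ℂ (fun s => e s ⬝ᵥ ((B s)⁻¹.mulVec (f s))) z := by
  have h1 : (fun s => e s ⬝ᵥ ((B s)⁻¹.mulVec (f s))) =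
      (fun s => (B s).det)⁻¹ * fun s => ∑ a, e s a * (B s).cramer (f s) a := by
    funext s
    rw [inv_mulVec_eq_cramer, dotProduct_smul, smul_eq_mul]
    rfl
  rw [h1]
  refine (((differentiable_det hB).analyticAt z).inv hz).mul (Differentiable.analyticAt ?_ z)
  exact Differentiable.fun_sum fun a _ => (he a).mul (differentiable_cramer hB hf a)

variable (τ : A → A)

/-- The family `f` after its part which is antisymmetric under `τ`, supposed to vanish at `0`, has
been divided by the variable. -/
def desingularize (f : ℂ → A → ℂ) (s : ℂ) (a : A) : ℂ :=
  f s a + f s (τ a) + dslope (fun s => f s a - f s (τ a)) 0 s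

/-- The columnwise version of `desingularize`. -/
def desingularizeMatrix (B : ℂ → Matrix A A ℂ) (s : ℂ) : Matrix A A ℂ :=
  Matrix.of fun a b => desingularize τ (fun s a => B s a b) s a

variable {τ}

omit [Fintype A] in
theorem differentiable_desingularize {f : ℂ → A → ℂ}
    (hf : ∀ a, Differentiable ℂ fun s => f s a) (a : A) :
    Differentiable ℂ fun s => desingularize τ f s a := by
  refine ((hf a).add (hf (τ a))).add ?_
  rw [← differentiableOn_univ, Complex.differentiableOn_dslope univ_mem, differentiableOn_univ]
  exact (hf a).sub (hf (τ a))

omit [Fintype A] in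
theorem desingularize_of_ne {f : ℂ → A → ℂ} (hf : ∀ a, f 0 (τ a) = f 0 a) {s : ℂ} (hs : s ≠ 0)
    (a : A) : desingularize τ f s a = (1 + s⁻¹) * f s a + (1 - s⁻¹) * f s (τ a) := by
  rw [desingularize, dslope_of_ne _ hs, slope_def_field, hf]
  ring

/-- For s ≠ 0 the rows a and τa are combined with coefficients 1 + s⁻¹ and 1 - s⁻¹ on both sides, so
solutions of the old system solve the new one, which still makes sense at s = 0. -/
theorem desingularizeMatrix_mulVec {B : ℂ → Matrix A A ℂ} (hB : ∀ a b, B 0 (τ a) b = B 0 a b)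
    {f : ℂ → A → ℂ} (hf : ∀ a, f 0 (τ a) = f 0 a) {s : ℂ} (hs : s ≠ 0) {u : A → ℂ}
    (h : (B s).mulVec u = f s) : (desingularizeMatrix τ B s).mulVec u = desingularize τ f s := by
  funext a
  have e : ∀ b, desingularizeMatrix τ B s a b * u b =
      (1 + s⁻¹) * (B s a b * u b) + (1 - s⁻¹) * (B s (τ a) b * u b) := fun b => by
    rw [desingularizeMatrix, Matrix.of_apply,
      desingularize_of_ne (f := fun s a => B s a b) (fun a => hB a b) hs]
    ring
  rw [desingularize_of_ne hf hs, ← h]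
  simp only [Matrix.mulVec, dotProduct, e, Finset.sum_add_distrib, ← Finset.mul_sum]

variable [DecidableEq A] (τ)

/-- The matrix with entries `-exp(-s R(τ a, b))`, to which `1` and the matrix of `τ` are added. -/
def expMatrix (R : A → A → ℝ) (s : ℂ) : Matrix A A ℂ := Matrix.of fun a b =>
  (if a = b then 1 else 0) + (if τ a = b then 1 else 0) - Complex.exp (-s * R (τ a) b)

variable {τ} {R : A → A → ℝ}

omit [Fintype A] in
theorem differentiable_expMatrix (a b : A) : Differentiable ℂ fun s => expMatrix τ R s a b := by
  simp only [expMatrix, Matrix.of_apply]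
  fun_prop

theorem hasDerivAt_exp_neg_mul (r : ℂ) :
    HasDerivAt (fun s : ℂ => Complex.exp (-s * r)) (-r) 0 := by
  have := ((hasDerivAt_id (0 : ℂ)).neg.mul_const r).cexp
  simpa using this

-- Summing over a, with S the sum of u and n the cardinality, gives 2S - nS = nc.
omit [DecidableEq A] in
theorem card_eq_of_symmetrized (hτ : Function.Involutive τ) (hn : Fintype.card A ≠ 2) {c : ℂ}
    {u : A → ℂ} (h : ∀ a, u a + u (τ a) - ∑ b, u b = c) :
    ∑ b, u b = c * (Fintype.card A / (2 - Fintype.card A)) := by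
  have h1 : ∑ a, (u a + u (τ a) - ∑ b, u b) = Fintype.card A * c := by
    simp [h]
  have h2 : ∑ a, u (τ a) = ∑ a, u a := Equiv.sum_comp hτ.toPerm u
  rw [Finset.sum_sub_distrib, Finset.sum_add_distrib, h2, Finset.sum_const, Finset.card_univ,
    nsmul_eq_mul] at h1
  have h3 : (2 - Fintype.card A : ℂ) ≠ 0 := by
    rw [sub_ne_zero]
    exact_mod_cast hn.symm
  field_simp
  linear_combination h1

-- Rv is τ-invariant while v is antisymmetric, so vᵀRv = 0; but v has sum zero, which makes vᵀRv
-- negative unless v = 0.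
omit [DecidableEq A] in
theorem eq_zero_of_antisymm (hτ : Function.Involutive τ)
    (hR : ∀ v : A → ℝ, v ≠ 0 → ∑ a, v a = 0 → ∑ a, ∑ b, v a * v b * R a b < 0) {v : A → ℝ}
    (hv : ∀ a, v (τ a) = -v a) (h : ∀ a, ∑ b, (R (τ a) b - R a b) * v b = 0) : v = 0 := by
  by_contra hne
  have h0 : ∑ a, v a = 0 := by
    have := Equiv.sum_comp hτ.toPerm v
    simp only [Function.Involutive.coe_toPerm, hv, Finset.sum_neg_distrib] at this
    linarith
  have h1 : ∀ a, ∑ b, R (τ a) b * v b = ∑ b, R a b * v b := fun a => by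
    rw [← sub_eq_zero, ← Finset.sum_sub_distrib, ← h a]
    simp only [sub_mul]
  have h2 := Equiv.sum_comp hτ.toPerm fun a => v a * ∑ b, R a b * v b
  simp only [Function.Involutive.coe_toPerm, hv, h1, neg_mul, Finset.sum_neg_distrib] at h2
  have h3 := hR v hne h0
  have h4 : ∑ a, ∑ b, v a * v b * R a b = ∑ a, v a * ∑ b, R a b * v b := by
    simp only [Finset.mul_sum]
    exact Finset.sum_congr rfl fun a _ => Finset.sum_congr rfl fun b _ => by ring
  linarith

/-- At 0 all exponentials are 1. The identity and τ cancel in the difference of the rows a and τa,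
whose derivative therefore involves R alone. -/
theorem desingularizeMatrix_expMatrix_zero (hτ : Function.Involutive τ) (u : A → ℂ) (a : A) :
    (desingularizeMatrix τ (expMatrix τ R) 0).mulVec u a =
      2 * (u a + u (τ a) - ∑ b, u b) + ∑ b, ((R (τ a) b - R a b : ℝ) : ℂ) * u b := by
  have e : ∀ b, desingularizeMatrix τ (expMatrix τ R) 0 a b * u b =
      2 * ((if a = b then u b else 0) + (if τ a = b then u b else 0) - u b) +
        ((R (τ a) b - R a b : ℝ) : ℂ) * u b := fun b => by
    have h1 : HasDerivAt (fun s => expMatrix τ R s a b - expMatrix τ R s (τ a) b)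
        (R (τ a) b - R a b) 0 := by
      have := (hasDerivAt_exp_neg_mul (R a b)).sub (hasDerivAt_exp_neg_mul (R (τ a) b))
      have e1 : (fun s => expMatrix τ R s a b - expMatrix τ R s (τ a) b) =
          (fun s : ℂ => Complex.exp (-s * R a b)) - fun s : ℂ => Complex.exp (-s * R (τ a) b) := by
        funext s
        simp only [expMatrix, Matrix.of_apply, hτ a, Pi.sub_apply]
        ring
      rw [e1]
      exact this.congr_deriv (by ring)
    rw [desingularizeMatrix, Matrix.of_apply, desingularize, dslope_same, h1.deriv]
    simp only [expMatrix, Matrix.of_apply, hτ a, neg_zero, zero_mul, Complex.exp_zero]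
    push_cast
    split_ifs <;> ring
  simp only [Matrix.mulVec, dotProduct, e, Finset.sum_add_distrib, ← Finset.mul_sum,
    Finset.sum_sub_distrib, Finset.sum_ite_eq, Finset.mem_univ, if_true]

variable (hτ : Function.Involutive τ) (hn : Fintype.card A ≠ 2)
  (hR : ∀ v : A → ℝ, v ≠ 0 → ∑ a, v a = 0 → ∑ a, ∑ b, v a * v b * R a b < 0)

-- The part of a kernel equation symmetric under τ involves only v_a + v_{τa} - ∑v and makes v
-- antisymmetric of sum zero; the antisymmetric part then contradicts negative definiteness,
-- separately for real and imaginary parts.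
include hτ hn hR in
theorem det_desingularizeMatrix_ne_zero :
    (desingularizeMatrix τ (expMatrix τ R) 0).det ≠ 0 := by
  intro h0
  obtain ⟨v, hv, hv0⟩ := Matrix.exists_mulVec_eq_zero_iff.2 h0
  have h1 : ∀ a, 2 * (v a + v (τ a) - ∑ b, v b) +
      ∑ b, ((R (τ a) b - R a b : ℝ) : ℂ) * v b = 0 := fun a => by
    rw [← desingularizeMatrix_expMatrix_zero hτ, hv0, Pi.zero_apply]
  -- Adding the equations for a and τa cancels the terms in R.
  have h2 : ∀ a, v a + v (τ a) - ∑ b, v b = 0 := fun a => by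
    have h3 := h1 (τ a)
    have h4 : ∑ b, ((R a b - R (τ a) b : ℝ) : ℂ) * v b =
        -∑ b, ((R (τ a) b - R a b : ℝ) : ℂ) * v b := by
      rw [← Finset.sum_neg_distrib]
      refine Finset.sum_congr rfl fun b _ => ?_
      push_cast
      ring
    rw [hτ a, h4] at h3
    linear_combination (h1 a + h3) / 4
  have hsum : ∑ b, v b = 0 := by
    simpa using card_eq_of_symmetrized hτ hn h2
  have hanti : ∀ a, v (τ a) = -v a := fun a => by linear_combination h2 a + hsum
  have h5 : ∀ a, ∑ b, ((R (τ a) b - R a b : ℝ) : ℂ) * v b = 0 := fun a => by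
    simpa [h2 a] using h1 a
  refine hv (funext fun a => Complex.ext ?_ ?_)
  · refine congrFun (eq_zero_of_antisymm (v := fun a => (v a).re) hτ hR (fun a => ?_)
      fun a => ?_) a
    · simp [hanti]
    · simpa only [Complex.re_sum, Complex.re_ofReal_mul, Complex.zero_re] using congrArg Complex.re (h5 a)
  · refine congrFun (eq_zero_of_antisymm (v := fun a => (v a).im) hτ hR (fun a => ?_)
      fun a => ?_) a
    · simp [hanti]
    · simpa only [Complex.im_sum, Complex.im_ofReal_mul, Complex.zero_im] using congrArg Complex.im (h5 a)

omit [Fintype A] in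
include hτ in
theorem expMatrix_zero (a b : A) : expMatrix τ R 0 (τ a) b = expMatrix τ R 0 a b := by
  simp [expMatrix, hτ a, add_comm]

include hτ hn hR in
theorem eventually_det_desingularizeMatrix_ne_zero :
    ∀ᶠ s in 𝓝 0, (desingularizeMatrix τ (expMatrix τ R) s).det ≠ 0 :=
  (differentiable_det fun a _ => differentiable_desingularize
    (fun a => differentiable_expMatrix a _) a).continuous.continuousAt.eventually_ne
    (det_desingularizeMatrix_ne_zero hτ hn hR)

-- For s ≠ 0 a kernel vector of the original matrix is one of the desingularized matrix, which is
-- invertible near 0.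
include hτ hn hR in
theorem eventually_det_expMatrix_ne_zero_at_zero :
    ∀ᶠ s in 𝓝[≠] 0, (expMatrix τ R s).det ≠ 0 := by
  filter_upwards [(eventually_det_desingularizeMatrix_ne_zero hτ hn hR).filter_mono
    nhdsWithin_le_nhds, self_mem_nhdsWithin] with s hs hs0 h0
  obtain ⟨v, hv, hv0⟩ := Matrix.exists_mulVec_eq_zero_iff.2 h0
  refine hs (Matrix.exists_mulVec_eq_zero_iff.1 ⟨v, hv, ?_⟩)
  rw [desingularizeMatrix_mulVec (expMatrix_zero hτ) (f := fun _ _ => 0) (fun _ => rfl) hs0 hv0]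
  funext a
  simp [desingularize_of_ne (τ := τ) (f := fun _ _ => 0) (fun _ => rfl) hs0]

-- The determinant is entire and not identically zero, being non-zero near 0 away from 0; its zeros
-- are isolated.
include hτ hn hR in
theorem eventually_det_expMatrix_ne_zero (z : ℂ) :
    ∀ᶠ s in 𝓝[≠] z, (expMatrix τ R s).det ≠ 0 := by
  have hd : Differentiable ℂ fun s => (expMatrix τ R s).det :=
    differentiable_det differentiable_expMatrix
  refine ((hd.analyticAt z).eventually_eq_zero_or_eventually_ne_zero).resolve_left fun h => ?_
  have h1 := (hd.differentiableOn.analyticOnNhd isOpen_univ).eqOn_zero_of_preconnected_of_eventuallyEq_zero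
    isPreconnected_univ (Set.mem_univ z) h
  obtain ⟨s, hs⟩ := (eventually_det_expMatrix_ne_zero_at_zero hτ hn hR).exists
  exact hs (h1 (Set.mem_univ s))

variable (x y : A → ℝ)

-- Adding the equations for a and τa eliminates both R and y, leaving the symmetrized system with
-- right-hand side 1.
include hτ hn in
theorem sum_eq_of_expMatrix_mulVec {u : A → ℂ}
    (h : (desingularizeMatrix τ (expMatrix τ R) 0).mulVec u =
      desingularize τ (fun s a => Complex.exp (-s * y (τ a))) 0) :
    ∑ b, u b = Fintype.card A / (2 - Fintype.card A) := by
  have h0 : ∀ a, desingularize τ (fun s a => Complex.exp (-s * y (τ a))) 0 a =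
      2 + (y a - y (τ a)) := fun a => by
    have h1 := (hasDerivAt_exp_neg_mul (y (τ a))).sub (hasDerivAt_exp_neg_mul (y a))
    rw [desingularize, dslope_same, hτ a]
    erw [h1.deriv]
    simp
    ring
  have h1 : ∀ a, 2 * (u a + u (τ a) - ∑ b, u b) +
      ∑ b, ((R (τ a) b - R a b : ℝ) : ℂ) * u b = 2 + (y a - y (τ a)) := fun a => by
    rw [← desingularizeMatrix_expMatrix_zero hτ, h, h0]
  have h2 := card_eq_of_symmetrized hτ hn (c := 1) (u := u) fun a => by
    have h3 := h1 (τ a)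
    have h4 : ∑ b, ((R a b - R (τ a) b : ℝ) : ℂ) * u b =
        -∑ b, ((R (τ a) b - R a b : ℝ) : ℂ) * u b := by
      rw [← Finset.sum_neg_distrib]
      refine Finset.sum_congr rfl fun b _ => ?_
      push_cast
      ring
    rw [hτ a, h4] at h3
    linear_combination (h1 a + h3) / 4
  rw [h2, one_mul]

include hτ hn hR in
theorem exists_analyticAt_expMatrix_inv :
    ∃ h : ℂ → ℂ, AnalyticAt ℂ h 0 ∧ h 0 = Fintype.card A / (2 - Fintype.card A) ∧
      ∀ᶠ s in 𝓝[≠] 0, (fun a => Complex.exp (-s * x a)) ⬝ᵥ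
        ((expMatrix τ R s)⁻¹.mulVec fun a => Complex.exp (-s * y (τ a))) = h s := by
  set f : ℂ → A → ℂ := fun s a => Complex.exp (-s * y (τ a)) with hf
  set e : ℂ → A → ℂ := fun s a => Complex.exp (-s * x a) with he
  -- The solution of the desingularized system is analytic at 0 and coincides with that of the
  -- original one at nearby s ≠ 0.
  refine ⟨fun s => e s ⬝ᵥ ((desingularizeMatrix τ (expMatrix τ R) s)⁻¹.mulVec
    (desingularize τ f s)), ?_, ?_, ?_⟩
  · refine analyticAt_dotProduct_inv (fun a _ => differentiable_desingularize
      (fun a => differentiable_expMatrix a _) a) (fun a => differentiable_desingularize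
      (fun a => ?_) a) (fun a => ?_) (det_desingularizeMatrix_ne_zero hτ hn hR)
    · simp only [hf]; fun_prop
    · simp only [he]; fun_prop
  · have h1 : e 0 = 1 := by funext a; simp [he]
    beta_reduce
    rw [h1, one_dotProduct]
    refine sum_eq_of_expMatrix_mulVec (R := R) hτ hn y ?_
    rw [Matrix.mulVec_mulVec, Matrix.mul_nonsing_inv _
      (isUnit_iff_ne_zero.2 (det_desingularizeMatrix_ne_zero hτ hn hR)), Matrix.one_mulVec]
  · filter_upwards [(eventually_det_desingularizeMatrix_ne_zero hτ hn hR).filter_mono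
      nhdsWithin_le_nhds, eventually_det_expMatrix_ne_zero_at_zero hτ hn hR,
      self_mem_nhdsWithin] with s hs hs1 hs0
    congr 1
    refine (inv_mulVec_eq hs (desingularizeMatrix_mulVec (expMatrix_zero hτ) (fun a => ?_)
      hs0 ?_)).symm
    · simp [hf]
    · rw [Matrix.mulVec_mulVec, Matrix.mul_nonsing_inv _ (isUnit_iff_ne_zero.2 hs1),
        Matrix.one_mulVec]

include hτ hn in
theorem sum_expMatrix_zero_inv (h0 : (expMatrix τ R 0).det ≠ 0) :
    ∑ a, (expMatrix τ R 0)⁻¹.mulVec 1 a = Fintype.card A / (2 - Fintype.card A) := by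
  have h1 : (expMatrix τ R 0).mulVec ((expMatrix τ R 0)⁻¹.mulVec 1) = 1 := by
    rw [Matrix.mulVec_mulVec, Matrix.mul_nonsing_inv _ (isUnit_iff_ne_zero.2 h0),
      Matrix.one_mulVec]
  generalize (expMatrix τ R 0)⁻¹.mulVec 1 = u at h1
  rw [← one_mul (_ / _)]
  refine card_eq_of_symmetrized hτ hn fun a => ?_
  have h2 := congrFun h1 a
  have e : ∀ b, expMatrix τ R 0 a b * u b =
      (if a = b then u b else 0) + (if τ a = b then u b else 0) - u b := fun b => by
    simp only [expMatrix, Matrix.of_apply, neg_zero, zero_mul, Complex.exp_zero]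
    split_ifs <;> ring
  simpa only [Matrix.mulVec, dotProduct, e, Finset.sum_add_distrib, Finset.sum_sub_distrib,
    Finset.sum_ite_eq, Finset.mem_univ, if_true, Pi.one_apply] using h2

end Analytic


/-! ### The Poincaré series as a sum over all words -/

namespace SchottkyFigure

variable {k : Type*} [NontriviallyNormedField k] [IsUltrametricDist k] [CompleteSpace k]
variable {g : ℕ} {γ : Fin g → PGL(2, k)} (D : SchottkyFigure γ)

/-- The matrix `M(s)` for real `s`. -/
def realM (s : ℝ) : Matrix (Letter g) (Letter g) ℝ := Matrix.of fun a b =>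
  if a.inv ≠ b then Real.exp (-s * rho (D.disk a.inv).boundary (D.disk b).boundary) else 0

/-- The vector `X_x(s)` for real `s`. -/
def realX (x : ProjLine k) (s : ℝ) (a : Letter g) : ℝ :=
  Real.exp (-s * rho x (D.disk a).boundary)

/-- The vector `Y_y(s)` for real `s`. -/
def realY (y : ProjLine k) (s : ℝ) (a : Letter g) : ℝ :=
  Real.exp (-s * rho y (D.disk a.inv).boundary)

theorem realX_pos (x : ProjLine k) (s : ℝ) (a : Letter g) : 0 < D.realX x s a := Real.exp_pos _

theorem realY_pos (y : ProjLine k) (s : ℝ) (a : Letter g) : 0 < D.realY y s a := Real.exp_pos _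

theorem realM_nonneg (s : ℝ) (a b : Letter g) : 0 ≤ D.realM s a b := by
  rw [realM, Matrix.of_apply]
  split_ifs
  exacts [(Real.exp_pos _).le, le_rfl]

theorem realM_of_ne (s : ℝ) {a b : Letter g} (h : a.inv ≠ b) : D.realM s a b =
    Real.exp (-s * rho (D.disk a.inv).boundary (D.disk b).boundary) := if_pos h

theorem realM_inv (s : ℝ) (a : Letter g) : D.realM s a a.inv = 0 := if_neg (not_not.2 rfl)

theorem one_sub_M_ofReal (s : ℝ) : 1 - D.M s = (1 - D.realM s).map Complex.ofReal := by
  ext a b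
  simp only [M, realM, Matrix.sub_apply, Matrix.map_apply, Matrix.of_apply, Matrix.one_apply]
  split_ifs <;> simp

theorem X_ofReal (x : ProjLine k) (s : ℝ) (a : Letter g) : D.X x s a = D.realX x s a := by
  simp [X, realX]

theorem Y_ofReal (y : ProjLine k) (s : ℝ) (a : Letter g) : D.Y y s a = D.realY y s a := by
  simp [Y, realY]

/-- The weight `exp(-s ρ(x, w y))` of the word `w` if it is reduced, as a product along `w`. -/
def term (x y : ProjLine k) (s : ℝ) : List (Letter g) → ℝ :=
  wordTerm (D.realX x s) (D.realY y s) (D.realM s) (Real.exp (-s * rho x y))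

variable {x y : ProjLine k} {s : ℝ}

theorem wordWeight_eq_exp (hy : y ∈ hyperbolicSpace k) (hyF : y ∈ D.fundamentalDomain)
    (a : Letter g) (l : List (Letter g)) (h : FreeGroup.IsReduced (a :: l)) :
    wordWeight (D.realY y s) (D.realM s) a l =
      Real.exp (-s * rho (D.disk a.inv).boundary (wordElt γ l • y)) := by
  induction l generalizing a with
  | nil => rw [wordWeight, realY, rho_comm, wordElt_nil, one_smul]
  | cons b l ih =>
    have h' := FreeGroup.isReduced_cons_cons.1 h
    rw [wordWeight, ih b h'.2, D.realM_of_ne s ((Letter.inv_ne_iff a b).2 h'.1), ← Real.exp_add,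
      D.rho_boundary_wordElt hy hyF a b l h, mul_add]

/-- A cancelling pair a a⁻¹ meets a zero entry of M, so sums over the group may be taken over all
words. -/
theorem wordWeight_eq_zero (a : Letter g) (l : List (Letter g))
    (h : ¬ FreeGroup.IsReduced (a :: l)) : wordWeight (D.realY y s) (D.realM s) a l = 0 := by
  induction l generalizing a with
  | nil => exact absurd (by simp) h
  | cons b l ih =>
    rw [FreeGroup.isReduced_cons_cons, ← Letter.inv_ne_iff, not_and_or, not_not] at h
    rcases h with h | h
    · rw [wordWeight, ← h, realM_inv, zero_mul]
    · rw [wordWeight, ih b h, mul_zero]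

theorem term_eq_exp (hx : x ∈ hyperbolicSpace k) (hy : y ∈ hyperbolicSpace k)
    (hxF : x ∈ D.fundamentalDomain) (hyF : y ∈ D.fundamentalDomain) (l : List (Letter g))
    (h : FreeGroup.IsReduced l) : D.term x y s l = Real.exp (-s * rho x (wordElt γ l • y)) := by
  cases l with
  | nil => rw [wordElt_nil, one_smul]; rfl
  | cons a l =>
    rw [term, wordTerm, D.wordWeight_eq_exp hy hyF a l h, realX, ← Real.exp_add,
      D.rho_wordElt hx hy hxF hyF a l h, mul_add]

theorem term_eq_zero (l : List (Letter g)) (h : ¬ FreeGroup.IsReduced l) :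
    D.term x y s l = 0 := by
  cases l with
  | nil => exact absurd (by simp) h
  | cons a l => rw [term, wordTerm, D.wordWeight_eq_zero a l h, mul_zero]

variable {Γ : Subgroup PGL(2, k)}

/-- The free group on the basis, as a group acting on the projective line. -/
def freeGroupEquiv (hΓ : Subgroup.closure (Set.range γ) = Γ)
    (hinj : Function.Injective (FreeGroup.lift γ)) : FreeGroup (Fin g) ≃ Γ :=
  (MonoidHom.ofInjective hinj).toEquiv.trans
    (Equiv.setCongr (congrArg (fun H : Subgroup PGL(2, k) => (H : Set PGL(2, k)))
      (FreeGroup.range_lift_eq_closure.trans hΓ)))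

omit [IsUltrametricDist k] [CompleteSpace k] in
theorem coe_freeGroupEquiv (hΓ : Subgroup.closure (Set.range γ) = Γ)
    (hinj : Function.Injective (FreeGroup.lift γ)) (w : FreeGroup (Fin g)) :
    ((freeGroupEquiv hΓ hinj w : Γ) : PGL(2, k)) = FreeGroup.lift γ w := rfl

theorem poincareTerm_freeGroupEquiv (hΓ : Subgroup.closure (Set.range γ) = Γ)
    (hx : x ∈ hyperbolicSpace k) (hy : y ∈ hyperbolicSpace k)
    (hxF : x ∈ D.fundamentalDomain) (hyF : y ∈ D.fundamentalDomain) :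
    poincareTerm Γ x y s ∘ freeGroupEquiv hΓ (D.lift_injective hxF) =
      D.term x y s ∘ FreeGroup.toWord := by
  funext w
  simp only [Function.comp_apply]
  rw [poincareTerm, coe_freeGroupEquiv, ← wordElt_toWord,
    D.term_eq_exp hx hy hxF hyF _ FreeGroup.isReduced_toWord]

theorem support_term_subset :
    Function.support (D.term x y s) ⊆ Set.range (FreeGroup.toWord (α := Fin g)) := by
  intro l hl
  by_cases h : FreeGroup.IsReduced l
  · exact ⟨FreeGroup.mk l, by rw [FreeGroup.toWord_mk, h.reduce_eq]⟩
  · exact absurd (D.term_eq_zero l h) hl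

theorem summable_poincareTerm_iff (hΓ : Subgroup.closure (Set.range γ) = Γ)
    (hx : x ∈ hyperbolicSpace k) (hy : y ∈ hyperbolicSpace k)
    (hxF : x ∈ D.fundamentalDomain) (hyF : y ∈ D.fundamentalDomain) :
    Summable (poincareTerm Γ x y s) ↔ Summable (D.term x y s) := by
  rw [← (freeGroupEquiv hΓ (D.lift_injective hxF)).summable_iff,
    D.poincareTerm_freeGroupEquiv hΓ hx hy hxF hyF]
  exact FreeGroup.toWord_injective.summable_iff fun l hl => Function.notMem_support.1 fun h =>
    hl (D.support_term_subset h)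

theorem poincareSeries_eq (hΓ : Subgroup.closure (Set.range γ) = Γ)
    (hx : x ∈ hyperbolicSpace k) (hy : y ∈ hyperbolicSpace k)
    (hxF : x ∈ D.fundamentalDomain) (hyF : y ∈ D.fundamentalDomain) :
    poincareSeries Γ x y s = ∑' l, D.term x y s l := by
  rw [poincareSeries, ← (freeGroupEquiv hΓ (D.lift_injective hxF)).tsum_eq]
  change ∑' w, (poincareTerm Γ x y s ∘ freeGroupEquiv hΓ (D.lift_injective hxF)) w = _
  rw [D.poincareTerm_freeGroupEquiv hΓ hx hy hxF hyF]
  exact FreeGroup.toWord_injective.tsum_eq D.support_term_subset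

theorem exists_summable_term (x y : ProjLine k) :
    ∃ σ : ℝ, ∀ s : ℝ, σ < s → Summable (D.term x y s) := by
  obtain ⟨δ, hδ, hmin⟩ := D.exists_min_rho_boundary
  -- The entries of M(s) are at most exp(-sδ) for s ≥ 0, so for large s the row sums drop below 1/2.
  have hlim : Filter.Tendsto (fun s : ℝ => Fintype.card (Letter g) * Real.exp (-s * δ))
      Filter.atTop (nhds 0) := by
    have h1 : Filter.Tendsto (fun s : ℝ => -s * δ) Filter.atTop Filter.atBot := by
      simp only [neg_mul, Filter.tendsto_neg_atBot_iff]
      exact Filter.tendsto_id.atTop_mul_const hδ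
    simpa using (Real.tendsto_exp_atBot.comp h1).const_mul (Fintype.card (Letter g) : ℝ)
  obtain ⟨σ, hσ⟩ := Filter.eventually_atTop.1
    ((hlim.eventually_le_const (u := 1 / 2) (by norm_num)).and (Filter.eventually_ge_atTop 0))
  refine ⟨σ, fun s hs => ?_⟩
  obtain ⟨h1, h0⟩ := hσ s hs.le
  refine (summable_wordTerm_iff (fun a => (D.realX_pos x s a).le)
    (fun a => (D.realY_pos y s a).le) (D.realM_nonneg s) (Real.exp_pos _).le).2
    (summable_of_row_sum_le (fun a => (D.realX_pos x s a).le)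
      (fun a => (D.realY_pos y s a).le) (D.realM_nonneg s) fun a => ?_)
  have h2 : ∀ b, D.realM s a b ≤ Real.exp (-s * δ) := fun b => by
    by_cases h : a.inv = b
    · rw [← h, realM_inv]
      exact (Real.exp_pos _).le
    · rw [D.realM_of_ne s h, Real.exp_le_exp, neg_mul, neg_mul, neg_le_neg_iff]
      exact mul_le_mul_of_nonneg_left (hmin _ _ h) h0
  refine (Finset.sum_le_sum fun b _ => h2 b).trans (le_trans (le_of_eq ?_) h1)
  rw [Finset.sum_const, Finset.card_univ, nsmul_eq_mul]

theorem tsum_term_eq (h : Summable (D.term x y s)) : (1 - D.M s).det ≠ 0 ∧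
    ((∑' l, D.term x y s l : ℝ) : ℂ) = D.X x s ⬝ᵥ ((1 - D.M s)⁻¹.mulVec (D.Y y s)) +
      Complex.exp (-s * rho x y) := by
  have h1 := (summable_wordTerm_iff (fun a => (D.realX_pos x s a).le)
    (fun a => (D.realY_pos y s a).le) (D.realM_nonneg s) (Real.exp_pos _).le).1 h
  obtain ⟨hdet, u, hu, hsum⟩ :=
    exists_geometric_sum (D.realX_pos x s) (D.realY_pos y s) (D.realM_nonneg s) h1
  have hdet' : (1 - D.M s).det ≠ 0 := by
    rw [one_sub_M_ofReal]
    have := RingHom.map_det Complex.ofRealHom (1 - D.realM s)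
    rw [RingHom.mapMatrix_apply] at this
    change ((1 - D.realM s).map Complex.ofRealHom).det ≠ 0
    rw [← this]
    exact Complex.ofReal_ne_zero.2 hdet
  refine ⟨hdet', ?_⟩
  have hu' : (1 - D.M s).mulVec (fun a => (u a : ℂ)) = D.Y y s := by
    funext a
    rw [one_sub_M_ofReal, Y_ofReal, ← hu]
    simp [Matrix.mulVec, dotProduct]
  rw [inv_mulVec_eq hdet' hu', term, tsum_wordTerm h, hsum, add_comm]
  simp [dotProduct, X_ofReal]

/-- The distances of the boundary points. -/
abbrev boundaryRho (a b : Letter g) : ℝ := rho (D.disk a).boundary (D.disk b).boundary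

/-- At b = a⁻¹ the exponential is exp 0 = 1, as the distance of a boundary point to itself is 0;
adding the matrix of τ compensates for it. -/
theorem one_sub_M (s : ℂ) : 1 - D.M s = expMatrix Letter.inv D.boundaryRho s := by
  ext a b
  simp only [M, expMatrix, Matrix.sub_apply, Matrix.of_apply, Matrix.one_apply]
  by_cases h : a.inv = b
  · subst h
    simp [rho_self]
  · simp [h]

end SchottkyFigure

theorem rho_smul_smul {k : Type*} [NontriviallyNormedField k] [IsUltrametricDist k]
    [CompleteSpace k] {x y : ProjLine k} (hx : x ∈ hyperbolicSpace k) (hy : y ∈ hyperbolicSpace k)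
    (α β δ : PGL(2, k)) : rho (α • x) ((α * δ * β⁻¹) • β • y) = rho x (δ • y) := by
  rw [smul_smul, inv_mul_cancel_right, mul_smul, rho_smul α hx (smul_mem_hyperbolicSpace δ hy)]

/-- The substitution δ ↦ αδβ⁻¹ permutes Γ and reduces the series to base points in F. -/
theorem poincareTerm_comp {k : Type*} [NontriviallyNormedField k] [IsUltrametricDist k]
    [CompleteSpace k] {Γ : Subgroup PGL(2, k)} {x y : ProjLine k} (hx : x ∈ hyperbolicSpace k)
    (hy : y ∈ hyperbolicSpace k) (α β : Γ) (s : ℝ) :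
    poincareTerm Γ ((α : PGL(2, k)) • x) ((β : PGL(2, k)) • y) s ∘
      (Equiv.mulLeft α).trans (Equiv.mulRight β⁻¹) = poincareTerm Γ x y s := by
  funext δ
  simp only [Function.comp_apply, poincareTerm, Equiv.trans_apply, Equiv.coe_mulLeft,
    Equiv.coe_mulRight, Subgroup.coe_mul, Subgroup.coe_inv, rho_smul_smul hx hy]

end Berkovich

end

/-! ### The main theorem -/

open Berkovich in
theorem mainTheorem2 {k : Type*} [NontriviallyNormedField k] [IsUltrametricDist k] [CompleteSpace k]
    (Γ : Subgroup PGL(2, k)) (hΓ : IsSchottkyGroup Γ) {g : ℕ} (hg : 1 < g)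
    (γ : Fin g → PGL(2, k)) (hγ : IsBasis Γ γ) (D : SchottkyFigure γ) :
    -- every point of the hyperbolic space has a translate in the fundamental domain
    (∀ x ∈ hyperbolicSpace k, ∃ α ∈ Γ, α • x ∈ D.fundamentalDomain) ∧
    ∀ x ∈ hyperbolicSpace k, ∀ y ∈ hyperbolicSpace k,
    ∀ α ∈ Γ, ∀ β ∈ Γ, α • x ∈ D.fundamentalDomain → β • y ∈ D.fundamentalDomain →
      -- the Poincaré series converges for large real `s`
      (∃ σ : ℝ, ∀ s : ℝ, σ < s → Summable (poincareTerm Γ x y s)) ∧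
      -- `I - M(s)` is invertible outside a closed discrete set
      (∀ z : ℂ, ∀ᶠ s in nhdsWithin z {z}ᶜ, (1 - D.M s).det ≠ 0) ∧
      -- the meromorphic extension
      ∃ P : ℂ → ℂ, MeromorphicOn P Set.univ ∧
        (∀ s : ℝ, 0 ≤ s → Summable (poincareTerm Γ x y s) →
          (1 - D.M s).det ≠ 0 ∧ P s = poincareSeries Γ x y s) ∧
        (∀ s : ℂ, (1 - D.M s).det ≠ 0 →
          P s = D.X (α • x) s ⬝ᵥ ((1 - D.M s)⁻¹.mulVec (D.Y (β • y) s)) +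
            Complex.exp (-s * rho (α • x) (β • y))) ∧
        AnalyticAt ℂ P 0 ∧ P 0 = 1 / (1 - (g : ℂ)) := by
  refine ⟨fun x hx => D.exists_smul_mem_fundamentalDomain
    (fun i => hγ.1 ▸ Subgroup.subset_closure (Set.mem_range_self i)) hx, ?_⟩
  intro x hx y hy α hα β hβ hαx hβy
  have hx' := smul_mem_hyperbolicSpace α hx
  have hy' := smul_mem_hyperbolicSpace β hy
  have hcomp := fun s => poincareTerm_comp hx hy (⟨α, hα⟩ : Γ) ⟨β, hβ⟩ s
  have hsummable : ∀ s, Summable (poincareTerm Γ x y s) ↔ Summable (D.term (α • x) (β • y) s) :=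
    fun s => by
      rw [← D.summable_poincareTerm_iff hγ.1 hx' hy' hαx hβy, ← hcomp s, Equiv.summable_iff]
  have hseries : ∀ s, poincareSeries Γ x y s = ∑' l, D.term (α • x) (β • y) s l := fun s => by
    rw [← D.poincareSeries_eq hγ.1 hx' hy' hαx hβy, poincareSeries, ← hcomp s]
    exact Equiv.tsum_eq _ _
  have hinv : Function.Involutive (Letter.inv : Letter g → Letter g) := Letter.inv_inv
  have hcard : Fintype.card (Letter g) = 2 * g := by simp [mul_comm]
  have hn : Fintype.card (Letter g) ≠ 2 := by omega
  have hR : ∀ v : Letter g → ℝ, v ≠ 0 → ∑ a, v a = 0 →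
      ∑ a, ∑ b, v a * v b * D.boundaryRho a b < 0 := fun v => D.sum_rho_boundary_neg
  -- With 2g letters: 2g/(2 - 2g) + 1 = 1/(1 - g), the 1 coming from the empty word.
  have hval : (Fintype.card (Letter g) / (2 - Fintype.card (Letter g)) : ℂ) + 1 =
      1 / (1 - (g : ℂ)) := by
    have h1 : (1 - g : ℂ) ≠ 0 := by
      rw [sub_ne_zero]
      exact_mod_cast hg.ne
    have h2 : (2 - 2 * g : ℂ) ≠ 0 := by
      rw [show (2 - 2 * g : ℂ) = 2 * (1 - g) by ring]
      exact mul_ne_zero two_ne_zero h1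
    rw [hcard]
    push_cast
    field_simp
    ring
  have hdet : ∀ z : ℂ, ∀ᶠ s in nhdsWithin z {z}ᶜ, (1 - D.M s).det ≠ 0 := by
    simp only [D.one_sub_M]
    exact eventually_det_expMatrix_ne_zero hinv hn hR
  set Q : ℂ → ℂ := fun s => D.X (α • x) s ⬝ᵥ ((1 - D.M s)⁻¹.mulVec (D.Y (β • y) s)) +
    Complex.exp (-s * rho (α • x) (β • y)) with hQ
  have hQ0 : (1 - D.M 0).det ≠ 0 → Q 0 = 1 / (1 - (g : ℂ)) := fun h => by
    rw [D.one_sub_M] at h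
    have hX : D.X (α • x) 0 = 1 := by funext a; simp [SchottkyFigure.X]
    have hY : D.Y (β • y) 0 = 1 := by funext a; simp [SchottkyFigure.Y]
    rw [← hval, ← sum_expMatrix_zero_inv hinv hn h]
    simp [hQ, hX, hY, D.one_sub_M, one_dotProduct]
  obtain ⟨h, hh, hh0, hev⟩ := exists_analyticAt_expMatrix_inv hinv hn hR
    (fun a => rho (α • x) (D.disk a).boundary) (fun a => rho (β • y) (D.disk a).boundary)
  have hexp : Differentiable ℂ fun s : ℂ => Complex.exp (-s * rho (α • x) (β • y)) := by fun_prop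
  -- The rows a and a⁻¹ of I - M(0) coincide, so Q 0 is computed from the default inverse of a
  -- singular matrix; the extension replaces it by the limit 1/(1 - g).
  have hP : ∀ s : ℂ, s ≠ 0 → Function.update Q 0 (1 / (1 - (g : ℂ))) s = Q s :=
    fun s hs => Function.update_of_ne hs _ _
  have hPM : ∀ s : ℂ, (1 - D.M s).det ≠ 0 → Function.update Q 0 (1 / (1 - (g : ℂ))) s = Q s := by
    intro s hs
    rcases eq_or_ne s 0 with rfl | h0
    · rw [Function.update_self, hQ0 hs]
    · exact hP s h0
  refine ⟨?_, hdet, Function.update Q 0 (1 / (1 - (g : ℂ))), ?_, ?_, hPM, ?_, by simp⟩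
  · obtain ⟨σ, hσ⟩ := D.exists_summable_term (α • x) (β • y)
    exact ⟨σ, fun s hs => (hsummable s).2 (hσ s hs)⟩
  · intro z _
    have hQz : MeromorphicAt Q z := by
      simp only [hQ, D.one_sub_M]
      refine (meromorphicAt_dotProduct_inv (fun a b => differentiable_expMatrix a b)
        (fun a => ?_) (fun a => ?_) z).add (hexp.analyticAt z).meromorphicAt
      · simp only [SchottkyFigure.Y]; fun_prop
      · simp only [SchottkyFigure.X]; fun_prop
    exact hQz.congr ((hdet z).mono fun s hs => (hPM s hs).symm)
  · intro s _ hs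
    obtain ⟨h1, h2⟩ := D.tsum_term_eq ((hsummable s).1 hs)
    exact ⟨h1, by rw [hPM s h1, hseries, h2]⟩
  · refine (hh.add (hexp.analyticAt 0)).congr ?_
    -- Agreement with the analytic function is checked at 0, where it is the computed value, and on
    -- a punctured neighbourhood.
    rw [Filter.EventuallyEq, ← pure_sup_nhdsNE, Filter.eventually_sup]
    refine ⟨?_, ?_⟩
    · rw [Filter.eventually_pure, Function.update_self, ← hval, ← hh0]
      simp
    · filter_upwards [hev, self_mem_nhdsWithin] with s hs hs0
      rw [hP s hs0, Pi.add_apply, ← hs]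
      simp only [hQ, D.one_sub_M]
      rfl
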